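/- Let $\omega_1,\tau>0$, let $\Lambda=2\omega_1\mathbb Z+2i\tau\mathbb Z$, let $\Omega=2\omega_1[0,1)+2i\tau[0,1)$ be the fundamental rectangle, and put $\gamma_1=[0,2\omega_1)$, $\gamma_2=i\tau+[0,2\omega_1)$. For $a\in\Omega\setminus\{0\}$ and an integer $n\ge 0$, let $\mathcal L(n\cdot 0+a)$ be the space of $\Lambda$-periodic meromorphic functions on $\mathbb C$ that are holomorphic off $\Lambda\cup(a+\Lambda)$, have a pole of order at most $n$ at $0$ and at most a simple pole at $a$. Let $\Gamma\in\{\gamma_1,\gamma_2\}$, let $a\in(\gamma_1\cup\gamma_2)\setminus\Gamma$, $a\neq 0$, and let $W$ be a real weight on $\Gamma$ that is positive almost everywhere and for which all integrals $\int_\Gamma P(s)Q(s)W(s)\,ds$ with $P,Q\in\bigcup_m\mathcal L(m\cdot 0+a)$ converge absolutely. The $n$-th orthonormal elliptic $a$-polynomial $f_n$ is a function $f_n\in\mathcal L(n\cdot 0+a)$ such that $\int_\Gamma f_nQW\,ds=0$ for all $Q\in\mathcal L((n-1)\cdot 0+a)$ (no condition if $n=0$), $\int_\Gamma f_n^2W\,ds=1$,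 and $\lim_{z\to0}z^nf_n(z)$ is a strictly positive real number. For functions $F,G$ with zeros $z_1,\dots,z_N$ and $w_1,\dots,w_M$ in a contour $\gamma$, counted with multiplicity, write $F\prec G$ in $\gamma$ if, after ordering, either $M=N$ and $\Re z_1<\Re w_1<\Re z_2<\cdots<\Re z_N<\Re w_N$, or $M=N-1$ and $\Re z_1<\Re w_1<\Re z_2<\cdots<\Re w_{N-1}<\Re z_N$. Then $f_n$ exists for every $n\ge 0$, all zeros of $f_n$ are simple, and the following holds for every $n\ge0$. (i) Let $\Gamma=\gamma_1$ (so $a\in\gamma_2$). Then $f_n$ has exactly $n$ zeros on $\gamma_1$. It has a zero on $\gamma_2$ if and only if it has a pole at $a$; there is at most one such zero, and $f_n$ has no zeros in $\Omega\setminus(\gamma_1\cup\gamma_2)$. Moreover, $f_{n+1}\prec f_n$ in $\gamma_1$. (ii) Let $\Gamma=\gamma_2$ (so $a\in\gamma_1\setminus\{0\}$). - If $n$ is even, $f_n$ has exactly $n$ zeros on $\gamma_2$. It has a zero on $\gamma_1$ if and only if it has a pole at $a$; there is at most one such zero, and $f_n$ has no zeros in $\Omega\setminus(\gamma_1\cup\gamma_2)$.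 - If $n$ is odd, $f_n$ has exactly $n+1$ zeros on $\gamma_2$, no other zeros in $\Omega$, and a pole at $a$. Moreover, $f_n\prec f_{n+1}$ in $\gamma_2$ or $f_{n+1}\prec f_n$ in $\gamma_2$. (iii) For fixed $W$ on $\Gamma$ (admissible for all the $a$ considered), the zeros of $f_n=f_n(\cdot;a)$ are real-analytic functions of the parameter $a$, where $a=s+i\tau$, $s\in\mathbb R$, if $\Gamma=\gamma_1$, and $a=s$, $s\in(0,2\omega_1)$, if $\Gamma=\gamma_2$. That is, for every $s_0$ and every zero $z_0\in\mathbb C$ of $f_n(\cdot;a(s_0))$ there is a function $Z$, real-analytic at $s_0$, with $Z(s_0)=z_0$, such that for all $s$ close to $s_0$ the point $Z(s)$ is a zero of $f_n(\cdot;a(s))$, and the only one in some fixed neighbourhood of $z_0$. -/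

import Mathlib

open MeasureTheory Filter
open scoped Topology

/-- The rectangular lattice `Λ = 2ω₁ ℤ + 2iτ ℤ` (half-periods `ω₁ > 0` and `ω₃ = iτ`, `τ > 0`). -/
def rectLattice (ω₁ τ : ℝ) : Submodule ℤ ℂ :=
  Submodule.span ℤ {(2 * ω₁ : ℂ), (2 * τ * Complex.I : ℂ)}

/-- The fundamental rectangle `Ω = 2ω₁ [0,1) + 2iτ [0,1)`. -/
def fundRect (ω₁ τ : ℝ) : Set ℂ :=
  {z | z.re ∈ Set.Ico 0 (2 * ω₁) ∧ z.im ∈ Set.Ico 0 (2 * τ)}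

/-- The horizontal contour `ih + [0, 2ω₁)`. Thus `γ₁ = horContour ω₁ 0` and
`γ₂ = horContour ω₁ τ`. -/
def horContour (ω₁ h : ℝ) : Set ℂ :=
  {z | z.re ∈ Set.Ico 0 (2 * ω₁) ∧ z.im = h}

/-- The point of the horizontal line at height `h` with abscissa `t`. -/
noncomputable def horPoint (h t : ℝ) : ℂ := (t : ℂ) + (h : ℂ) * Complex.I

/-- The space `𝓛(n·0 + a)`: elliptic functions with period lattice `Λ`, holomorphic off
`Λ ∪ (a + Λ)`, with a pole of order at most `n` at `0` and at most a simple pole at `a`.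
A function is represented by a map `ℂ → ℂ` whose values at `Λ ∪ (a + Λ)` are irrelevant: zeros and
poles are read off from the meromorphic order, never from the value of the map. -/
structure IsEllipticPoly (ω₁ τ : ℝ) (a : ℂ) (n : ℕ) (f : ℂ → ℂ) : Prop where
  meromorphic : ∀ z, MeromorphicAt f z
  periodic : ∀ l ∈ rectLattice ω₁ τ, ∀ z, f (z + l) = f z
  holomorphic : ∀ z, z ∉ rectLattice ω₁ τ → z - a ∉ rectLattice ω₁ τ → AnalyticAt ℂ f z
  order_zero : ((-(n : ℤ) : ℤ) : WithTop ℤ) ≤ meromorphicOrderAt f 0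
  order_anchor : ((-1 : ℤ) : WithTop ℤ) ≤ meromorphicOrderAt f a

/-- `∫_Γ P(s) Q(s) W(s) ds` over the contour `Γ = ih + [0, 2ω₁)`. -/
noncomputable def contourPairing (ω₁ h : ℝ) (W : ℂ → ℝ) (P Q : ℂ → ℂ) : ℂ :=
  ∫ t in (0 : ℝ)..(2 * ω₁), P (horPoint h t) * Q (horPoint h t) * (W (horPoint h t) : ℂ)

/-- `W` is a positive weight on `Γ = ih + [0, 2ω₁)` for the anchor `a`: it is positive
almost everywhere on `Γ`, and all the integrals `∫_Γ P Q W ds` of elliptic `a`-polynomials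
`P`, `Q` converge absolutely. -/
structure IsPosWeight (ω₁ τ h : ℝ) (a : ℂ) (W : ℂ → ℝ) : Prop where
  pos : ∀ᵐ t ∂(volume.restrict (Set.Ioo 0 (2 * ω₁))), 0 < W (horPoint h t)
  integrable : ∀ (m : ℕ) (P Q : ℂ → ℂ), IsEllipticPoly ω₁ τ a m P → IsEllipticPoly ω₁ τ a m Q →
    IntervalIntegrable
      (fun t : ℝ => P (horPoint h t) * Q (horPoint h t) * (W (horPoint h t) : ℂ))
      volume 0 (2 * ω₁)

/-- `f` is the `n`-th orthonormal elliptic `a`-polynomial for the weight `W` on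
`Γ = ih + [0, 2ω₁)`, normalized to have a strictly positive leading coefficient `c`,
`f(z) = c / zⁿ + O(1 / zⁿ⁻¹)` as `z → 0`.
(For `n = 0` there is no orthogonality condition, as `𝓛((-1)·0 + a) = {0}`.) -/
structure IsOrthonormalEOP (ω₁ τ h : ℝ) (W : ℂ → ℝ) (a : ℂ) (n : ℕ) (f : ℂ → ℂ) : Prop where
  mem : IsEllipticPoly ω₁ τ a n f
  orthogonal : ∀ m < n, ∀ Q : ℂ → ℂ, IsEllipticPoly ω₁ τ a m Q → contourPairing ω₁ h W f Q = 0
  normalized : contourPairing ω₁ h W f f = 1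
  leading_pos : ∃ c : ℝ, 0 < c ∧ Tendsto (fun z : ℂ => z ^ n * f z) (𝓝[≠] 0) (𝓝 (c : ℂ))

/-- `z` is a zero of the meromorphic function `f`. -/
def IsMeroZero (f : ℂ → ℂ) (z : ℂ) : Prop := 0 < meromorphicOrderAt f z

/-- `z` is a simple zero of the meromorphic function `f`. -/
def IsSimpleMeroZero (f : ℂ → ℂ) (z : ℂ) : Prop := meromorphicOrderAt f z = 1

/-- `z` is a pole of the meromorphic function `f`. -/
def HasPoleAt (f : ℂ → ℂ) (z : ℂ) : Prop := meromorphicOrderAt f z < 0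

/-- The set of zeros of `f` in `S`. -/
def meroZeros (f : ℂ → ℂ) (S : Set ℂ) : Set ℂ := {z | z ∈ S ∧ IsMeroZero f z}

/-- `z₁, …, z_N` is the list of the zeros of `f` in `γ`, each repeated according to its
multiplicity. -/
def IsZeroList (f : ℂ → ℂ) (γ : Set ℂ) {N : ℕ} (z : Fin N → ℂ) : Prop :=
  (∀ i, z i ∈ γ) ∧
    ∀ w ∈ γ, ((({i | z i = w} : Set (Fin N)).ncard : ℤ) : WithTop ℤ) =
      max (meromorphicOrderAt f w) 0

/-- Strict interlacing `F ≺ G` in `γ`: with `z₁, …, z_n` and `w₁, …, w_m` the zeros of `F` and `G`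
in `γ`, counted with multiplicity, either
`m = n` and `Re z₁ < Re w₁ < Re z₂ < ⋯ < Re z_n < Re w_n`, or
`m = n - 1` and `Re z₁ < Re w₁ < Re z₂ < ⋯ < Re w_{n-1} < Re z_n`. -/
def StrictlyInterlaces (γ : Set ℂ) (F G : ℂ → ℂ) : Prop :=
  (∃ (n : ℕ) (z w : Fin n → ℂ), IsZeroList F γ z ∧ IsZeroList G γ w ∧
    (∀ i, (z i).re < (w i).re) ∧
    ∀ i j : Fin n, (j : ℕ) = i + 1 → (w i).re < (z j).re) ∨
  (∃ (m : ℕ) (z : Fin (m + 1) → ℂ) (w : Fin m → ℂ), IsZeroList F γ z ∧ IsZeroList G γ w ∧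
    ∀ i : Fin m, (z i.castSucc).re < (w i).re ∧ (w i).re < (z i.succ).re)

/-- The zeros of the one-parameter family `F s` are real-analytic functions of `s` near `s₀`:
every zero `z₀` of `F s₀` lies on a real-analytic curve `s ↦ Z s` with `Z s₀ = z₀` such that, for
`s` near `s₀`, the point `Z s` is a zero of `F s`, and is its only zero near `z₀`. -/
def ZerosAnalyticAt (F : ℝ → ℂ → ℂ) (s₀ : ℝ) : Prop :=
  ∀ z₀ : ℂ, IsMeroZero (F s₀) z₀ →
    ∃ Z : ℝ → ℂ, AnalyticAt ℝ Z s₀ ∧ Z s₀ = z₀ ∧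
      (∀ᶠ s in 𝓝 s₀, IsMeroZero (F s) (Z s)) ∧
      ∃ U ∈ 𝓝 z₀, ∀ᶠ s in 𝓝 s₀, ∀ z ∈ U, IsMeroZero (F s) z → z = Z s

/-! The space `𝓛(n·0 + a)` has dimension `n + 1`, with basis `1`, `ζ(z) - ζ(z - a)`, `℘`, `℘'`, …,
whose orders at `0` are `0, -1, -2, …`. It reduces to the constants for `n = 0` because no elliptic
function has a single simple pole (`exists_const_of_zero`). Since `conj a ≡ a` modulo `Λ`, the
reflection `f ↦ conj (f (conj z))` preserves the space. On `γ₁` and `γ₂`, which conjugation fixes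
modulo `Λ`, it is plain conjugation of values. Pairing `f` with its reflection gives `∫ |f|² W > 0`,
so the Gram matrix is invertible. Hence the orthogonal function exists, is unique up to a factor,
and is real on both lines.

The zeros are located by counting. The orders over `Ω` add up to `0` (`finsum_ordZ_fundRect`), a
function real on a line has even total order along one period of it (`even_finsum_horContour`), and
poles occur only at `0` and `a`. If `f` is orthogonal to all `𝓛(m·0 + a)` with `m < n` but has only
`k < n` points of odd order on `Γ` away from `0`, there is a real `Q` in `𝓛(k·0 + a)` vanishing at
these points. Counting shows that `Q` has simple zeros there and no other zeros on `Γ` away from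
`0`. Thus `f Q` has constant sign on `Γ`, contradicting `∫ f Q W = 0` (`le_card_odd`). So there are
at least `n` zeros on `Γ`, and parity can supply one more. The available poles leave no room for
further zeros, except for a simple zero that balances a pole at `a` when the parity on the line of
`a` allows it.

The gain from parity also gives interlacing. A real combination of `f_{n+1}` and `f_n` satisfies one
orthogonality condition fewer, yet still has only simple zeros on `Γ` (for `Γ = γ₂` this needs `n`
odd). Therefore the Wronskian of the two functions does not vanish on `Γ`, and Rolle's theorem
applied to their quotient separates the zeros.

For the dependence on `a`, Cramer's rule writes the coefficients of an orthogonal function as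
polynomials in the Gram entries. These entries are analytic in `a`, because only `ζ(z - a)` involves
`a` and it is regular on `Γ`. Since the zeros are simple, the implicit function theorem finishes the
proof. -/

/-! ### The rectangular lattice and its fundamental rectangle. -/

lemma mem_rectLattice {ω₁ τ : ℝ} {z : ℂ} :
    z ∈ rectLattice ω₁ τ ↔ ∃ m n : ℤ, (m : ℂ) * (2 * ω₁) + n * (2 * τ * Complex.I) = z := by
  simp only [rectLattice, Submodule.mem_span_pair, zsmul_eq_mul]

lemma mem_rectLattice_iff_re_im {ω₁ τ : ℝ} {z : ℂ} :
    z ∈ rectLattice ω₁ τ ↔ ∃ m n : ℤ, z.re = m * (2 * ω₁) ∧ z.im = n * (2 * τ) := by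
  rw [mem_rectLattice]
  refine exists_congr fun m => exists_congr fun n => ?_
  rw [Complex.ext_iff]
  simp [eq_comm]

lemma conj_mem_rectLattice {ω₁ τ : ℝ} {z : ℂ} :
    (starRingEnd ℂ) z ∈ rectLattice ω₁ τ ↔ z ∈ rectLattice ω₁ τ := by
  have key : ∀ w ∈ rectLattice ω₁ τ, (starRingEnd ℂ) w ∈ rectLattice ω₁ τ := by
    intro w hw
    obtain ⟨m, n, h1, h2⟩ := mem_rectLattice_iff_re_im.1 hw
    exact mem_rectLattice_iff_re_im.2 ⟨m, -n, by simpa using h1, by simp [h2]⟩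
  exact ⟨fun h => by simpa using key _ h, key z⟩

/-- The period pair of the rectangular lattice. -/
noncomputable def rectPeriodPair {ω₁ τ : ℝ} (hω₁ : 0 < ω₁) (hτ : 0 < τ) : PeriodPair where
  ω₁ := 2 * ω₁
  ω₂ := 2 * τ * Complex.I
  indep := by
    rw [LinearIndependent.pair_iff]
    intro s t h
    rw [Complex.ext_iff] at h
    simpa [hω₁.ne', hτ.ne'] using h

lemma isClosed_rectLattice {ω₁ τ : ℝ} (hω₁ : 0 < ω₁) (hτ : 0 < τ) :
    IsClosed (rectLattice ω₁ τ : Set ℂ) :=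
  (rectPeriodPair hω₁ hτ).isClosed_lattice

lemma exists_add_mem_fundRect {ω₁ τ : ℝ} (hω₁ : 0 < ω₁) (hτ : 0 < τ) (z : ℂ) :
    ∃ l ∈ rectLattice ω₁ τ, z + l ∈ fundRect ω₁ τ := by
  have h1 : (0 : ℝ) < 2 * ω₁ := by positivity
  have h2 : (0 : ℝ) < 2 * τ := by positivity
  obtain ⟨m, hm, -⟩ := existsUnique_add_zsmul_mem_Ico h1 z.re 0
  obtain ⟨n, hn, -⟩ := existsUnique_add_zsmul_mem_Ico h2 z.im 0
  refine ⟨(m : ℂ) * (2 * ω₁) + n * (2 * τ * Complex.I), mem_rectLattice.2 ⟨m, n, rfl⟩, ?_⟩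
  simpa [fundRect] using And.intro hm hn

lemma int_mul_eq_zero_of_mem_Ico {c x : ℝ} (hx : x ∈ Set.Ico 0 c) {m : ℤ}
    (hm : x + m * c ∈ Set.Ico 0 c) : m = 0 := by
  have hc : 0 < c := hx.1.trans_lt hx.2
  have h1 : (-1 : ℝ) < m := by
    by_contra! h
    nlinarith [hm.1, hx.2]
  have h2 : (m : ℝ) < 1 := by
    by_contra! h
    nlinarith [hm.2, hx.1]
  have h1' : (-1 : ℤ) < m := by exact_mod_cast h1
  have h2' : m < (1 : ℤ) := by exact_mod_cast h2
  omega

lemma eq_zero_of_add_mem_fundRect {ω₁ τ : ℝ} {z l : ℂ} (hz : z ∈ fundRect ω₁ τ)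
    (hl : l ∈ rectLattice ω₁ τ) (h : z + l ∈ fundRect ω₁ τ) : l = 0 := by
  obtain ⟨m, n, h1, h2⟩ := mem_rectLattice_iff_re_im.1 hl
  have hm : m = 0 := int_mul_eq_zero_of_mem_Ico hz.1 (by simpa [h1] using h.1)
  have hn : n = 0 := int_mul_eq_zero_of_mem_Ico hz.2 (by simpa [h2] using h.2)
  apply Complex.ext <;> simp [h1, h2, hm, hn]

lemma eq_of_sub_mem_rectLattice {ω₁ τ : ℝ} {z w : ℂ} (hz : z ∈ fundRect ω₁ τ)
    (hw : w ∈ fundRect ω₁ τ) (h : z - w ∈ rectLattice ω₁ τ) : z = w := by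
  have := eq_zero_of_add_mem_fundRect hw h (by simpa using hz)
  exact sub_eq_zero.1 this

lemma horContour_zero_subset_fundRect {ω₁ τ : ℝ} (hτ : 0 < τ) :
    horContour ω₁ 0 ⊆ fundRect ω₁ τ := by
  rintro z ⟨h1, h2⟩
  exact ⟨h1, by rw [h2]; constructor <;> linarith⟩

lemma horContour_subset_fundRect {ω₁ τ : ℝ} (hτ : 0 < τ) :
    horContour ω₁ τ ⊆ fundRect ω₁ τ := by
  rintro z ⟨h1, h2⟩
  exact ⟨h1, by rw [h2]; constructor <;> linarith⟩

lemma zero_mem_fundRect {ω₁ τ : ℝ} (hω₁ : 0 < ω₁) (hτ : 0 < τ) : (0 : ℂ) ∈ fundRect ω₁ τ := by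
  simp [fundRect, hω₁, hτ]

lemma horPoint_re (h t : ℝ) : (horPoint h t).re = t := by simp [horPoint]

lemma horPoint_im (h t : ℝ) : (horPoint h t).im = h := by simp [horPoint]

lemma horPoint_re_im (z : ℂ) : horPoint z.im z.re = z := by
  apply Complex.ext <;> simp [horPoint]

/-! ### Elliptic functions and their orders. -/

/-- Elliptic functions (meromorphic, with period lattice containing `Λ`). -/
structure IsElliptic (ω₁ τ : ℝ) (f : ℂ → ℂ) : Prop where
  meromorphic : ∀ z, MeromorphicAt f z
  periodic : ∀ l ∈ rectLattice ω₁ τ, ∀ z, f (z + l) = f z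

lemma IsEllipticPoly.isElliptic {ω₁ τ : ℝ} {a : ℂ} {n : ℕ} {f : ℂ → ℂ}
    (hf : IsEllipticPoly ω₁ τ a n f) : IsElliptic ω₁ τ f :=
  ⟨hf.meromorphic, hf.periodic⟩

/-- The order of a meromorphic function as an integer (zero if the function vanishes locally). -/
noncomputable def ordZ (f : ℂ → ℂ) (z : ℂ) : ℤ := (meromorphicOrderAt f z).untop₀

lemma coe_ordZ {f : ℂ → ℂ} {z : ℂ} (h : meromorphicOrderAt f z ≠ ⊤) :
    (ordZ f z : WithTop ℤ) = meromorphicOrderAt f z :=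
  WithTop.coe_untop₀_of_ne_top h

lemma IsElliptic.order_add {ω₁ τ : ℝ} {f : ℂ → ℂ} (hf : IsElliptic ω₁ τ f) {l : ℂ}
    (hl : l ∈ rectLattice ω₁ τ) (z : ℂ) :
    meromorphicOrderAt f (z + l) = meromorphicOrderAt f z := by
  rw [← meromorphicOrderAt_comp_add_const_eq_meromorphicOrderAt]
  congr 1
  exact funext fun w => hf.periodic l hl w

lemma IsElliptic.order_congr {ω₁ τ : ℝ} {f : ℂ → ℂ} (hf : IsElliptic ω₁ τ f) {z w : ℂ}
    (h : z - w ∈ rectLattice ω₁ τ) : meromorphicOrderAt f z = meromorphicOrderAt f w := by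
  rw [← hf.order_add h w, add_sub_cancel]

lemma order_ne_top_of_ne_top {f : ℂ → ℂ} (hf : ∀ z, MeromorphicAt f z) {z : ℂ}
    (h : meromorphicOrderAt f z ≠ ⊤) (w : ℂ) : meromorphicOrderAt f w ≠ ⊤ :=
  MeromorphicOn.meromorphicOrderAt_ne_top_of_isPreconnected (U := Set.univ) (fun z _ => hf z)
    isPreconnected_univ (Set.mem_univ z) (Set.mem_univ w) h

lemma isCompact_rect (a b c d : ℝ) : IsCompact {z : ℂ | z.re ∈ Set.Icc a b ∧ z.im ∈ Set.Icc c d} :=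
  isCompact_Icc.reProdIm isCompact_Icc

/-- The points of analyticity with nonzero value form a codiscrete set, whose complement meets a
compact set in finitely many points. -/
lemma finite_irregular {f : ℂ → ℂ} (hf : ∀ z, MeromorphicAt f z)
    (hne : ∀ z, meromorphicOrderAt f z ≠ ⊤) {K : Set ℂ} (hK : IsCompact K) :
    {z ∈ K | ¬ (AnalyticAt ℂ f z ∧ f z ≠ 0)}.Finite := by
  have hfK : MeromorphicOn f K := fun z _ => hf z
  have h := hK.finite_sdiff_of_mem_codiscreteWithin
    (inter_mem hfK.analyticAt_mem_codiscreteWithin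
      (hfK.eventually_codiscreteWithin_apply_ne_zero fun z _ => hne z))
  refine h.subset fun z hz => ⟨hz.1, fun hz' => hz.2 ⟨hz'.1, hz'.2⟩⟩

lemma ordZ_eq_zero {f : ℂ → ℂ} {z : ℂ} (h : AnalyticAt ℂ f z) (h0 : f z ≠ 0) : ordZ f z = 0 := by
  have := h.meromorphicNFAt.meromorphicOrderAt_eq_zero_iff.2 h0
  simp [ordZ, this]

lemma fundRect_subset (ω₁ τ : ℝ) :
    fundRect ω₁ τ ⊆ {z : ℂ | z.re ∈ Set.Icc 0 (2 * ω₁) ∧ z.im ∈ Set.Icc 0 (2 * τ)} :=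
  fun _ hz => ⟨Set.Ico_subset_Icc_self hz.1, Set.Ico_subset_Icc_self hz.2⟩

lemma finite_support_ordZ {f : ℂ → ℂ} (hf : ∀ z, MeromorphicAt f z)
    (hne : ∀ z, meromorphicOrderAt f z ≠ ⊤) {A : Set ℂ} {ω₁ τ : ℝ} (hA : A ⊆ fundRect ω₁ τ) :
    (A ∩ Function.support (ordZ f)).Finite := by
  refine (finite_irregular hf hne (isCompact_rect 0 (2 * ω₁) 0 (2 * τ))).subset ?_
  rintro z ⟨hz, hz'⟩
  exact ⟨fundRect_subset _ _ (hA hz), fun h => hz' (ordZ_eq_zero h.1 h.2)⟩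

/-! ### The argument principle on a rectangle. -/

/-- The integral over the boundary of the rectangle `[x₀, x₁] × [y₀, y₁]`. -/
noncomputable def rectInt (f : ℂ → ℂ) (x₀ x₁ y₀ y₁ : ℝ) : ℂ :=
  (∫ x : ℝ in x₀..x₁, f (x + y₀ * Complex.I)) - (∫ x : ℝ in x₀..x₁, f (x + y₁ * Complex.I)) +
    Complex.I • (∫ y : ℝ in y₀..y₁, f (x₁ + y * Complex.I)) -
    Complex.I • (∫ y : ℝ in y₀..y₁, f (x₀ + y * Complex.I))

/-- The contribution of a corner of the rectangle: the logarithms used on the two adjacent edges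
differ by a quarter turn. Four corners make up `2πi`. -/
lemma log_I_mul {w : ℂ} (hw : 0 < w.re) :
    Complex.log (Complex.I * w) - Complex.log w = Real.pi / 2 * Complex.I := by
  have hw0 : w ≠ 0 := by rintro rfl; simp at hw
  have harg : |w.arg| < Real.pi / 2 := Complex.abs_arg_lt_pi_div_two_iff.2 (Or.inl hw)
  rw [abs_lt] at harg
  have := (Complex.log_mul_eq_add_log_iff Complex.I_ne_zero hw0).2
    (by rw [Complex.arg_I]; constructor <;> linarith [Real.pi_pos])
  rw [this, Complex.log_I]
  ring

/-- The factor `c` rotates the segment into the right half-plane, where the principal logarithm is a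
primitive. It cancels in the logarithmic derivative. -/
lemma integral_inv_segment {a v p c : ℂ} {s t : ℝ} (hst : s ≤ t) (hv : v ≠ 0)
    (h : ∀ x ∈ Set.Icc s t, 0 < (c * (a + x * v - p)).re) :
    v * ∫ x : ℝ in s..t, (a + x * v - p)⁻¹ =
      Complex.log (c * (a + t * v - p)) - Complex.log (c * (a + s * v - p)) := by
  have hne : ∀ x ∈ Set.Icc s t, a + (x : ℂ) * v - p ≠ 0 ∧ c ≠ 0 := by
    intro x hx
    have := h x hx
    constructor <;> rintro h0 <;> simp [h0] at this
  have hd : ∀ x ∈ Set.uIcc s t,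
      HasDerivAt (fun x : ℝ => Complex.log (c * (a + x * v - p))) (v * (a + x * v - p)⁻¹) x := by
    intro x hx
    rw [Set.uIcc_of_le hst] at hx
    have h1 : HasDerivAt (fun x : ℝ => c * (a + (x : ℂ) * v - p)) (c * v) x := by
      have := ((Complex.ofRealCLM.hasDerivAt (x := x)).mul_const v)
      have h2 := ((this.const_add a).sub_const p).const_mul c
      simpa using h2
    have h3 := h1.clog_real (Or.inl (h x hx))
    refine h3.congr_deriv ?_
    have := hne x hx
    field_simp [this.1, this.2]
  have hc : ContinuousOn (fun x : ℝ => v * (a + x * v - p)⁻¹) (Set.uIcc s t) := by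
    rw [Set.uIcc_of_le hst]
    refine continuousOn_const.mul (ContinuousOn.inv₀ (by fun_prop) fun x hx => (hne x hx).1)
  rw [← intervalIntegral.integral_const_mul]
  exact intervalIntegral.integral_eq_sub_of_hasDerivAt hd hc.intervalIntegrable

lemma rectInt_inv {x₀ x₁ y₀ y₁ : ℝ} {p : ℂ} (h1 : x₀ < p.re) (h2 : p.re < x₁) (h3 : y₀ < p.im)
    (h4 : p.im < y₁) : rectInt (fun z => (z - p)⁻¹) x₀ x₁ y₀ y₁ = 2 * Real.pi * Complex.I := by
  have b := integral_inv_segment (a := y₀ * Complex.I) (v := 1) (p := p) (c := Complex.I)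
    (h1.trans h2).le one_ne_zero (fun x _ => by simp; linarith)
  have t := integral_inv_segment (a := y₁ * Complex.I) (v := 1) (p := p) (c := -Complex.I)
    (h1.trans h2).le one_ne_zero (fun x _ => by simp; linarith)
  have r := integral_inv_segment (a := x₁) (v := Complex.I) (p := p) (c := 1)
    (h3.trans h4).le Complex.I_ne_zero (fun x _ => by simp; linarith)
  have l := integral_inv_segment (a := x₀) (v := Complex.I) (p := p) (c := -1)
    (h3.trans h4).le Complex.I_ne_zero (fun x _ => by simp; linarith)
  simp only [one_mul, mul_one] at b t r l
  have c1 := log_I_mul (w := Complex.I * (x₀ + y₀ * Complex.I - p)) (by simp; linarith)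
  have c2 := log_I_mul (w := x₁ + y₀ * Complex.I - p) (by simp; linarith)
  have c3 := log_I_mul (w := -Complex.I * (x₁ + y₁ * Complex.I - p)) (by simp; linarith)
  have c4 := log_I_mul (w := -1 * (x₀ + y₁ * Complex.I - p)) (by simp; linarith)
  rw [← mul_assoc, Complex.I_mul_I] at c1
  rw [show Complex.I * (-Complex.I * (x₁ + y₁ * Complex.I - p)) = x₁ + y₁ * Complex.I - p by
    linear_combination (-(x₁ + y₁ * Complex.I - p)) * Complex.I_sq] at c3
  rw [show Complex.I * (-1 * (x₀ + y₁ * Complex.I - p)) =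
    -Complex.I * (x₀ + y₁ * Complex.I - p) by ring] at c4
  have b' : ∫ x : ℝ in x₀..x₁, ((x : ℂ) + y₀ * Complex.I - p)⁻¹ =
      Complex.log (Complex.I * (x₁ + y₀ * Complex.I - p)) -
      Complex.log (Complex.I * (x₀ + y₀ * Complex.I - p)) := by
    rw [← add_comm (y₀ * Complex.I), ← add_comm (y₀ * Complex.I), ← b]
    simp only [add_comm (y₀ * Complex.I)]
  have t' : ∫ x : ℝ in x₀..x₁, ((x : ℂ) + y₁ * Complex.I - p)⁻¹ =
      Complex.log (-Complex.I * (x₁ + y₁ * Complex.I - p)) -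
      Complex.log (-Complex.I * (x₀ + y₁ * Complex.I - p)) := by
    rw [← add_comm (y₁ * Complex.I), ← add_comm (y₁ * Complex.I), ← t]
    simp only [add_comm (y₁ * Complex.I)]
  unfold rectInt
  rw [smul_eq_mul, smul_eq_mul, r, l, b', t']
  linear_combination c1 + c2 + c3 + c4

/-- Writing `f = (w - p)^k g` with `g p ≠ 0`, the difference is `g' / g` near `p`. -/
lemma order_logDeriv_sub_nonneg {f : ℂ → ℂ} {p : ℂ} (hf : MeromorphicAt f p)
    (hne : meromorphicOrderAt f p ≠ ⊤) :
    0 ≤ meromorphicOrderAt (fun w => logDeriv f w - ordZ f p * (w - p)⁻¹) p := by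
  obtain ⟨g, hg, hg0, hfg⟩ := (meromorphicOrderAt_eq_int_iff hf).1 (coe_ordZ hne).symm
  have h1 := logDeriv_congr_nhdsNE hfg
  have h2 : (fun w => logDeriv f w - ordZ f p * (w - p)⁻¹) =ᶠ[𝓝[≠] p] logDeriv g := by
    filter_upwards [h1, self_mem_nhdsWithin, hg.eventually_analyticAt.filter_mono nhdsWithin_le_nhds,
      (hg.continuousAt.eventually_ne hg0).filter_mono nhdsWithin_le_nhds] with w hw hwp hgw hgw0
    have hwp' : w - p ≠ 0 := sub_ne_zero.2 hwp
    rw [hw]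
    simp only [smul_eq_mul]
    have hd : DifferentiableAt ℂ (fun z : ℂ => (z - p) ^ ordZ f p) w :=
      (differentiableAt_id.sub_const p).zpow (Or.inl hwp')
    rw [logDeriv_mul (f := fun z : ℂ => (z - p) ^ ordZ f p) w (zpow_ne_zero _ hwp') hgw0 hd
      hgw.differentiableAt]
    rw [logDeriv_fun_zpow (by fun_prop)]
    have : logDeriv (fun z : ℂ => z - p) w = (w - p)⁻¹ := by
      simp [logDeriv_apply]
    rw [this]
    ring
  rw [meromorphicOrderAt_congr h2]
  exact (hg.deriv.div hg hg0).meromorphicOrderAt_nonneg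

/-- Subtracting the polar parts at the points of `S` from `f' / f` leaves only removable
singularities, to which Cauchy's theorem applies. Each polar part contributes through `rectInt_inv`.
-/
lemma rectInt_logDeriv {f : ℂ → ℂ} (hf : ∀ z, MeromorphicAt f z)
    (hne : ∀ z, meromorphicOrderAt f z ≠ ⊤) {x₀ x₁ y₀ y₁ : ℝ} (hx : x₀ < x₁) (hy : y₀ < y₁)
    (S : Finset ℂ) (hS : ∀ p ∈ S, (x₀ < p.re ∧ p.re < x₁) ∧ y₀ < p.im ∧ p.im < y₁)
    (hreg : ∀ z : ℂ, z.re ∈ Set.Icc x₀ x₁ → z.im ∈ Set.Icc y₀ y₁ → z ∉ S →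
      AnalyticAt ℂ f z ∧ f z ≠ 0) :
    rectInt (logDeriv f) x₀ x₁ y₀ y₁ = 2 * Real.pi * Complex.I * ∑ p ∈ S, (ordZ f p : ℂ) := by
  classical
  set φ : ℂ → ℂ := fun w => logDeriv f w - ∑ p ∈ S, (ordZ f p : ℂ) * (w - p)⁻¹ with hφ
  have hmer : ∀ z, MeromorphicAt φ z := by
    intro z
    refine (hf z).logDeriv.sub (MeromorphicAt.fun_sum fun p _ => ?_)
    fun_prop
  have hφan : ∀ z : ℂ, z.re ∈ Set.Icc x₀ x₁ → z.im ∈ Set.Icc y₀ y₁ → z ∉ S → AnalyticAt ℂ φ z := by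
    intro z h1 h2 h3
    obtain ⟨h4, h5⟩ := hreg z h1 h2 h3
    refine (h4.deriv.div h4 h5).sub (Finset.analyticAt_fun_sum S fun p hp => ?_)
    have : z - p ≠ 0 := sub_ne_zero.2 fun h => h3 (h ▸ hp)
    fun_prop (disch := assumption)
  -- The normal form fills in the removable singularities: `ψ` is analytic on the closed rectangle
  -- and equals `φ` off `S`.
  set ψ := toMeromorphicNFOn φ Set.univ
  have hmerOn : MeromorphicOn φ Set.univ := fun z _ => hmer z
  have hψφ : ∀ z : ℂ, z.re ∈ Set.Icc x₀ x₁ → z.im ∈ Set.Icc y₀ y₁ → z ∉ S → ψ z = φ z := by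
    intro z h1 h2 h3
    have := (toMeromorphicNFOn_eq_toMeromorphicNFAt_on_nhds hmerOn (Set.mem_univ z)).eq_of_nhds
    exact this.trans (by rw [toMeromorphicNFAt_eq_self.2 (hφan z h1 h2 h3).meromorphicNFAt])
  have hψan : ∀ z : ℂ, z.re ∈ Set.Icc x₀ x₁ → z.im ∈ Set.Icc y₀ y₁ → AnalyticAt ℂ ψ z := by
    intro z h1 h2
    refine (AnalyticAt.congr ?_
      (toMeromorphicNFOn_eq_toMeromorphicNFAt_on_nhds hmerOn (Set.mem_univ z)).symm)
    rw [← (hmer z).meromorphicOrderAt_nonneg_iff_analyticAt_toMeromorphicNFAt]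
    by_cases h3 : z ∈ S
    · have h4 : φ = (fun w => logDeriv f w - ordZ f z * (w - z)⁻¹) +
          fun w => -∑ p ∈ S.erase z, (ordZ f p : ℂ) * (w - p)⁻¹ := by
        funext w
        simp only [hφ, Pi.add_apply, ← Finset.add_sum_erase S _ h3]
        ring
      have h5 : AnalyticAt ℂ (fun w => -∑ p ∈ S.erase z, (ordZ f p : ℂ) * (w - p)⁻¹) z := by
        refine (Finset.analyticAt_fun_sum _ fun p hp => ?_).neg
        have : z - p ≠ 0 := sub_ne_zero.2 (Finset.ne_of_mem_erase hp).symm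
        fun_prop (disch := assumption)
      have h6 := order_logDeriv_sub_nonneg (hf z) (hne z)
      rw [h4]
      refine le_trans (le_min h6 h5.meromorphicOrderAt_nonneg) (meromorphicOrderAt_add ?_
        h5.meromorphicAt)
      exact (hf z).logDeriv.sub (by fun_prop)
    · exact (hφan z h1 h2 h3).meromorphicOrderAt_nonneg
  have hψint : rectInt ψ x₀ x₁ y₀ y₁ = 0 := by
    have := Complex.integral_boundary_rect_eq_zero_of_differentiableOn ψ ⟨x₀, y₀⟩ ⟨x₁, y₁⟩ (by
      intro z hz
      simp only [Set.uIcc_of_le hx.le, Set.uIcc_of_le hy.le] at hz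
      exact (hψan z hz.1 hz.2).differentiableAt.differentiableWithinAt)
    simpa [rectInt] using this
  -- edges
  have edge : ∀ γ : ℝ → ℂ, ∀ s t : ℝ, s ≤ t → Continuous γ →
      (∀ x ∈ Set.Icc s t, (γ x).re ∈ Set.Icc x₀ x₁ ∧ (γ x).im ∈ Set.Icc y₀ y₁ ∧ γ x ∉ S) →
      ∫ x in s..t, logDeriv f (γ x) =
        (∫ x in s..t, ψ (γ x)) + ∑ p ∈ S, (ordZ f p : ℂ) * ∫ x in s..t, (γ x - p)⁻¹ := by
    intro γ s t hst hγ h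
    have hcont : ∀ p ∈ S, ContinuousOn (fun x => (ordZ f p : ℂ) * (γ x - p)⁻¹) (Set.uIcc s t) := by
      intro p hp
      rw [Set.uIcc_of_le hst]
      refine continuousOn_const.mul (ContinuousOn.inv₀ (by fun_prop) fun x hx => ?_)
      exact sub_ne_zero.2 fun h' => (h x hx).2.2 (h' ▸ hp)
    have hψc : ContinuousOn (fun x => ψ (γ x)) (Set.uIcc s t) := by
      rw [Set.uIcc_of_le hst]
      intro x hx
      exact ((hψan _ (h x hx).1 (h x hx).2.1).continuousAt.comp
        hγ.continuousAt).continuousWithinAt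
    simp_rw [← intervalIntegral.integral_const_mul]
    rw [← intervalIntegral.integral_finsetSum fun p hp => (hcont p hp).intervalIntegrable,
      ← intervalIntegral.integral_add hψc.intervalIntegrable
      (continuousOn_finsetSum _ hcont).intervalIntegrable]
    refine intervalIntegral.integral_congr fun x hx => ?_
    rw [Set.uIcc_of_le hst] at hx
    obtain ⟨h1, h2, h3⟩ := h x hx
    simp only [hψφ _ h1 h2 h3, hφ]
    ring
  have e1 := edge (fun x => x + y₀ * Complex.I) x₀ x₁ hx.le (by fun_prop) (fun x hx' => by
    refine ⟨by simpa using hx', by simpa using hy.le, fun h => ?_⟩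
    have := (hS _ h).2.1
    simp at this)
  have e2 := edge (fun x => x + y₁ * Complex.I) x₀ x₁ hx.le (by fun_prop) (fun x hx' => by
    refine ⟨by simpa using hx', by simpa using hy.le, fun h => ?_⟩
    have := (hS _ h).2.2
    simp at this)
  have e3 := edge (fun y => x₁ + y * Complex.I) y₀ y₁ hy.le (by fun_prop) (fun x hx' => by
    refine ⟨by simpa using hx.le, by simpa using hx', fun h => ?_⟩
    have := (hS _ h).1.2
    simp at this)
  have e4 := edge (fun y => x₀ + y * Complex.I) y₀ y₁ hy.le (by fun_prop) (fun x hx' => by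
    refine ⟨by simpa using hx.le, by simpa using hx', fun h => ?_⟩
    have := (hS _ h).1.1
    simp at this)
  have hsum : 2 * Real.pi * Complex.I * ∑ p ∈ S, (ordZ f p : ℂ) =
      ∑ p ∈ S, (ordZ f p : ℂ) * rectInt (fun z => (z - p)⁻¹) x₀ x₁ y₀ y₁ := by
    rw [Finset.mul_sum]
    refine Finset.sum_congr rfl fun p hp => ?_
    rw [rectInt_inv (hS p hp).1.1 (hS p hp).1.2 (hS p hp).2.1 (hS p hp).2.2]
    ring
  rw [hsum]
  simp only [rectInt, smul_eq_mul] at hψint ⊢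
  rw [e1, e2, e3, e4]
  have hsplit : ∀ b t r l : ℂ → ℂ, ∑ p ∈ S, (ordZ f p : ℂ) *
      (b p - t p + Complex.I * r p - Complex.I * l p) =
      ∑ p ∈ S, (ordZ f p : ℂ) * b p - ∑ p ∈ S, (ordZ f p : ℂ) * t p +
      Complex.I * ∑ p ∈ S, (ordZ f p : ℂ) * r p - Complex.I * ∑ p ∈ S, (ordZ f p : ℂ) * l p := by
    intro b t r l
    rw [Finset.mul_sum, Finset.mul_sum, ← Finset.sum_sub_distrib, ← Finset.sum_add_distrib,
      ← Finset.sum_sub_distrib]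
    exact Finset.sum_congr rfl fun p _ => by ring
  rw [hsplit]
  linear_combination hψint

lemma IsElliptic.logDeriv_add {ω₁ τ : ℝ} {f : ℂ → ℂ} (hf : IsElliptic ω₁ τ f) {l : ℂ}
    (hl : l ∈ rectLattice ω₁ τ) (z : ℂ) : logDeriv f (z + l) = logDeriv f z := by
  have h : (fun w => f (w + l)) = f := funext fun w => hf.periodic l hl w
  have h2 := deriv_comp_add_const (f := f) l z
  rw [h] at h2
  rw [logDeriv_apply, logDeriv_apply, hf.periodic l hl, h2]

lemma exists_lt_forall_lt (s : Finset ℝ) {c : ℝ} (hc : 0 < c) (hs : ∀ x ∈ s, x < c) :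
    ∃ d, 0 < d ∧ d < c ∧ ∀ x ∈ s, x < d := by
  have : (insert 0 s).max' (Finset.insert_nonempty 0 s) < c := by
    rw [Finset.max'_lt_iff]
    intro x hx
    rcases Finset.mem_insert.1 hx with rfl | h
    exacts [hc, hs x h]
  obtain ⟨d, hd1, hd2⟩ := exists_between this
  refine ⟨d, lt_of_le_of_lt (Finset.le_max' _ 0 (by simp)) hd1, hd2, fun x hx => ?_⟩
  exact lt_of_le_of_lt (Finset.le_max' _ x (by simp [hx])) hd1

/-- A nonzero elliptic function has as many zeros as poles in the fundamental rectangle. -/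
theorem IsElliptic.finsum_ordZ_fundRect {ω₁ τ : ℝ} (hω₁ : 0 < ω₁) (hτ : 0 < τ) {f : ℂ → ℂ}
    (hf : IsElliptic ω₁ τ f) (hne : ∀ z, meromorphicOrderAt f z ≠ ⊤) :
    ∑ᶠ z ∈ fundRect ω₁ τ, ordZ f z = 0 := by
  classical
  have hfin : {z ∈ fundRect ω₁ τ | ¬ (AnalyticAt ℂ f z ∧ f z ≠ 0)}.Finite :=
    (finite_irregular hf.meromorphic hne (isCompact_rect 0 (2 * ω₁) 0 (2 * τ))).subset
      fun z hz => ⟨fundRect_subset _ _ hz.1, hz.2⟩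
  set S := hfin.toFinset with hSdef
  have hS : ∀ z, z ∈ S ↔ z ∈ fundRect ω₁ τ ∧ ¬ (AnalyticAt ℂ f z ∧ f z ≠ 0) := fun z => by
    simp [hSdef]
  -- Zeros and poles may lie on the left or lower edge of the half-open rectangle. Choosing `x₁ <
  -- 2ω₁` and `y₁ < 2τ` beyond all of them puts them strictly inside the shifted rectangle with
  -- upper right corner `x₁ + i y₁`.
  obtain ⟨x₁, hx0, hx1, hx⟩ := exists_lt_forall_lt (S.image Complex.re) (c := 2 * ω₁)
    (by positivity) (by
      intro x hx
      obtain ⟨z, hz, rfl⟩ := Finset.mem_image.1 hx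
      exact ((hS z).1 hz).1.1.2)
  obtain ⟨y₁, hy0, hy1, hy⟩ := exists_lt_forall_lt (S.image Complex.im) (c := 2 * τ)
    (by positivity) (by
      intro x hx
      obtain ⟨z, hz, rfl⟩ := Finset.mem_image.1 hx
      exact ((hS z).1 hz).1.2.2)
  replace hx : ∀ z ∈ S, z.re < x₁ := fun z hz => hx _ (Finset.mem_image_of_mem _ hz)
  replace hy : ∀ z ∈ S, z.im < y₁ := fun z hz => hy _ (Finset.mem_image_of_mem _ hz)
  have hper : ∀ l ∈ rectLattice ω₁ τ, ∀ z, (AnalyticAt ℂ f (z + l) ∧ f (z + l) ≠ 0) ↔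
      (AnalyticAt ℂ f z ∧ f z ≠ 0) := by
    have key : ∀ l ∈ rectLattice ω₁ τ, ∀ z, AnalyticAt ℂ f (z + l) → AnalyticAt ℂ f z := by
      intro l hl z h
      have h2 : AnalyticAt ℂ (fun w => f (w + l)) z :=
        AnalyticAt.fun_comp (f := fun w => w + l) (x := z) h (by fun_prop)
      rwa [show (fun w => f (w + l)) = f from funext fun w => hf.periodic l hl w] at h2
    intro l hl z
    rw [hf.periodic l hl]
    refine and_congr_left fun _ => ⟨key l hl z, fun h => ?_⟩
    exact key (-l) (neg_mem hl) (z + l) (by simpa using h)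
  have hreg : ∀ z : ℂ, z.re ∈ Set.Icc (x₁ - 2 * ω₁) x₁ → z.im ∈ Set.Icc (y₁ - 2 * τ) y₁ → z ∉ S →
      AnalyticAt ℂ f z ∧ f z ≠ 0 := by
    intro z h1 h2 h3
    by_contra hcon
    obtain ⟨l, hl, hzl⟩ := exists_add_mem_fundRect hω₁ hτ z
    have hmem : z + l ∈ S := (hS _).2 ⟨hzl, fun h => hcon ((hper l hl z).1 h)⟩
    obtain ⟨m, n, hm, hn⟩ := mem_rectLattice_iff_re_im.1 hl
    have h4 := hx _ hmem
    have h5 := hy _ hmem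
    have h6 := hzl.1.1
    have h7 := hzl.2.1
    simp only [Complex.add_re, Complex.add_im, hm, hn] at h4 h5 h6 h7
    have aux : ∀ (m : ℤ) (c x d : ℝ), 0 < c → d < c → d - c ≤ x → x ≤ d → 0 ≤ x + m * c →
        x + m * c < d → m = 0 := by
      intro m c x d hc hd h1 h2 h3 h4
      have h5 : (-1 : ℝ) < m := by
        by_contra! h
        nlinarith
      have h6 : (m : ℝ) < 1 := by
        by_contra! h
        nlinarith
      have h5' : (-1 : ℤ) < m := by exact_mod_cast h5
      have h6' : m < (1 : ℤ) := by exact_mod_cast h6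
      omega
    have hm0 := aux m (2 * ω₁) z.re x₁ (by positivity) hx1 h1.1 h1.2 h6 h4
    have hn0 := aux n (2 * τ) z.im y₁ (by positivity) hy1 h2.1 h2.2 h7 h5
    have hl0 : l = 0 := by apply Complex.ext <;> simp [hm, hn, hm0, hn0]
    rw [hl0, add_zero] at hmem
    exact h3 hmem
  have hint := rectInt_logDeriv hf.meromorphic hne (x₀ := x₁ - 2 * ω₁) (x₁ := x₁)
    (y₀ := y₁ - 2 * τ) (y₁ := y₁) (by linarith) (by linarith) S (fun p hp => by
      have h0 := ((hS p).1 hp).1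
      exact ⟨⟨by linarith [h0.1.1], hx p hp⟩, by linarith [h0.2.1], hy p hp⟩) hreg
  -- Opposite edges cancel by periodicity.
  have hzero : rectInt (logDeriv f) (x₁ - 2 * ω₁) x₁ (y₁ - 2 * τ) y₁ = 0 := by
    have hl1 : (2 * ω₁ : ℂ) ∈ rectLattice ω₁ τ := mem_rectLattice.2 ⟨1, 0, by simp⟩
    have hl2 : (2 * τ * Complex.I : ℂ) ∈ rectLattice ω₁ τ := mem_rectLattice.2 ⟨0, 1, by simp⟩
    have h1 : ∀ x : ℝ, logDeriv f (x + y₁ * Complex.I) =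
        logDeriv f (x + (y₁ - 2 * τ : ℝ) * Complex.I) := by
      intro x
      rw [← hf.logDeriv_add hl2 (x + (y₁ - 2 * τ : ℝ) * Complex.I)]
      congr 1
      push_cast
      ring
    have h2 : ∀ y : ℝ, logDeriv f (x₁ + y * Complex.I) =
        logDeriv f ((x₁ - 2 * ω₁ : ℝ) + y * Complex.I) := by
      intro y
      rw [← hf.logDeriv_add hl1 ((x₁ - 2 * ω₁ : ℝ) + y * Complex.I)]
      congr 1
      push_cast
      ring
    simp only [rectInt, h1, h2]
    ring
  rw [hzero] at hint
  have hsum : ∑ p ∈ S, ordZ f p = 0 := by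
    have : (2 * Real.pi * Complex.I : ℂ) ≠ 0 := by simp [Real.pi_ne_zero]
    have h := (mul_eq_zero.1 hint.symm).resolve_left this
    exact_mod_cast h
  rw [← hsum]
  rw [finsum_mem_eq_sum_of_inter_support_eq (s := fundRect ω₁ τ) (t := S)]
  ext z
  simp only [Set.mem_inter_iff, Finset.mem_coe, hS, Function.mem_support]
  constructor
  · rintro ⟨h1, h2⟩
    exact ⟨⟨h1, fun h => h2 (ordZ_eq_zero h.1 h.2)⟩, h2⟩
  · rintro ⟨⟨h1, _⟩, h2⟩
    exact ⟨h1, h2⟩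

/-! ### The Weierstrass zeta function. -/

namespace PeriodPair

variable (L : PeriodPair)

/-- The three fractions combine to `s² / (l² (s - l))`, which is of size `|l|⁻³` and hence summable
over a planar lattice. -/
lemma zeta_bound (r : ℝ) (hr : 0 < r) (s : ℂ) (hs : ‖s‖ < r) (l : ℂ) (h : 2 * r ≤ ‖l‖) :
    ‖1 / (s - l) + 1 / l + s / l ^ 2‖ ≤ 2 * r ^ 2 * ‖l‖ ^ (-3 : ℝ) := by
  have hl : 0 < ‖l‖ := by linarith
  have hl0 : l ≠ 0 := norm_pos_iff.1 hl
  have hsl : s - l ≠ 0 := sub_ne_zero.2 (by rintro rfl; linarith)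
  have hb : ‖l‖ / 2 ≤ ‖s - l‖ := by
    rw [norm_sub_rev]
    exact .trans (by linarith) (norm_sub_norm_le l s)
  have h3 : ‖l‖ ^ (-3 : ℝ) = (‖l‖ ^ 3)⁻¹ := by
    rw [Real.rpow_neg hl.le]; norm_cast
  calc ‖1 / (s - l) + 1 / l + s / l ^ 2‖ = ‖s ^ 2 / (l ^ 2 * (s - l))‖ := by
        congr 1
        field_simp
        ring
    _ = ‖s‖ ^ 2 / (‖l‖ ^ 2 * ‖s - l‖) := by simp
    _ ≤ r ^ 2 / (‖l‖ ^ 2 * (‖l‖ / 2)) := by gcongr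
    _ = 2 * r ^ 2 * ‖l‖ ^ (-3 : ℝ) := by
        rw [h3]
        field_simp

/-- The Weierstrass `ζ` function with the term of `l₀` omitted. -/
noncomputable def zetaExcept (l₀ : ℂ) (z : ℂ) : ℂ :=
  ∑' l : L.lattice, if l = l₀ then 0 else (1 / (z - l) + 1 / l + z / (l : ℂ) ^ 2)

/-- The Weierstrass `ζ` function. -/
noncomputable def zeta (z : ℂ) : ℂ :=
  ∑' l : L.lattice, (1 / (z - l) + 1 / l + z / (l : ℂ) ^ 2)

lemma hasSumLocallyUniformly_zetaExcept (l₀ : ℂ) :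
    HasSumLocallyUniformly (fun (l : L.lattice) (z : ℂ) ↦
      if l.1 = l₀ then 0 else (1 / (z - l) + 1 / l + z / (l : ℂ) ^ 2)) (L.zetaExcept l₀) := by
  refine L.hasSumLocallyUniformly_aux (u := (2 * · ^ 2 * ‖·‖ ^ (-3 : ℝ))) _
    (fun _ _ ↦ (ZLattice.summable_norm_rpow _ _ (by simp; norm_num)).mul_left _) fun r hr ↦
    Filter.eventually_atTop.mpr ⟨2 * r, ?_⟩
  rintro _ h s hs l rfl
  split_ifs
  · simpa using! show 0 ≤ 2 * r ^ 2 * (‖↑l‖ ^ 3)⁻¹ by positivity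
  · exact zeta_bound r hr s hs l h

lemma zetaExcept_add (l₀ : L.lattice) (z : ℂ) :
    L.zetaExcept l₀ z + (1 / (z - l₀.1) + 1 / l₀.1 + z / l₀.1 ^ 2) = L.zeta z := by
  trans L.zetaExcept l₀ z + ∑' i : L.lattice,
    if i = l₀.1 then (1 / (z - l₀.1) + 1 / l₀.1 + z / l₀.1 ^ 2) else 0
  · simp
  rw [zetaExcept, ← Summable.tsum_add]
  · unfold zeta
    congr with w; split_ifs <;> simp only [zero_add, add_zero, *]
  · exact ⟨_, (L.hasSumLocallyUniformly_zetaExcept _).hasSum⟩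
  · exact summable_of_hasFiniteSupport ((Set.finite_singleton l₀).subset (by simp))

lemma zetaExcept_of_notMem (l₀ : ℂ) (hl : l₀ ∉ L.lattice) : L.zetaExcept l₀ = L.zeta := by
  delta zetaExcept zeta
  congr! 3 with z l
  have : l.1 ≠ l₀ := by rintro rfl; simp at hl
  simp [this]

lemma differentiableAt_zeta_term {l z : ℂ} (h : z - l ≠ 0) :
    DifferentiableAt ℂ (fun z : ℂ => 1 / (z - l) + 1 / l + z / l ^ 2) z := by
  fun_prop (disch := assumption)

lemma differentiableOn_zetaExcept (l₀ : ℂ) :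
    DifferentiableOn ℂ (L.zetaExcept l₀) (L.lattice \ {l₀})ᶜ := by
  refine (L.hasSumLocallyUniformly_zetaExcept l₀).hasSumLocallyUniformlyOn.differentiableOn
    (.of_forall fun s ↦ .fun_sum fun i hi ↦ ?_) L.isOpen_compl_lattice_sdiff
  split_ifs with h
  · simp
  · intro z hz
    refine (differentiableAt_zeta_term (sub_ne_zero.2 ?_)).differentiableWithinAt
    rintro rfl
    exact hz ⟨i.2, h⟩

open scoped PeriodPair in
lemma deriv_zetaExcept (l₀ : ℂ) :
    Set.EqOn (deriv (L.zetaExcept l₀)) (fun z => -L.weierstrassPExcept l₀ z)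
      (L.lattice \ {l₀})ᶜ := by
  refine ((L.hasSumLocallyUniformly_zetaExcept l₀).tendstoLocallyUniformlyOn.deriv
    (.of_forall fun s ↦ .fun_sum fun i hi ↦ ?_) L.isOpen_compl_lattice_sdiff).unique ?_
  · split_ifs with h
    · simp
    · intro z hz
      refine (differentiableAt_zeta_term (sub_ne_zero.2 ?_)).differentiableWithinAt
      rintro rfl
      exact hz ⟨i.2, h⟩
  · refine (L.hasSumLocallyUniformly_weierstrassPExcept l₀).tendstoLocallyUniformlyOn.neg.congr ?_
    intro s l hl
    simp only [Function.comp_apply, Pi.neg_apply]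
    have hne : ∀ x : L.lattice, ¬ x.1 = l₀ → l - x ≠ 0 := fun x hx e ↦ hl (by
      obtain rfl := sub_eq_zero.mp e
      exact ⟨x.2, hx⟩)
    rw [deriv_fun_sum]
    · rw [← Finset.sum_neg_distrib]
      congr with x
      split_ifs with hl₁
      · simp
      have h1 := hne x hl₁
      have hd : HasDerivAt (fun z : ℂ => 1 / (z - x) + 1 / (x : ℂ) + z / (x : ℂ) ^ 2)
          (-1 / (l - x) ^ 2 + 1 / (x : ℂ) ^ 2) l := by
        have e1 := ((hasDerivAt_id l).sub_const (x : ℂ)).inv h1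
        have e2 := (hasDerivAt_id l).div_const ((x : ℂ) ^ 2)
        simpa using (e1.add_const (1 / (x : ℂ))).fun_add e2
      rw [hd.deriv]
      ring
    · intros x hxs
      split_ifs with hl₁
      · simp
      exact differentiableAt_zeta_term (hne x hl₁)

lemma analyticOnNhd_zetaExcept (l₀ : ℂ) :
    AnalyticOnNhd ℂ (L.zetaExcept l₀) (L.lattice \ {l₀})ᶜ :=
  (L.differentiableOn_zetaExcept l₀).analyticOnNhd L.isOpen_compl_lattice_sdiff

lemma analyticAt_zeta {z : ℂ} (hz : z ∉ L.lattice) : AnalyticAt ℂ L.zeta z := by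
  -- A half-period is not in the lattice, so omitting its term omits nothing.
  rw [← L.zetaExcept_of_notMem _ L.ω₁_div_two_notMem_lattice]
  exact L.analyticOnNhd_zetaExcept _ z fun h => hz h.1

lemma hasDerivAt_zeta {z : ℂ} (hz : z ∉ L.lattice) :
    HasDerivAt L.zeta (-L.weierstrassP z) z := by
  have h := L.deriv_zetaExcept (L.ω₁ / 2) (x := z) fun h => hz h.1
  simp only [L.zetaExcept_of_notMem _ L.ω₁_div_two_notMem_lattice,
    L.weierstrassPExcept_of_notMem _ L.ω₁_div_two_notMem_lattice] at h
  rw [← h]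
  exact (L.analyticAt_zeta hz).differentiableAt.hasDerivAt

/-- The rest of the series is analytic at `l`, so the term of `l` decides. The case `l = 0` is
included: division by zero gives zero, and the term is then `1 / z`. -/
lemma order_zeta {l : ℂ} (hl : l ∈ L.lattice) : meromorphicOrderAt L.zeta l = ((-1 : ℤ) : WithTop ℤ) := by
  have h1 : L.zeta = (fun z => (z - l) ^ (-1 : ℤ)) +
      fun z => L.zetaExcept l z + 1 / l + z / l ^ 2 := by
    funext z
    have := L.zetaExcept_add ⟨l, hl⟩ z
    simp only [Pi.add_apply, ← this, zpow_neg_one]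
    ring
  have h2 : AnalyticAt ℂ (fun z => L.zetaExcept l z + 1 / l + z / l ^ 2) l := by
    have h3 : AnalyticAt ℂ (L.zetaExcept l) l := L.analyticOnNhd_zetaExcept l l (by simp)
    have h4 : AnalyticAt ℂ (fun z : ℂ => z / l ^ 2) l := by
      simp only [div_eq_mul_inv]
      fun_prop
    fun_prop
  have h5 : meromorphicOrderAt (fun z => (z - l) ^ (-1 : ℤ)) l = ((-1 : ℤ) : WithTop ℤ) :=
    fun_meromorphicOrderAt_zpow_id_sub_const
  rw [h1, meromorphicOrderAt_add_eq_left_of_lt h2.meromorphicAt, h5]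
  · rw [h5]
    refine lt_of_lt_of_le ?_ h2.meromorphicOrderAt_nonneg
    exact_mod_cast (by norm_num : (-1 : ℤ) < 0)

lemma meromorphicAt_zeta (z : ℂ) : MeromorphicAt L.zeta z := by
  by_cases hz : z ∈ L.lattice
  · refine meromorphicAt_of_meromorphicOrderAt_ne_zero ?_
    rw [L.order_zeta hz]
    exact WithTop.coe_injective.ne (by norm_num : (-1 : ℤ) ≠ 0)
  · exact (L.analyticAt_zeta hz).meromorphicAt

lemma isPreconnected_compl_lattice : IsPreconnected ((L.lattice : Set ℂ)ᶜ) := by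
  have hc : (L.lattice : Set ℂ).Countable := by
    have : Countable L.lattice := (L.latticeEquivProd.toEquiv).injective.countable
    exact Set.countable_coe_iff.1 this
  exact (hc.isConnected_compl_of_one_lt_rank (by simp)).isPreconnected

/-- The derivative `-℘` is periodic, so the difference is constant on the connected complement of
the lattice. -/
lemma exists_zeta_add {l : ℂ} (hl : l ∈ L.lattice) :
    ∃ η : ℂ, ∀ z ∉ L.lattice, L.zeta (z + l) = L.zeta z + η := by
  have hmem : ∀ z, z + l ∉ L.lattice ↔ z ∉ L.lattice := fun z =>
    not_congr ⟨fun h => by simpa using sub_mem h hl, fun h => add_mem h hl⟩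
  have hd : ∀ z ∉ L.lattice, HasDerivAt (fun z => L.zeta (z + l) - L.zeta z) 0 z := by
    intro z hz
    have h1 := (L.hasDerivAt_zeta ((hmem z).2 hz)).comp_add_const z l
    have h2 := h1.sub (L.hasDerivAt_zeta hz)
    rw [L.weierstrassP_add_coe z ⟨l, hl⟩, sub_self] at h2
    exact h2
  obtain ⟨η, hη⟩ := (L.isClosed_lattice.isOpen_compl).exists_is_const_of_deriv_eq_zero
    L.isPreconnected_compl_lattice
    (fun z hz => (hd z hz).differentiableAt.differentiableWithinAt)
    (fun z hz => (hd z hz).deriv)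
  exact ⟨η, fun z hz => by rw [← hη z hz]; ring⟩

end PeriodPair

/-! ### Elliptic functions with few poles. -/

/-- The form in which every count of zeros is used: once `X` contains all possible poles in `A`, the
remaining points can only raise the total order. -/
lemma sum_le_finsum_mem {A : Set ℂ} {g : ℂ → ℤ} (hfin : (A ∩ Function.support g).Finite)
    (X : Finset ℂ) (hX : ∀ z ∈ X, z ∈ A) (h : ∀ z ∈ A, z ∉ X → 0 ≤ g z) :
    ∑ z ∈ X, g z ≤ ∑ᶠ z ∈ A, g z := by
  classical
  rw [finsum_mem_eq_sum_of_inter_support_eq (s := A) (t := X ∪ hfin.toFinset)]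
  · refine Finset.sum_le_sum_of_subset_of_nonneg Finset.subset_union_left fun z hz hzX => ?_
    have : z ∈ hfin.toFinset := (Finset.mem_union.1 hz).resolve_left hzX
    exact h z (by simpa using ((Set.Finite.mem_toFinset _).1 this).1) hzX
  · ext z
    simp only [Set.mem_inter_iff, Function.mem_support, Finset.coe_union, Set.mem_union,
      Finset.mem_coe, Set.Finite.mem_toFinset]
    constructor
    · rintro ⟨h1, h2⟩
      exact ⟨Or.inr ⟨h1, h2⟩, h2⟩
    · rintro ⟨h1 | h1, h2⟩
      exacts [⟨hX z h1, h2⟩, ⟨h1.1, h2⟩]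

lemma order_sub_const_of_tendsto {f : ℂ → ℂ} {z c : ℂ} (hf : MeromorphicAt f z)
    (h : Tendsto f (𝓝[≠] z) (𝓝 c)) : 0 < meromorphicOrderAt (fun w => f w - c) z := by
  exact (tendsto_zero_iff_meromorphicOrderAt_pos (hf.sub (MeromorphicAt.const c z))).1
    (by simpa using! h.sub_const c)

namespace IsElliptic

variable {ω₁ τ : ℝ} {f g : ℂ → ℂ}

lemma sub_const (hf : IsElliptic ω₁ τ f) (c : ℂ) : IsElliptic ω₁ τ (fun z => f z - c) :=
  ⟨fun z => (hf.meromorphic z).sub (MeromorphicAt.const c z), fun l hl z => by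
    rw [hf.periodic l hl]⟩

lemma deriv (hf : IsElliptic ω₁ τ f) : IsElliptic ω₁ τ (deriv f) := by
  refine ⟨fun z => (hf.meromorphic z).deriv, fun l hl z => ?_⟩
  rw [← deriv_comp_add_const, show (fun w => f (w + l)) = f from funext fun w => hf.periodic l hl w]

/-- After the singularities are removed, the function is entire and periodic, hence bounded;
Liouville's theorem applies. -/
lemma exists_const (hω₁ : 0 < ω₁) (hτ : 0 < τ) (hf : IsElliptic ω₁ τ f)
    (h : ∀ z, 0 ≤ meromorphicOrderAt f z) : ∃ c, ∀ z, AnalyticAt ℂ f z → f z = c := by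
  set F := toMeromorphicNFOn f Set.univ
  have hmer : MeromorphicOn f Set.univ := fun z _ => hf.meromorphic z
  have hF : ∀ z, AnalyticAt ℂ F z := fun z =>
    ((hf.meromorphic z).meromorphicOrderAt_nonneg_iff_analyticAt_toMeromorphicNFAt.1 (h z)).congr
      (toMeromorphicNFOn_eq_toMeromorphicNFAt_on_nhds hmer (Set.mem_univ z)).symm
  have hlim : ∀ z, Tendsto f (𝓝[≠] z) (𝓝 (F z)) := fun z =>
    ((hF z).continuousAt.tendsto.mono_left nhdsWithin_le_nhds).congr'
      (hmer.toMeromorphicNFOn_eq_self_on_nhdsNE (Set.mem_univ z))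
  have hper : ∀ z, ∀ l ∈ rectLattice ω₁ τ, F (z + l) = F z := by
    intro z l hl
    refine tendsto_nhds_unique ?_ (hlim z)
    have h1 : Tendsto (fun w => w + l) (𝓝[≠] z) (𝓝[≠] (z + l)) :=
      tendsto_nhdsWithin_iff.2 ⟨((continuous_add_const l).tendsto z).mono_left nhdsWithin_le_nhds,
        by filter_upwards [self_mem_nhdsWithin] with w hw using by simpa using hw⟩
    refine ((hlim (z + l)).comp h1).congr fun w => ?_
    exact hf.periodic l hl w
  have hd : Differentiable ℂ F := fun z => (hF z).differentiableAt
  have hb := (IsZLattice.isCompact_range_of_periodic (rectPeriodPair hω₁ hτ).lattice _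
    hd.continuous fun z w hw => hper z w hw).isBounded
  refine ⟨F 0, fun z hz => ?_⟩
  rw [hd.apply_eq_apply_of_bounded hb 0 z]
  exact tendsto_nhds_unique (hz.continuousAt.tendsto.mono_left nhdsWithin_le_nhds) (hlim z)

/-- An argument by counting instead of residues. The derivative would have a double pole at `a`, so
the balance of zeros and poles gives it a zero `z₁ ≠ a`. With `c` the value of `f` at `z₁`, the
function `f - c` has a zero of order at least two there, but no pole other than the simple one at
`a`. -/
lemma not_single_simple_pole (hω₁ : 0 < ω₁) (hτ : 0 < τ) (hf : IsElliptic ω₁ τ f) {a : ℂ}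
    (ha : a ∈ fundRect ω₁ τ) (h : ∀ z ∈ fundRect ω₁ τ, z ≠ a → 0 ≤ meromorphicOrderAt f z) :
    meromorphicOrderAt f a ≠ ((-1 : ℤ) : WithTop ℤ) := by
  intro hpole
  have hne : ∀ z, meromorphicOrderAt f z ≠ ⊤ :=
    order_ne_top_of_ne_top hf.meromorphic (z := a) (by rw [hpole]; exact WithTop.coe_ne_top)
  have hda : meromorphicOrderAt (_root_.deriv f) a = ((-2 : ℤ) : WithTop ℤ) :=
    meromorphicOrderAt_deriv_eq_sub_one (n := -1) (by norm_num) hpole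
  have hdne : ∀ z, meromorphicOrderAt (_root_.deriv f) z ≠ ⊤ :=
    order_ne_top_of_ne_top hf.deriv.meromorphic (z := a) (by rw [hda]; exact WithTop.coe_ne_top)
  obtain ⟨z₁, hz₁, hz₁a, hz₁0⟩ : ∃ z₁ ∈ fundRect ω₁ τ, z₁ ≠ a ∧ 0 < ordZ (_root_.deriv f) z₁ := by
    by_contra! hcon
    have h1 := hf.deriv.finsum_ordZ_fundRect hω₁ hτ hdne
    have h2 : ∑ᶠ z ∈ fundRect ω₁ τ, -ordZ (_root_.deriv f) z = 0 := by
      have h0 : ∀ z, (∑ᶠ (_ : z ∈ fundRect ω₁ τ), -ordZ (_root_.deriv f) z) =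
          -∑ᶠ (_ : z ∈ fundRect ω₁ τ), ordZ (_root_.deriv f) z := fun z => finsum_neg_distrib _
      rw [finsum_congr h0, finsum_neg_distrib, h1, neg_zero]
    have h3 := sum_le_finsum_mem (A := fundRect ω₁ τ) (g := fun z => -ordZ (_root_.deriv f) z) (by
      simpa using finite_support_ordZ hf.deriv.meromorphic hdne (subset_refl (fundRect ω₁ τ)))
      {a} (by simpa using ha) (fun z hz hza => by
        have := hcon z hz (by simpa using hza)
        omega)
    rw [h2] at h3
    simp [ordZ, hda] at h3
  have hz₁f := h z₁ hz₁ hz₁a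
  obtain ⟨c, hc⟩ := tendsto_nhds_of_meromorphicOrderAt_nonneg (hf.meromorphic z₁) hz₁f
  have hpos := order_sub_const_of_tendsto (hf.meromorphic z₁) hc
  set k : ℂ → ℂ := fun w => f w - c with hk
  have hkell : IsElliptic ω₁ τ k := hf.sub_const c
  have hkderiv : _root_.deriv k = _root_.deriv f := by
    funext z
    simp [hk]
  have hkadd : k = f + fun _ => -c := by
    funext w
    simp [hk, sub_eq_add_neg]
  have hka : meromorphicOrderAt k a = ((-1 : ℤ) : WithTop ℤ) := by
    rw [hkadd, meromorphicOrderAt_add_eq_left_of_lt (MeromorphicAt.const _ _), hpole]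
    rw [hpole]
    refine lt_of_lt_of_le ?_ (analyticAt_const (v := -c)).meromorphicOrderAt_nonneg
    exact_mod_cast (by norm_num : (-1 : ℤ) < 0)
  have hkne : ∀ z, meromorphicOrderAt k z ≠ ⊤ :=
    order_ne_top_of_ne_top hkell.meromorphic (z := a) (by rw [hka]; exact WithTop.coe_ne_top)
  have hk2 : 2 ≤ ordZ k z₁ := by
    have h1 : 0 < ordZ k z₁ := by
      rw [← coe_ordZ (hkne z₁)] at hpos
      exact_mod_cast hpos
    have h2 := meromorphicOrderAt_deriv_eq_sub_one (n := ordZ k z₁) (by exact_mod_cast h1.ne')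
      (coe_ordZ (hkne z₁)).symm
    rw [hkderiv] at h2
    have h3 : ordZ (_root_.deriv f) z₁ = ordZ k z₁ - 1 := by
      rw [ordZ, h2, WithTop.untop₀_coe]
    omega
  have hsum := hkell.finsum_ordZ_fundRect hω₁ hτ hkne
  have h4 := sum_le_finsum_mem (finite_support_ordZ hkell.meromorphic hkne
    (subset_refl (fundRect ω₁ τ))) {a, z₁} (by
      intro z hz
      rcases Finset.mem_insert.1 hz with rfl | hz
      · exact ha
      · rw [Finset.mem_singleton.1 hz]; exact hz₁) (by
      intro z hz hzX
      have hza : z ≠ a := fun h => hzX (by simp [h])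
      have h5 : 0 ≤ meromorphicOrderAt k z := by
        have h6 := meromorphicOrderAt_add (hf.meromorphic z) (MeromorphicAt.const (-c) z)
        rw [hkadd]
        exact le_trans (le_min (h z hz hza)
          (analyticAt_const (𝕜 := ℂ) (v := -c)).meromorphicOrderAt_nonneg) h6
      rw [← coe_ordZ (hkne z)] at h5
      exact_mod_cast h5)
  rw [hsum, Finset.sum_pair hz₁a.symm] at h4
  have : ordZ k a = -1 := by simp [ordZ, hka]
  omega

end IsElliptic

/-! ### The spaces `𝓛(n·0 + a)`. -/

namespace IsEllipticPoly

variable {ω₁ τ : ℝ} {a : ℂ} {n m : ℕ} {f g : ℂ → ℂ}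

lemma mono (hf : IsEllipticPoly ω₁ τ a n f) (h : n ≤ m) : IsEllipticPoly ω₁ τ a m f :=
  { hf with order_zero := le_trans (by exact_mod_cast (by omega : -(m : ℤ) ≤ -n)) hf.order_zero }

lemma add (hf : IsEllipticPoly ω₁ τ a n f) (hg : IsEllipticPoly ω₁ τ a n g) :
    IsEllipticPoly ω₁ τ a n (fun z => f z + g z) where
  meromorphic z := (hf.meromorphic z).add (hg.meromorphic z)
  periodic l hl z := by rw [hf.periodic l hl, hg.periodic l hl]
  holomorphic z h1 h2 := (hf.holomorphic z h1 h2).add (hg.holomorphic z h1 h2)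
  order_zero := le_trans (le_min hf.order_zero hg.order_zero)
    (meromorphicOrderAt_add (hf.meromorphic 0) (hg.meromorphic 0))
  order_anchor := le_trans (le_min hf.order_anchor hg.order_anchor)
    (meromorphicOrderAt_add (hf.meromorphic a) (hg.meromorphic a))

lemma const_mul (hf : IsEllipticPoly ω₁ τ a n f) (c : ℂ) :
    IsEllipticPoly ω₁ τ a n (fun z => c * f z) := by
  have h : ∀ z, meromorphicOrderAt f z ≤ meromorphicOrderAt (fun z => c * f z) z := by
    intro z
    have h1 := fun_meromorphicOrderAt_mul (MeromorphicAt.const c z) (hf.meromorphic z)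
    rw [h1]
    exact le_add_of_nonneg_left analyticAt_const.meromorphicOrderAt_nonneg
  exact
    { meromorphic := fun z => (MeromorphicAt.const c z).mul (hf.meromorphic z)
      periodic := fun l hl z => by rw [hf.periodic l hl]
      holomorphic := fun z h1 h2 => analyticAt_const.mul (hf.holomorphic z h1 h2)
      order_zero := hf.order_zero.trans (h 0)
      order_anchor := hf.order_anchor.trans (h a) }

lemma const (ω₁ τ : ℝ) (a : ℂ) (n : ℕ) (c : ℂ) : IsEllipticPoly ω₁ τ a n (fun _ => c) where
  meromorphic z := MeromorphicAt.const c z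
  periodic _ _ _ := rfl
  holomorphic _ _ _ := analyticAt_const
  order_zero := le_trans (by exact_mod_cast (by omega : -(n : ℤ) ≤ 0))
    analyticAt_const.meromorphicOrderAt_nonneg
  order_anchor := le_trans (by exact_mod_cast (by omega : (-1 : ℤ) ≤ 0))
    analyticAt_const.meromorphicOrderAt_nonneg

lemma sub (hf : IsEllipticPoly ω₁ τ a n f) (hg : IsEllipticPoly ω₁ τ a n g) :
    IsEllipticPoly ω₁ τ a n (fun z => f z - g z) := by
  have := hf.add (hg.const_mul (-1))
  simpa [sub_eq_add_neg] using this

lemma sum {ι : Type*} {s : Finset ι} {F : ι → ℂ → ℂ}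
    (h : ∀ i ∈ s, IsEllipticPoly ω₁ τ a n (F i)) :
    IsEllipticPoly ω₁ τ a n (fun z => ∑ i ∈ s, F i z) := by
  classical
  induction s using Finset.induction_on with
  | empty => simpa using const ω₁ τ a n 0
  | insert i s hi ih =>
    simp only [Finset.sum_insert hi]
    exact (h i (by simp)).add (ih fun j hj => h j (by simp [hj]))

lemma congr_anchor {a' : ℂ} (h : a' - a ∈ rectLattice ω₁ τ) (hf : IsEllipticPoly ω₁ τ a n f) :
    IsEllipticPoly ω₁ τ a' n f :=
  { hf with
    holomorphic := fun z h1 h2 => hf.holomorphic z h1 fun h3 => h2 (by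
      have := sub_mem h3 h
      rwa [show z - a - (a' - a) = z - a' by ring] at this)
    order_anchor := by rw [hf.isElliptic.order_congr h]; exact hf.order_anchor }

lemma order_nonneg (hf : IsEllipticPoly ω₁ τ a n f) {z : ℂ} (h1 : z ∉ rectLattice ω₁ τ)
    (h2 : z - a ∉ rectLattice ω₁ τ) : 0 ≤ meromorphicOrderAt f z :=
  (hf.holomorphic z h1 h2).meromorphicOrderAt_nonneg

lemma pred_of_tendsto_zero (hf : IsEllipticPoly ω₁ τ a (n + 1) f)
    (h : Tendsto (fun z : ℂ => z ^ (n + 1) * f z) (𝓝[≠] 0) (𝓝 0)) :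
    IsEllipticPoly ω₁ τ a n f := by
  refine { hf with order_zero := ?_ }
  have hp : MeromorphicAt (fun z : ℂ => z ^ (n + 1)) 0 := by fun_prop
  have hpo : meromorphicOrderAt (fun z : ℂ => z ^ (n + 1)) 0 = ((n + 1 : ℕ) : WithTop ℤ) := by
    have := fun_meromorphicOrderAt_pow_id_sub_const (𝕜 := ℂ) (x := 0) (n := n + 1)
    simpa using this
  have h1 := (tendsto_zero_iff_meromorphicOrderAt_pos (hp.mul (hf.meromorphic 0))).1 h
  rw [meromorphicOrderAt_mul hp (hf.meromorphic 0), hpo] at h1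
  cases ho : meromorphicOrderAt f 0 with
  | top => exact le_top
  | coe k =>
    rw [ho] at h1
    have h2 : (0 : ℤ) < (n + 1 : ℕ) + k := by exact_mod_cast h1
    have : -(n : ℤ) ≤ k := by push_cast at h2; omega
    exact_mod_cast this

/-- The only pole left is a simple one at the anchor, which cannot occur alone. The anchor is moved
into the fundamental rectangle to apply `not_single_simple_pole`. -/
lemma exists_const_of_zero (hω₁ : 0 < ω₁) (hτ : 0 < τ)
    (hf : IsEllipticPoly ω₁ τ a 0 f) :
    ∃ c, ∀ z, z ∉ rectLattice ω₁ τ → z - a ∉ rectLattice ω₁ τ → f z = c := by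
  have hzero : ∀ z ∈ rectLattice ω₁ τ, 0 ≤ meromorphicOrderAt f z := by
    intro z hz
    rw [hf.isElliptic.order_congr (w := 0) (by simpa using hz)]
    simpa using hf.order_zero
  obtain ⟨l, hl, hal⟩ := exists_add_mem_fundRect hω₁ hτ a
  have hpole := hf.isElliptic.not_single_simple_pole hω₁ hτ hal (by
    intro z hz hza
    by_cases h1 : z ∈ rectLattice ω₁ τ
    · exact hzero z h1
    · refine hf.order_nonneg h1 fun h2 => hza (eq_of_sub_mem_rectLattice hz hal ?_)
      have := sub_mem h2 hl
      rwa [show z - a - l = z - (a + l) by ring] at this)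
  rw [hf.isElliptic.order_add hl] at hpole
  have hanchor : 0 ≤ meromorphicOrderAt f a := by
    have h1 := hf.order_anchor
    cases ho : meromorphicOrderAt f a with
    | top => exact le_top
    | coe k =>
      rw [ho] at h1 hpole
      have h2 : (-1 : ℤ) ≤ k := by exact_mod_cast h1
      have h3 : k ≠ -1 := fun h => hpole (by rw [h])
      exact_mod_cast (by omega : 0 ≤ k)
  obtain ⟨c, hc⟩ := hf.isElliptic.exists_const hω₁ hτ (by
    intro z
    by_cases h1 : z ∈ rectLattice ω₁ τ
    · exact hzero z h1
    by_cases h2 : z - a ∈ rectLattice ω₁ τ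
    · rw [hf.isElliptic.order_congr h2]
      exact hanchor
    exact hf.order_nonneg h1 h2)
  exact ⟨c, fun z h1 h2 => hc z (hf.holomorphic z h1 h2)⟩

end IsEllipticPoly

/-! ### A basis with prescribed orders at `0`. -/

open Classical in
/-- A basis of the elliptic functions with poles at most at `0` and a simple pole at `a`, ordered
by the order of the pole at `0`. -/
noncomputable def ellBasis (L : PeriodPair) (a : ℂ) : ℕ → ℂ → ℂ
  | 0 => fun _ => 1
  | 1 => fun z => if z ∈ L.lattice ∨ z - a ∈ L.lattice then 0 else L.zeta z - L.zeta (z - a)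
  | n + 2 => deriv^[n] L.weierstrassP

/-- Linear combinations of the first `n + 1` basis functions. -/
noncomputable def ellSum (L : PeriodPair) (a : ℂ) (n : ℕ) (c : Fin (n + 1) → ℂ) (z : ℂ) : ℂ :=
  ∑ j, c j * ellBasis L a j z

lemma ellBasis_one_of_notMem (L : PeriodPair) (a : ℂ) {z : ℂ} (h1 : z ∉ L.lattice)
    (h2 : z - a ∉ L.lattice) : ellBasis L a 1 z = L.zeta z - L.zeta (z - a) := by
  simp [ellBasis, h1, h2]

lemma PeriodPair.eventually_notMem (L : PeriodPair) (z : ℂ) : ∀ᶠ w in 𝓝[≠] z, w ∉ L.lattice := by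
  filter_upwards [nhdsWithin_le_nhds (L.compl_lattice_sdiff_singleton_mem_nhds z),
    self_mem_nhdsWithin] with w h1 h2 h3
  exact h1 ⟨h3, h2⟩

lemma PeriodPair.eventually_sub_notMem (L : PeriodPair) (a z : ℂ) :
    ∀ᶠ w in 𝓝[≠] z, w - a ∉ L.lattice := by
  have h : Tendsto (fun w => w - a) (𝓝[≠] z) (𝓝[≠] (z - a)) :=
    tendsto_nhdsWithin_iff.2 ⟨((continuous_id.sub continuous_const).tendsto z).mono_left
      nhdsWithin_le_nhds, by
        filter_upwards [self_mem_nhdsWithin] with w hw using by simpa [sub_left_inj] using hw⟩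
  exact h.eventually (L.eventually_notMem (z - a))

lemma eventually_notMem_polar {ω₁ τ : ℝ} (hω₁ : 0 < ω₁) (hτ : 0 < τ) (a z : ℂ) :
    ∀ᶠ w in 𝓝[≠] z, w ∉ rectLattice ω₁ τ ∧ w - a ∉ rectLattice ω₁ τ :=
  ((rectPeriodPair hω₁ hτ).eventually_notMem z).and
    ((rectPeriodPair hω₁ hτ).eventually_sub_notMem a z)

section

variable {ω₁ τ : ℝ} (hω₁ : 0 < ω₁) (hτ : 0 < τ) {a : ℂ}

local notation "𝐋" => rectPeriodPair hω₁ hτ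

lemma ellBasis_one_eventuallyEq (L : PeriodPair) (a z : ℂ) :
    ellBasis L a 1 =ᶠ[𝓝[≠] z] fun w => L.zeta w - L.zeta (w - a) := by
  filter_upwards [L.eventually_notMem z, L.eventually_sub_notMem a z] with w h1 h2
  exact ellBasis_one_of_notMem L a h1 h2

lemma order_iterate_deriv_weierstrassP (L : PeriodPair) (n : ℕ) :
    meromorphicOrderAt (deriv^[n] L.weierstrassP) 0 = ((-(n + 2 : ℕ) : ℤ) : WithTop ℤ) := by
  induction n with
  | zero =>
    rw [Function.iterate_zero, id, L.order_weierstrassP 0 (zero_mem _)]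
    rfl
  | succ n ih =>
    rw [Function.iterate_succ_apply', meromorphicOrderAt_deriv_eq_sub_one ?_ ih]
    · congr 1
    · exact_mod_cast (by omega : -((n + 2 : ℕ) : ℤ) ≠ 0)

lemma isElliptic_iterate_deriv_weierstrassP (n : ℕ) :
    IsElliptic ω₁ τ (deriv^[n] (𝐋).weierstrassP) := by
  induction n with
  | zero => exact ⟨fun z => (𝐋).meromorphic_weierstrassP z, fun l hl z =>
      (𝐋).weierstrassP_add_coe z ⟨l, hl⟩⟩
  | succ n ih =>
    rw [Function.iterate_succ_apply']
    exact ih.deriv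

lemma analyticAt_iterate_deriv_weierstrassP (L : PeriodPair) (n : ℕ) {z : ℂ}
    (hz : z ∉ L.lattice) : AnalyticAt ℂ (deriv^[n] L.weierstrassP) z := by
  induction n with
  | zero => exact L.analyticOnNhd_weierstrassP z hz
  | succ n ih =>
    rw [Function.iterate_succ_apply']
    exact ih.deriv

lemma analyticAt_zeta_sub (L : PeriodPair) {a z : ℂ} (hz : z - a ∉ L.lattice) :
    AnalyticAt ℂ (fun w => L.zeta (w - a)) z :=
  AnalyticAt.fun_comp (f := fun w => w - a) (x := z) (L.analyticAt_zeta hz) (by fun_prop)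

lemma order_ellBasis_one_zero (L : PeriodPair) (ha : a ∉ L.lattice) :
    meromorphicOrderAt (ellBasis L a 1) 0 = ((-1 : ℤ) : WithTop ℤ) := by
  have han : AnalyticAt ℂ (fun w => -L.zeta (w - a)) 0 :=
    (analyticAt_zeta_sub L (by simpa using ha)).neg
  have heq : ellBasis L a 1 =ᶠ[𝓝[≠] 0] L.zeta + fun w => -L.zeta (w - a) :=
    (ellBasis_one_eventuallyEq L a 0).trans (Eventually.of_forall fun w => by
      simp [sub_eq_add_neg])
  rw [meromorphicOrderAt_congr heq,
    meromorphicOrderAt_add_eq_left_of_lt han.meromorphicAt, L.order_zeta (zero_mem _)]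
  rw [L.order_zeta (zero_mem _)]
  exact lt_of_lt_of_le (by exact_mod_cast (by norm_num : (-1 : ℤ) < 0)) han.meromorphicOrderAt_nonneg

lemma order_ellBasis (L : PeriodPair) (ha : a ∉ L.lattice) (n : ℕ) :
    meromorphicOrderAt (ellBasis L a n) 0 = ((-(n : ℤ) : ℤ) : WithTop ℤ) := by
  match n with
  | 0 =>
    have := (analyticAt_const (𝕜 := ℂ) (v := (1 : ℂ)) (x := 0)).meromorphicNFAt
    simpa [ellBasis] using! this.meromorphicOrderAt_eq_zero_iff.2 one_ne_zero
  | 1 => exact_mod_cast order_ellBasis_one_zero L ha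
  | n + 2 => exact order_iterate_deriv_weierstrassP L n

lemma ellBasis_mem (ha : a ∉ rectLattice ω₁ τ) (n : ℕ) :
    IsEllipticPoly ω₁ τ a n (ellBasis 𝐋 a n) := by
  match n with
  | 0 => exact IsEllipticPoly.const ω₁ τ a 0 1
  | 1 =>
    have hmer : ∀ z, MeromorphicAt (fun w => (𝐋).zeta w - (𝐋).zeta (w - a)) z := fun z =>
      ((𝐋).meromorphicAt_zeta z).sub
        (MeromorphicAt.comp_analyticAt (g := fun w => w - a)
          ((𝐋).meromorphicAt_zeta _) (by fun_prop))
    have hana : AnalyticAt ℂ (𝐋).zeta a := (𝐋).analyticAt_zeta ha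
    refine ⟨fun z => (hmer z).congr (ellBasis_one_eventuallyEq 𝐋 a z).symm, ?_, ?_, ?_, ?_⟩
    -- The value `0` prescribed at the poles makes periodicity hold at every point. Elsewhere the
    -- quasi-periods of the two zeta functions cancel.
    · intro l hl z
      have h1 : z + l ∈ (𝐋).lattice ↔ z ∈ (𝐋).lattice :=
        ⟨fun h => by simpa using sub_mem h hl, fun h => add_mem h hl⟩
      have h2 : z + l - a ∈ (𝐋).lattice ↔ z - a ∈ (𝐋).lattice :=
        ⟨fun h => by
          have := sub_mem h hl
          rwa [show z + l - a - l = z - a by ring] at this, fun h => by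
          have := add_mem h hl
          rwa [show z - a + l = z + l - a by ring] at this⟩
      by_cases h : z ∈ (𝐋).lattice ∨ z - a ∈ (𝐋).lattice
      · simp only [ellBasis, h1, h2, h, if_true]
      · have h' := not_or.1 h
        rw [ellBasis_one_of_notMem _ _ h'.1 h'.2,
          ellBasis_one_of_notMem _ _ (h1.not.2 h'.1) (h2.not.2 h'.2)]
        obtain ⟨η, hη⟩ := (𝐋).exists_zeta_add hl
        rw [hη z h'.1, show z + l - a = z - a + l by ring, hη _ h'.2]
        ring
    · intro z h1 h2
      have h3 : AnalyticAt ℂ (fun w => (𝐋).zeta w - (𝐋).zeta (w - a)) z :=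
        ((𝐋).analyticAt_zeta h1).sub (analyticAt_zeta_sub 𝐋 h2)
      refine h3.congr ?_
      have h4 := (𝐋).isClosed_lattice.isOpen_compl.mem_nhds h1
      have h5 : ∀ᶠ w in 𝓝 z, w - a ∈ ((𝐋).lattice : Set ℂ)ᶜ :=
        (continuous_id.sub continuous_const).continuousAt.eventually
          ((𝐋).isClosed_lattice.isOpen_compl.mem_nhds h2)
      filter_upwards [h4, h5] with w h6 h7
      exact (ellBasis_one_of_notMem _ _ h6 h7).symm
    · exact (order_ellBasis_one_zero 𝐋 ha).ge
    · rw [meromorphicOrderAt_congr (ellBasis_one_eventuallyEq 𝐋 a a)]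
      have hz : meromorphicOrderAt (fun w => (𝐋).zeta (w - a)) a = ((-1 : ℤ) : WithTop ℤ) := by
        rw [meromorphicOrderAt_fun_comp_sub_const_eq_meromorphicOrderAt, sub_self,
          (𝐋).order_zeta (zero_mem _)]
      have hm : MeromorphicAt (fun w => (𝐋).zeta (w - a)) a :=
        meromorphicAt_of_meromorphicOrderAt_ne_zero (by
          rw [hz]; exact WithTop.coe_injective.ne (by norm_num : (-1 : ℤ) ≠ 0))
      have h1 := meromorphicOrderAt_add hana.meromorphicAt hm.neg
      rw [← meromorphicOrderAt_neg, hz, ← sub_eq_add_neg] at h1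
      refine le_trans (le_min ?_ le_rfl) h1
      exact le_trans (by exact_mod_cast (by norm_num : (-1 : ℤ) ≤ 0)) hana.meromorphicOrderAt_nonneg
  | n + 2 =>
    have h := isElliptic_iterate_deriv_weierstrassP hω₁ hτ n
    exact
      { meromorphic := h.meromorphic
        periodic := h.periodic
        holomorphic := fun z h1 _ => analyticAt_iterate_deriv_weierstrassP 𝐋 n h1
        order_zero := (order_ellBasis 𝐋 ha (n + 2)).ge
        order_anchor := le_trans (by exact_mod_cast (by norm_num : (-1 : ℤ) ≤ 0))
          (analyticAt_iterate_deriv_weierstrassP 𝐋 n (z := a) ha).meromorphicOrderAt_nonneg }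

lemma ellSum_mem (ha : a ∉ rectLattice ω₁ τ) (n : ℕ) (c : Fin (n + 1) → ℂ) :
    IsEllipticPoly ω₁ τ a n (ellSum 𝐋 a n c) :=
  IsEllipticPoly.sum fun j _ => ((ellBasis_mem hω₁ hτ ha j).mono (Fin.is_le j)).const_mul (c j)

/-- Here `c` is the limit of `f / e` at `z`: subtracting `c * e` cancels the leading term. -/
lemma exists_sub_mul_order {f e : ℂ → ℂ} {z : ℂ} {n : ℤ} (hf : MeromorphicAt f z)
    (h1 : (n : WithTop ℤ) ≤ meromorphicOrderAt f z) (h2 : meromorphicOrderAt e z = n)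
    (he : MeromorphicAt e z) :
    ∃ c : ℂ, ((n + 1 : ℤ) : WithTop ℤ) ≤ meromorphicOrderAt (fun w => f w - c * e w) z := by
  have hq : 0 ≤ meromorphicOrderAt (f / e) z := by
    rw [meromorphicOrderAt_div hf he, h2]
    cases ho : meromorphicOrderAt f z with
    | top => exact le_top
    | coe k =>
      rw [ho] at h1
      have : n ≤ k := by exact_mod_cast h1
      exact_mod_cast (by omega : 0 ≤ k - n)
  obtain ⟨c, hc⟩ := tendsto_nhds_of_meromorphicOrderAt_nonneg (hf.div he) hq
  have hpos := order_sub_const_of_tendsto (hf.div he) hc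
  refine ⟨c, ?_⟩
  have hne : ∀ᶠ w in 𝓝[≠] z, e w ≠ 0 :=
    (meromorphicOrderAt_ne_top_iff_eventually_ne_zero he).1 (by rw [h2]; exact WithTop.coe_ne_top)
  have heq : (fun w => f w - c * e w) =ᶠ[𝓝[≠] z] (fun w => (f / e) w - c) * e := by
    filter_upwards [hne] with w hw
    simp only [Pi.mul_apply, Pi.div_apply]
    field_simp
  rw [meromorphicOrderAt_congr heq,
    meromorphicOrderAt_mul (f := fun w => (f / e) w - c) ((hf.div he).sub (MeromorphicAt.const c z)) he, h2]
  cases ho : meromorphicOrderAt (fun w => (f / e) w - c) z with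
  | top => exact le_top
  | coe k =>
    rw [ho] at hpos
    have : 0 < k := by exact_mod_cast hpos
    exact_mod_cast (by omega : n + 1 ≤ k + n)

/-- By induction on the order of the pole at `0`: the last basis function cancels the leading term,
and the remainder lies in the previous space. The base case is the description of `𝓛(0·0 + a)` as
constants. -/
lemma IsEllipticPoly.exists_eq_ellSum (ha : a ∉ rectLattice ω₁ τ) {n : ℕ} {f : ℂ → ℂ}
    (hf : IsEllipticPoly ω₁ τ a n f) : ∃ c : Fin (n + 1) → ℂ, ∀ z, z ∉ rectLattice ω₁ τ →
      z - a ∉ rectLattice ω₁ τ → f z = ellSum 𝐋 a n c z := by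
  induction n generalizing f with
  | zero =>
    obtain ⟨c, hc⟩ := hf.exists_const_of_zero hω₁ hτ
    exact ⟨fun _ => c, fun z h1 h2 => by simp [ellSum, ellBasis, hc z h1 h2]⟩
  | succ n ih =>
    have he := ellBasis_mem hω₁ hτ ha (n + 1)
    obtain ⟨c, hc⟩ := exists_sub_mul_order (hf.meromorphic 0) hf.order_zero
      (order_ellBasis 𝐋 ha (n + 1)) (he.meromorphic 0)
    have hmem : IsEllipticPoly ω₁ τ a n (fun w => f w - c * ellBasis 𝐋 a (n + 1) w) :=
      { hf.sub (he.const_mul c) with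
        order_zero := by
          refine le_trans (le_of_eq ?_) hc
          congr 1
          push_cast
          ring }
    obtain ⟨d, hd⟩ := ih hmem
    refine ⟨Fin.snoc d c, fun z h1 h2 => ?_⟩
    have := hd z h1 h2
    rw [ellSum, Fin.sum_univ_castSucc]
    simp only [Fin.snoc_castSucc, Fin.snoc_last, Fin.val_castSucc, Fin.val_last]
    rw [ellSum] at this
    rw [← this]
    ring

lemma order_ellSum_last (ha : a ∉ rectLattice ω₁ τ) {n : ℕ} {c : Fin (n + 1) → ℂ}
    (hc : c (Fin.last n) ≠ 0) :
    meromorphicOrderAt (ellSum 𝐋 a n c) 0 = ((-(n : ℤ) : ℤ) : WithTop ℤ) := by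
  have hlast : meromorphicOrderAt (fun z => c (Fin.last n) * ellBasis 𝐋 a n z) 0 =
      ((-(n : ℤ) : ℤ) : WithTop ℤ) := by
    rw [← order_ellBasis 𝐋 ha n]
    exact meromorphicOrderAt_mul_of_ne_zero (g := fun _ => c (Fin.last n)) analyticAt_const hc
  have hsplit : ellSum 𝐋 a n c = (fun z => c (Fin.last n) * ellBasis 𝐋 a n z) +
      fun z => ∑ j : Fin n, c j.castSucc * ellBasis 𝐋 a j z := by
    funext z
    rw [ellSum, Fin.sum_univ_castSucc, Pi.add_apply, add_comm]
    simp
  rw [hsplit]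
  match n with
  | 0 =>
    simp only [Finset.univ_eq_empty, Finset.sum_empty]
    rw [← hlast]
    congr 1
    funext z
    simp
  | n + 1 =>
    have hrest : IsEllipticPoly ω₁ τ a n
        (fun z => ∑ j : Fin (n + 1), c j.castSucc * ellBasis 𝐋 a j z) :=
      IsEllipticPoly.sum fun j _ =>
        ((ellBasis_mem hω₁ hτ ha j).mono (Fin.is_le j)).const_mul (c j.castSucc)
    rw [meromorphicOrderAt_add_eq_left_of_lt (hrest.meromorphic 0), hlast]
    rw [hlast]
    exact lt_of_lt_of_le (by exact_mod_cast (by omega : -((n : ℤ) + 1) < -n)) hrest.order_zero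

/-- This is linear independence of the basis: the orders at `0` are distinct, so the last nonzero
coefficient determines the order of the sum. -/
lemma order_ellSum_ne_top (ha : a ∉ rectLattice ω₁ τ) {n : ℕ} {c : Fin (n + 1) → ℂ}
    (hc : c ≠ 0) : meromorphicOrderAt (ellSum 𝐋 a n c) 0 ≠ ⊤ := by
  induction n with
  | zero =>
    rw [order_ellSum_last hω₁ hτ ha]
    · exact WithTop.coe_ne_top
    · intro h
      exact hc (funext fun j => by rw [Fin.eq_zero j]; exact h)
  | succ n ih =>
    by_cases hl : c (Fin.last (n + 1)) = 0
    · have h1 : ellSum 𝐋 a (n + 1) c = ellSum 𝐋 a n (fun j => c j.castSucc) := by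
        funext z
        rw [ellSum, Fin.sum_univ_castSucc, hl]
        simp [ellSum]
      rw [h1]
      refine ih fun h => hc (funext fun j => ?_)
      refine Fin.lastCases hl (fun i => ?_) j
      exact congrFun h i
    · rw [order_ellSum_last hω₁ hτ ha hl]
      exact WithTop.coe_ne_top

end

/-- There is a nonzero function in the space of dimension `k + 1` that vanishes at `k` points. -/
lemma exists_isEllipticPoly_vanishing {ω₁ τ : ℝ} (hω₁ : 0 < ω₁) (hτ : 0 < τ) {a : ℂ}
    (ha : a ∉ rectLattice ω₁ τ)
    (X : Finset ℂ) :
    ∃ Q, IsEllipticPoly ω₁ τ a X.card Q ∧ meromorphicOrderAt Q 0 ≠ ⊤ ∧ ∀ x ∈ X, Q x = 0 := by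
  let T : (Fin (X.card + 1) → ℂ) →ₗ[ℂ] (X → ℂ) :=
    { toFun := fun c x => ellSum (rectPeriodPair hω₁ hτ) a X.card c x
      map_add' := fun c d => by
        funext x
        simp [ellSum, add_mul, Finset.sum_add_distrib]
      map_smul' := fun r c => by
        funext x
        simp [ellSum, mul_assoc, Finset.mul_sum] }
  have hker := LinearMap.ker_ne_bot_of_finrank_lt (f := T) (by simp)
  obtain ⟨c, hc, hc0⟩ := (Submodule.ne_bot_iff _).1 hker
  exact ⟨ellSum (rectPeriodPair hω₁ hτ) a X.card c, ellSum_mem hω₁ hτ ha _ c, order_ellSum_ne_top hω₁ hτ ha hc0,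
    fun x hx => congrFun (LinearMap.mem_ker.1 hc) ⟨x, hx⟩⟩

lemma AnalyticAt.order_eq_one_iff {f : ℂ → ℂ} {z : ℂ} (hf : AnalyticAt ℂ f z) (h0 : f z = 0) :
    meromorphicOrderAt f z = ((1 : ℤ) : WithTop ℤ) ↔ deriv f z ≠ 0 := by
  have hpos : 0 < meromorphicOrderAt f z :=
    (tendsto_zero_iff_meromorphicOrderAt_pos hf.meromorphicAt).1
      (h0 ▸ hf.continuousAt.tendsto.mono_left nhdsWithin_le_nhds)
  rw [← hf.deriv.meromorphicNFAt.meromorphicOrderAt_eq_zero_iff]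
  cases ho : meromorphicOrderAt f z with
  | top =>
    have h1 : f =ᶠ[𝓝[≠] z] 0 := meromorphicOrderAt_eq_top_iff.1 ho
    have h2 : meromorphicOrderAt (deriv f) z = ⊤ := by
      rw [meromorphicOrderAt_congr h1.nhdsNE_deriv, meromorphicOrderAt_eq_top_iff]
      exact Eventually.of_forall fun w => by simp
    simp [h2]
  | coe k =>
    rw [ho] at hpos
    have hk : 0 < k := by exact_mod_cast hpos
    rw [meromorphicOrderAt_deriv_eq_sub_one (by exact_mod_cast hk.ne') ho]
    constructor
    · intro h
      have : k = 1 := by exact_mod_cast h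
      subst this
      rfl
    · intro h
      have : k - 1 = 0 := by exact_mod_cast h
      have : k = 1 := by omega
      rw [this]

/-! ### Parity and sign on a horizontal line. -/

lemma tendsto_horPoint (h t : ℝ) : Tendsto (horPoint h) (𝓝[≠] t) (𝓝[≠] (horPoint h t)) := by
  refine tendsto_nhdsWithin_iff.2 ⟨?_, ?_⟩
  · have : Continuous (horPoint h) := by unfold horPoint; fun_prop
    exact (this.tendsto t).mono_left nhdsWithin_le_nhds
  · filter_upwards [self_mem_nhdsWithin] with s hs h'
    exact hs (by simpa [horPoint] using h')

lemma continuous_horPoint (h : ℝ) : Continuous (horPoint h) := by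
  unfold horPoint
  fun_prop

/-- A sine with simple zeros at `horPoint h p + 2 ω₁ ℤ`. -/
noncomputable def sinFactor (ω₁ : ℝ) (w z : ℂ) : ℂ := Complex.sin (Real.pi * (z - w) / (2 * ω₁))

lemma sinFactor_horPoint (ω₁ h p t : ℝ) : sinFactor ω₁ (horPoint h p) (horPoint h t) =
    (Real.sin (Real.pi * (t - p) / (2 * ω₁)) : ℝ) := by
  simp [sinFactor, horPoint]

lemma sin_factor_eq_zero_iff {ω₁ : ℝ} (hω₁ : 0 < ω₁) (p t : ℝ) :
    Real.sin (Real.pi * (t - p) / (2 * ω₁)) = 0 ↔ ∃ k : ℤ, t - p = k * (2 * ω₁) := by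
  rw [Real.sin_eq_zero_iff]
  refine exists_congr fun k => ?_
  have := Real.pi_pos
  constructor
  · intro h
    field_simp at h
    linarith
  · intro h
    rw [h]
    field_simp

lemma analyticAt_sinFactor (ω₁ : ℝ) (w z : ℂ) : AnalyticAt ℂ (sinFactor ω₁ w) z := by
  have h : Differentiable ℂ (sinFactor ω₁ w) := by
    unfold sinFactor
    simp only [div_eq_mul_inv]
    fun_prop
  exact h.analyticAt z

open Classical in
lemma order_sinFactor {ω₁ : ℝ} (hω₁ : 0 < ω₁) (h p t : ℝ) :
    meromorphicOrderAt (sinFactor ω₁ (horPoint h p)) (horPoint h t) =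
      ((if ∃ k : ℤ, t - p = k * (2 * ω₁) then 1 else 0 : ℤ) : WithTop ℤ) := by
  have han := analyticAt_sinFactor ω₁ (horPoint h p) (horPoint h t)
  split_ifs with hk
  · have h0 := (sin_factor_eq_zero_iff hω₁ p t).2 hk
    rw [han.order_eq_one_iff (by rw [sinFactor_horPoint, h0]; rfl)]
    have hd : HasDerivAt (sinFactor ω₁ (horPoint h p))
        (Complex.cos (Real.pi * (horPoint h t - horPoint h p) / (2 * ω₁)) *
          (Real.pi / (2 * ω₁))) (horPoint h t) := by
      have h1 := (((hasDerivAt_id (horPoint h t)).sub_const (horPoint h p)).const_mul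
        (Real.pi : ℂ)).div_const (2 * ω₁ : ℂ)
      have h2 := (Complex.hasDerivAt_sin (Real.pi * (horPoint h t - horPoint h p) / (2 * ω₁))).comp
        (horPoint h t) h1
      simpa using! h2
    rw [hd.deriv]
    have hc : Real.cos (Real.pi * (t - p) / (2 * ω₁)) ≠ 0 := by
      intro hc
      have := Real.sin_sq_add_cos_sq (Real.pi * (t - p) / (2 * ω₁))
      rw [h0, hc] at this
      norm_num at this
    have hc' : Complex.cos (Real.pi * (horPoint h t - horPoint h p) / (2 * ω₁)) =
        (Real.cos (Real.pi * (t - p) / (2 * ω₁)) : ℝ) := by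
      simp [horPoint]
    rw [hc']
    have h3 : (Real.pi : ℂ) ≠ 0 := by exact_mod_cast Real.pi_ne_zero
    have h4 : (ω₁ : ℂ) ≠ 0 := by exact_mod_cast hω₁.ne'
    have h5 : ((Real.cos (Real.pi * (t - p) / (2 * ω₁)) : ℝ) : ℂ) ≠ 0 := by exact_mod_cast hc
    exact mul_ne_zero h5 (div_ne_zero h3 (mul_ne_zero two_ne_zero h4))
  · have h0 := (sin_factor_eq_zero_iff hω₁ p t).not.2 hk
    exact han.meromorphicNFAt.meromorphicOrderAt_eq_zero_iff.2 (by
      rw [sinFactor_horPoint]; exact_mod_cast h0)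

/-- `f` is real on the line of height `h`. -/
def IsRealOnLine (f : ℂ → ℂ) (h : ℝ) : Prop :=
  ∀ t : ℝ, AnalyticAt ℂ f (horPoint h t) → (f (horPoint h t)).im = 0

lemma finite_line_support {f : ℂ → ℂ} (hf : ∀ z, MeromorphicAt f z)
    (hne : ∀ z, meromorphicOrderAt f z ≠ ⊤) (c h : ℝ) :
    {t : ℝ | t ∈ Set.Icc 0 c ∧ ¬ (AnalyticAt ℂ f (horPoint h t) ∧ f (horPoint h t) ≠ 0)}.Finite := by
  have h1 := finite_irregular hf hne (isCompact_rect 0 c h h)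
  refine (h1.image Complex.re).subset ?_
  rintro t ⟨ht, ht'⟩
  exact ⟨horPoint h t, ⟨by simpa [horPoint_re, horPoint_im] using ht, ht'⟩, horPoint_re h t⟩

lemma exists_regular {f : ℂ → ℂ} (hf : ∀ z, MeromorphicAt f z)
    (hne : ∀ z, meromorphicOrderAt f z ≠ ⊤) {c : ℝ} (hc : 0 < c) (h : ℝ) :
    ∃ t : ℝ, AnalyticAt ℂ f (horPoint h t) ∧ f (horPoint h t) ≠ 0 := by
  by_contra! hcon
  refine (Set.Icc_infinite hc) ((finite_line_support hf hne c h).subset fun t ht => ⟨ht, ?_⟩)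
  exact fun h' => h'.2 (hcon t h'.1)

lemma horPoint_add_mem {ω₁ τ : ℝ} (k : ℤ) : ((k * (2 * ω₁) : ℝ) : ℂ) ∈ rectLattice ω₁ τ :=
  mem_rectLattice.2 ⟨k, 0, by simp⟩

lemma horPoint_add (h t s : ℝ) : horPoint h (t + s) = horPoint h t + (s : ℂ) := by
  simp [horPoint]
  ring

/-- The zeros and poles of `f` on the line are divided out by sines with the same zeros modulo
`2ω₁`. The quotient extends to a continuous nonvanishing real function `G`. Since the sines change
sign over a period, the parity of the orders can be read off. -/
lemma IsElliptic.exists_line_factorization {ω₁ τ : ℝ} (hω₁ : 0 < ω₁) {f : ℂ → ℂ}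
    (hf : IsElliptic ω₁ τ f) (hne : ∀ z, meromorphicOrderAt f z ≠ ⊤) {h : ℝ}
    (hreal : IsRealOnLine f h) :
    ∃ (S : Finset ℝ) (G : ℝ → ℝ),
      (∀ p, p ∈ S ↔ p ∈ Set.Ico 0 (2 * ω₁) ∧ ordZ f (horPoint h p) ≠ 0) ∧ Continuous G ∧
      (∀ t, G t ≠ 0) ∧ ∀ t, AnalyticAt ℂ f (horPoint h t) → f (horPoint h t) ≠ 0 →
        (∀ p ∈ S, Real.sin (Real.pi * (t - p) / (2 * ω₁)) ≠ 0) ∧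
        (f (horPoint h t)).re = G t * ∏ p ∈ S,
          Real.sin (Real.pi * (t - p) / (2 * ω₁)) ^ ordZ f (horPoint h p) := by
  classical
  have hfin : {t : ℝ | t ∈ Set.Ico 0 (2 * ω₁) ∧ ordZ f (horPoint h t) ≠ 0}.Finite :=
    (finite_line_support hf.meromorphic hne (2 * ω₁) h).subset fun t ht =>
      ⟨Set.Ico_subset_Icc_self ht.1, fun h' => ht.2 (ordZ_eq_zero h'.1 h'.2)⟩
  set S := hfin.toFinset with hSdef
  have hS : ∀ p, p ∈ S ↔ p ∈ Set.Ico 0 (2 * ω₁) ∧ ordZ f (horPoint h p) ≠ 0 := fun p => by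
    simp [hSdef]
  set P : ℂ → ℂ := fun z => ∏ p ∈ S, sinFactor ω₁ (horPoint h p) z ^ (-ordZ f (horPoint h p))
    with hP
  have hsm : ∀ p z, MeromorphicAt (fun z => sinFactor ω₁ (horPoint h p) z ^
      (-ordZ f (horPoint h p))) z := fun p z => (analyticAt_sinFactor ω₁ _ z).meromorphicAt.zpow _
  have hPm : ∀ z, MeromorphicAt P z := fun z => MeromorphicAt.fun_prod fun p _ => hsm p z
  have hshift : ∀ t : ℝ, ∀ k : ℤ, ordZ f (horPoint h (t + k * (2 * ω₁))) = ordZ f (horPoint h t) := by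
    intro t k
    rw [horPoint_add, ordZ, hf.order_add (horPoint_add_mem k)]
    rfl
  have hPord : ∀ t, meromorphicOrderAt P (horPoint h t) = ((-ordZ f (horPoint h t) : ℤ) : WithTop ℤ) := by
    intro t
    -- Of the sines attached to `S`, only the one at the representative `t₀` of `t` modulo `2ω₁` can
    -- vanish at `t`.
    obtain ⟨k, hk, -⟩ := existsUnique_add_zsmul_mem_Ico (by positivity : (0 : ℝ) < 2 * ω₁) t 0
    rw [zero_add, zsmul_eq_mul] at hk
    set t₀ := t + k * (2 * ω₁) with ht₀
    have hiff : ∀ p ∈ S, (∃ j : ℤ, t - p = j * (2 * ω₁)) ↔ p = t₀ := by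
      intro p hp
      constructor
      · rintro ⟨j, hj⟩
        have h1 : p + ((j + k : ℤ) : ℝ) * (2 * ω₁) = t₀ := by
          push_cast
          rw [ht₀]
          linarith
        have h2 := int_mul_eq_zero_of_mem_Ico ((hS p).1 hp).1 (m := j + k) (by rw [h1]; exact hk)
        rw [h2] at h1
        simpa using h1
      · rintro rfl
        exact ⟨-k, by push_cast; rw [ht₀]; ring⟩
    rw [hP, meromorphicOrderAt_fun_prod fun p _ => hsm p _]
    have h3 : ∀ p ∈ S, meromorphicOrderAt (fun z => sinFactor ω₁ (horPoint h p) z ^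
        (-ordZ f (horPoint h p))) (horPoint h t) =
        ((if p = t₀ then -ordZ f (horPoint h p) else 0 : ℤ) : WithTop ℤ) := by
      intro p hp
      rw [fun_meromorphicOrderAt_zpow (analyticAt_sinFactor ω₁ _ _).meromorphicAt,
        order_sinFactor hω₁, ← WithTop.coe_mul]
      simp only [hiff p hp]
      congr 1
      split_ifs <;> simp
    rw [Finset.sum_congr rfl h3, ← WithTop.coe_sum, Finset.sum_ite_eq']
    rw [← hshift t k]
    split_ifs with h4
    · rfl
    · have h5 : ordZ f (horPoint h t₀) = 0 := by
        by_contra h6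
        exact h4 ((hS _).2 ⟨hk, h6⟩)
      rw [← ht₀, h5]
      rfl
  set g : ℂ → ℂ := f * P with hg
  have hgm : ∀ z, MeromorphicAt g z := fun z => (hf.meromorphic z).mul (hPm z)
  have hgm' : MeromorphicOn g Set.univ := fun z _ => hgm z
  have hgord : ∀ t, meromorphicOrderAt g (horPoint h t) = 0 := by
    intro t
    rw [hg, meromorphicOrderAt_mul (hf.meromorphic _) (hPm _), hPord, ← coe_ordZ (hne _),
      ← WithTop.coe_add]
    simp
  set F := toMeromorphicNFOn g Set.univ
  have hFe : ∀ z, F =ᶠ[𝓝 z] toMeromorphicNFAt g z := fun z =>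
    toMeromorphicNFOn_eq_toMeromorphicNFAt_on_nhds hgm' (Set.mem_univ z)
  have hFan : ∀ t, AnalyticAt ℂ F (horPoint h t) := fun t =>
    ((hgm _).meromorphicOrderAt_nonneg_iff_analyticAt_toMeromorphicNFAt.1 (hgord t).ge).congr
      (hFe _).symm
  have hFne : ∀ t, F (horPoint h t) ≠ 0 := fun t => by
    rw [(hFe (horPoint h t)).eq_of_nhds]
    exact (hgm _).meromorphicOrderAt_eq_zero_iff_toMeromorphicNFAt_ne_zero.1 (hgord t)
  have hPreal : ∀ t, P (horPoint h t) = (∏ p ∈ S,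
      Real.sin (Real.pi * (t - p) / (2 * ω₁)) ^ (-ordZ f (horPoint h p)) : ℝ) := by
    intro t
    simp only [hP, sinFactor_horPoint]
    push_cast
    rfl
  -- Near `t`, but off it, `F` is a product of real values; continuity gives reality at `t` itself.
  have hFim : ∀ t, (F (horPoint h t)).im = 0 := by
    intro t
    have h1 : Tendsto (fun s => (F (horPoint h s)).im) (𝓝[≠] t) (𝓝 (F (horPoint h t)).im) :=
      ((Complex.continuous_im.continuousAt.comp ((hFan t).continuousAt.comp
        (continuous_horPoint h).continuousAt)).tendsto).mono_left nhdsWithin_le_nhds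
    refine tendsto_nhds_unique h1 (tendsto_const_nhds.congr' ?_)
    filter_upwards [(tendsto_horPoint h t).eventually
      ((hgm'.toMeromorphicNFOn_eq_self_on_nhdsNE (Set.mem_univ _)).and
        (hf.meromorphic (horPoint h t)).eventually_analyticAt)] with s hs
    change 0 = (toMeromorphicNFOn g Set.univ (horPoint h s)).im
    rw [hs.1, hg, Pi.mul_apply, hPreal, Complex.mul_im, hreal s hs.2, Complex.ofReal_im, mul_zero,
      zero_mul, add_zero]
  refine ⟨S, fun t => (F (horPoint h t)).re, hS, ?_, ?_, ?_⟩
  · refine continuous_iff_continuousAt.2 fun t => ?_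
    exact Complex.continuous_re.continuousAt.comp ((hFan t).continuousAt.comp
        (continuous_horPoint h).continuousAt)
  · intro t h0
    exact hFne t (Complex.ext h0 (hFim t))
  · intro t h1 h2
    have hsin : ∀ p ∈ S, Real.sin (Real.pi * (t - p) / (2 * ω₁)) ≠ 0 := by
      intro p hp h3
      obtain ⟨k, hk⟩ := (sin_factor_eq_zero_iff hω₁ p t).1 h3
      have h4 := hshift p k
      rw [show p + k * (2 * ω₁) = t by linarith, ordZ_eq_zero h1 h2] at h4
      exact ((hS p).1 hp).2 h4.symm
    refine ⟨hsin, ?_⟩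
    have hPan : AnalyticAt ℂ P (horPoint h t) := by
      refine Finset.analyticAt_fun_prod S fun p hp => (analyticAt_sinFactor ω₁ _ _).fun_zpow ?_
      rw [sinFactor_horPoint]
      exact_mod_cast hsin p hp
    have hFg : F (horPoint h t) = g (horPoint h t) := by
      rw [(hFe (horPoint h t)).eq_of_nhds, toMeromorphicNFAt_eq_self.2 (h1.mul hPan).meromorphicNFAt]
    have him := hreal t h1
    simp only [hFg]
    rw [hg, Pi.mul_apply, hPreal, Complex.mul_re, him, Complex.ofReal_re, zero_mul, sub_zero,
      mul_assoc, ← Finset.prod_mul_distrib, Finset.prod_congr rfl (g := fun _ => 1), Finset.prod_const_one,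
      mul_one]
    intro p hp
    rw [zpow_neg, inv_mul_cancel₀ (zpow_ne_zero _ (hsin p hp))]

lemma continuous_nonvanishing_sign {G : ℝ → ℝ} (hG : Continuous G) (h0 : ∀ t, G t ≠ 0) (s t : ℝ) :
    0 < G s * G t := by
  by_contra! hcon
  have hcon' : G s * G t < 0 := lt_of_le_of_ne hcon (mul_ne_zero (h0 s) (h0 t))
  rcases mul_neg_iff.1 hcon' with h | h
  · obtain ⟨u, hu⟩ := mem_range_of_exists_le_of_exists_ge hG ⟨t, h.2.le⟩ ⟨s, h.1.le⟩
    exact h0 u hu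
  · obtain ⟨u, hu⟩ := mem_range_of_exists_le_of_exists_ge hG ⟨s, h.1.le⟩ ⟨t, h.2.le⟩
    exact h0 u hu

/-- A real elliptic function has an even number of zeros and poles on a period of a line. -/
theorem IsElliptic.even_finsum_horContour {ω₁ τ : ℝ} (hω₁ : 0 < ω₁) {f : ℂ → ℂ}
    (hf : IsElliptic ω₁ τ f) (hne : ∀ z, meromorphicOrderAt f z ≠ ⊤) {h : ℝ}
    (hreal : IsRealOnLine f h) : Even (∑ᶠ z ∈ horContour ω₁ h, ordZ f z) := by
  classical
  obtain ⟨S, G, hS, hGc, hG0, hfac⟩ := hf.exists_line_factorization hω₁ hne hreal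
  have hsum : ∑ᶠ z ∈ horContour ω₁ h, ordZ f z = ∑ p ∈ S, ordZ f (horPoint h p) := by
    rw [← Finset.sum_image (g := horPoint h) (f := fun z => ordZ f z) (s := S)]
    · rw [finsum_mem_eq_sum_of_inter_support_eq]
      ext z
      simp only [Set.mem_inter_iff, Function.mem_support, Finset.coe_image, Set.mem_image,
        Finset.mem_coe]
      constructor
      · rintro ⟨⟨h1, h2⟩, h3⟩
        have h4 : horPoint h z.re = z := by rw [← h2]; exact horPoint_re_im z
        exact ⟨⟨z.re, (hS _).2 ⟨h1, by rwa [h4]⟩, h4⟩, h3⟩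
      · rintro ⟨⟨p, hp, rfl⟩, h3⟩
        exact ⟨⟨by simpa [horPoint_re] using ((hS p).1 hp).1, horPoint_im h p⟩, h3⟩
    · intro p _ q _ hpq
      simpa [horPoint] using hpq
  rw [hsum]
  obtain ⟨t, ht1, ht2⟩ := exists_regular hf.meromorphic hne hω₁ h
  have hl : ((2 * ω₁ : ℝ) : ℂ) ∈ rectLattice ω₁ τ := by
    simpa using horPoint_add_mem (τ := τ) (ω₁ := ω₁) 1
  have hper : (fun w => f (w + ((2 * ω₁ : ℝ) : ℂ))) = f := funext fun w => hf.periodic _ hl w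
  have ht1' : AnalyticAt ℂ f (horPoint h (t + 2 * ω₁)) := by
    rw [horPoint_add]
    have h2 : AnalyticAt ℂ (fun w => f (w - ((2 * ω₁ : ℝ) : ℂ))) (horPoint h t + ((2 * ω₁ : ℝ) : ℂ)) :=
      AnalyticAt.fun_comp (f := fun w => w - ((2 * ω₁ : ℝ) : ℂ)) (by simpa using ht1) (by fun_prop)
    rwa [show (fun w => f (w - ((2 * ω₁ : ℝ) : ℂ))) = f from funext fun w => by
      simpa [sub_eq_add_neg] using hf.periodic _ (neg_mem hl) w] at h2
  have hval : f (horPoint h (t + 2 * ω₁)) = f (horPoint h t) := by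
    rw [horPoint_add, hf.periodic _ hl]
  obtain ⟨hs1, e1⟩ := hfac t ht1 ht2
  obtain ⟨-, e2⟩ := hfac (t + 2 * ω₁) ht1' (by rwa [hval])
  -- Over one period every sine changes sign while `f` returns to its value. An odd total order
  -- would therefore force `G` to change sign, which a continuous nonvanishing function cannot do.
  have hanti : ∀ p, Real.sin (Real.pi * (t + 2 * ω₁ - p) / (2 * ω₁)) =
      -Real.sin (Real.pi * (t - p) / (2 * ω₁)) := by
    intro p
    rw [← Real.sin_add_pi]
    congr 1
    field_simp
    ring
  rw [hval, e1] at e2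
  simp only [hanti] at e2
  have hprod : ∏ p ∈ S, (-Real.sin (Real.pi * (t - p) / (2 * ω₁))) ^ ordZ f (horPoint h p) =
      (-1) ^ (∑ p ∈ S, ordZ f (horPoint h p)) *
        ∏ p ∈ S, Real.sin (Real.pi * (t - p) / (2 * ω₁)) ^ ordZ f (horPoint h p) := by
    have h1 : ∀ s : Finset ℝ, ∏ p ∈ s, (-1 : ℝ) ^ ordZ f (horPoint h p) =
        (-1) ^ (∑ p ∈ s, ordZ f (horPoint h p)) := by
      intro s
      induction s using Finset.induction_on with
      | empty => simp
      | insert i s hi ih => rw [Finset.prod_insert hi, Finset.sum_insert hi, ih,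
          zpow_add₀ (by norm_num)]
    rw [← h1, ← Finset.prod_mul_distrib]
    exact Finset.prod_congr rfl fun p _ => by rw [← mul_zpow, neg_one_mul]
  rw [hprod] at e2
  have hP0 : ∏ p ∈ S, Real.sin (Real.pi * (t - p) / (2 * ω₁)) ^ ordZ f (horPoint h p) ≠ 0 :=
    Finset.prod_ne_zero_iff.2 fun p hp => zpow_ne_zero _ (hs1 p hp)
  by_contra hodd
  rw [Int.not_even_iff_odd] at hodd
  rw [hodd.neg_one_zpow] at e2
  have e3 : (G t + G (t + 2 * ω₁)) *
      ∏ p ∈ S, Real.sin (Real.pi * (t - p) / (2 * ω₁)) ^ ordZ f (horPoint h p) = 0 := by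
    linear_combination e2
  have e4 := (mul_eq_zero.1 e3).resolve_right hP0
  have e5 := continuous_nonvanishing_sign hGc hG0 t (t + 2 * ω₁)
  rw [eq_neg_of_add_eq_zero_right e4] at e5
  nlinarith [mul_self_nonneg (G t)]

/-- A real elliptic function without zeros or poles of odd order on a line has constant sign
there. -/
theorem IsElliptic.exists_sign {ω₁ τ : ℝ} (hω₁ : 0 < ω₁) {f : ℂ → ℂ}
    (hf : IsElliptic ω₁ τ f) (hne : ∀ z, meromorphicOrderAt f z ≠ ⊤) {h : ℝ}
    (hreal : IsRealOnLine f h) (heven : ∀ z ∈ horContour ω₁ h, Even (ordZ f z)) :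
    ∃ ε : ℝ, ∀ t, AnalyticAt ℂ f (horPoint h t) → f (horPoint h t) ≠ 0 →
      0 < ε * (f (horPoint h t)).re := by
  obtain ⟨S, G, hS, hGc, hG0, hfac⟩ := hf.exists_line_factorization hω₁ hne hreal
  refine ⟨G 0, fun t h1 h2 => ?_⟩
  obtain ⟨h3, h4⟩ := hfac t h1 h2
  rw [h4, ← mul_assoc]
  refine mul_pos (continuous_nonvanishing_sign hGc hG0 0 t) (Finset.prod_pos fun p hp => ?_)
  refine (heven _ ⟨?_, horPoint_im h p⟩).zpow_pos (h3 p hp)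
  simpa [horPoint_re] using ((hS p).1 hp).1

/-! ### Functions symmetric under conjugation. -/

/-- `f` is symmetric with respect to complex conjugation, off the poles. -/
def ConjSymm (ω₁ τ : ℝ) (a : ℂ) (f : ℂ → ℂ) : Prop :=
  ∀ z, z ∉ rectLattice ω₁ τ → z - a ∉ rectLattice ω₁ τ →
    f ((starRingEnd ℂ) z) = (starRingEnd ℂ) (f z)

/-- Conjugation fixes the line of height `0` and moves the points of the line of height `τ` by the
period `-2iτ`. -/
lemma conj_horPoint_sub_mem {ω₁ τ h t : ℝ} (hh : h = 0 ∨ h = τ) :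
    (starRingEnd ℂ) (horPoint h t) - horPoint h t ∈ rectLattice ω₁ τ := by
  rw [mem_rectLattice_iff_re_im]
  rcases hh with rfl | rfl
  · exact ⟨0, 0, by simp [horPoint], by simp [horPoint]⟩
  · exact ⟨0, -1, by simp [horPoint], by simp [horPoint]; ring⟩

lemma ConjSymm.isRealOnLine {ω₁ τ : ℝ} (hω₁ : 0 < ω₁) (hτ : 0 < τ) {a : ℂ} {f : ℂ → ℂ}
    (hf : IsElliptic ω₁ τ f) (hs : ConjSymm ω₁ τ a f) {h : ℝ} (hh : h = 0 ∨ h = τ) :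
    IsRealOnLine f h := by
  intro t ht
  have h1 : Tendsto (fun s => (f (horPoint h s)).im) (𝓝[≠] t) (𝓝 (f (horPoint h t)).im) :=
    ((Complex.continuous_im.continuousAt.comp (ht.continuousAt.comp
      (continuous_horPoint h).continuousAt)).tendsto).mono_left nhdsWithin_le_nhds
  refine tendsto_nhds_unique h1 (tendsto_const_nhds.congr' ?_)
  filter_upwards [(tendsto_horPoint h t).eventually (eventually_notMem_polar hω₁ hτ a _)] with s hs'
  have h2 := hs _ hs'.1 hs'.2
  have h3 := hf.periodic _ (conj_horPoint_sub_mem (ω₁ := ω₁) (t := s) hh) (horPoint h s)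
  rw [add_sub_cancel, h2] at h3
  exact (Complex.conj_eq_iff_im.1 h3).symm

/-- Modulo two, a sum of orders counts the points of odd order. -/
lemma exists_finset_odd {f : ℂ → ℂ} {A : Set ℂ} (hfin : (A ∩ Function.support (ordZ f)).Finite) :
    ∃ X : Finset ℂ, (∀ z, z ∈ X ↔ z ∈ A ∧ Odd (ordZ f z)) ∧
      (Even (∑ᶠ z ∈ A, ordZ f z) ↔ Even (X.card : ℤ)) := by
  classical
  refine ⟨hfin.toFinset.filter fun z => Odd (ordZ f z), fun z => ?_, ?_⟩
  · simp only [Finset.mem_filter, Set.Finite.mem_toFinset, Set.mem_inter_iff, Function.mem_support]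
    constructor
    · rintro ⟨⟨h1, -⟩, h2⟩
      exact ⟨h1, h2⟩
    · rintro ⟨h1, h2⟩
      refine ⟨⟨h1, fun h0 => ?_⟩, h2⟩
      rw [h0] at h2
      exact absurd h2 (by decide)
  · rw [finsum_mem_eq_sum_of_inter_support_eq (s := A) (t := hfin.toFinset) _ (by simp)]
    have h1 : Even (∑ z ∈ hfin.toFinset, (ordZ f z - if Odd (ordZ f z) then 1 else 0)) := by
      refine Finset.even_sum _ fun z _ => ?_
      split_ifs with h
      · exact h.sub_odd odd_one
      · simpa using h
    rw [Finset.sum_sub_distrib, Finset.sum_boole] at h1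
    exact Int.even_sub.1 h1

/-! ### Counting zeros on the two contours. -/

namespace IsEllipticPoly

variable {ω₁ τ : ℝ} {a : ℂ} {N : ℕ} {f : ℂ → ℂ}

lemma ordZ_nonneg (hω₁ : 0 < ω₁) (hτ : 0 < τ) (hf : IsEllipticPoly ω₁ τ a N f)
    (hne : ∀ z, meromorphicOrderAt f z ≠ ⊤) (ha : a ∈ fundRect ω₁ τ) {z : ℂ}
    (hz : z ∈ fundRect ω₁ τ) (h0 : z ≠ 0) (hza : z ≠ a) : 0 ≤ ordZ f z := by
  have := hf.order_nonneg (z := z)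
    (fun h => h0 (eq_of_sub_mem_rectLattice hz (zero_mem_fundRect hω₁ hτ) (by simpa using h)))
    (fun h => hza (eq_of_sub_mem_rectLattice hz ha h))
  rw [← coe_ordZ (hne z)] at this
  exact_mod_cast this

lemma ordZ_zero_ge (hf : IsEllipticPoly ω₁ τ a N f)
    (hne : ∀ z, meromorphicOrderAt f z ≠ ⊤) : -(N : ℤ) ≤ ordZ f 0 := by
  have := hf.order_zero
  rw [← coe_ordZ (hne 0)] at this
  exact_mod_cast this

lemma ordZ_anchor_ge (hf : IsEllipticPoly ω₁ τ a N f)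
    (hne : ∀ z, meromorphicOrderAt f z ≠ ⊤) : -1 ≤ ordZ f a := by
  have := hf.order_anchor
  rw [← coe_ordZ (hne a)] at this
  exact_mod_cast this

/-- The three sums are bounded below separately. When the bounds add up to `0`, each of them is
attained. -/
lemma sum_split (hω₁ : 0 < ω₁) (hτ : 0 < τ) (hf : IsEllipticPoly ω₁ τ a N f)
    (hne : ∀ z, meromorphicOrderAt f z ≠ ⊤) :
    ∑ᶠ z ∈ horContour ω₁ 0, ordZ f z + ∑ᶠ z ∈ horContour ω₁ τ, ordZ f z +
      ∑ᶠ z ∈ fundRect ω₁ τ \ (horContour ω₁ 0 ∪ horContour ω₁ τ), ordZ f z = 0 := by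
  have hm := hf.meromorphic
  have h0 := horContour_zero_subset_fundRect (ω₁ := ω₁) hτ
  have h1 := horContour_subset_fundRect (ω₁ := ω₁) hτ
  have hd : Disjoint (horContour ω₁ 0) (horContour ω₁ τ) := by
    rw [Set.disjoint_left]
    rintro z ⟨-, h2⟩ ⟨-, h3⟩
    exact hτ.ne (h2.symm.trans h3)
  rw [← finsum_mem_union' hd (finite_support_ordZ hm hne h0) (finite_support_ordZ hm hne h1),
    ← finsum_mem_union' Set.disjoint_sdiff_right
      (finite_support_ordZ hm hne (Set.union_subset h0 h1))
      (finite_support_ordZ hm hne Set.sdiff_subset),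
    Set.union_sdiff_cancel (Set.union_subset h0 h1)]
  exact hf.isElliptic.finsum_ordZ_fundRect hω₁ hτ hne

lemma rest_nonneg (hω₁ : 0 < ω₁) (hτ : 0 < τ) (hf : IsEllipticPoly ω₁ τ a N f)
    (hne : ∀ z, meromorphicOrderAt f z ≠ ⊤) (ha : a ∈ horContour ω₁ 0 ∪ horContour ω₁ τ)
    (X : Finset ℂ) (hX : ∀ z ∈ X, z ∈ fundRect ω₁ τ \ (horContour ω₁ 0 ∪ horContour ω₁ τ)) :
    ∑ z ∈ X, ordZ f z ≤
      ∑ᶠ z ∈ fundRect ω₁ τ \ (horContour ω₁ 0 ∪ horContour ω₁ τ), ordZ f z := by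
  have haΩ : a ∈ fundRect ω₁ τ := Set.union_subset
    (horContour_zero_subset_fundRect hτ) (horContour_subset_fundRect hτ) ha
  refine sum_le_finsum_mem (finite_support_ordZ hf.meromorphic hne Set.sdiff_subset) X hX ?_
  rintro z ⟨hz1, hz2⟩ -
  refine hf.ordZ_nonneg hω₁ hτ hne haΩ hz1 ?_ ?_
  · rintro rfl
    exact hz2 (Or.inl ⟨by simp [hω₁], rfl⟩)
  · rintro rfl
    exact hz2 ha

/-- The line through the anchor: if the orders off the zero point add up to `0`, then either all
of them vanish, or there is a simple pole at the anchor and one simple zero. -/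
lemma line_alternative {A : Set ℂ} {g : ℂ → ℤ} (hfin : (A ∩ Function.support g).Finite)
    (X : Finset ℂ) (hX : ∀ z ∈ X, z ∈ A) (haA : a ∈ A) (haX : a ∉ X) (ha : -1 ≤ g a)
    (hnn : ∀ z ∈ A, z ∉ X → z ≠ a → 0 ≤ g z)
    (hsum : ∑ᶠ z ∈ A, g z = ∑ z ∈ X, g z) :
    (∀ z ∈ A, z ∉ X → g z = 0) ∨
    (g a = -1 ∧ ∃ w ∈ A, w ∉ X ∧ w ≠ a ∧ g w = 1 ∧ ∀ z ∈ A, z ∉ X → z ≠ a → z ≠ w → g z = 0) := by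
  classical
  -- Points of `A` other than those of `X` and `a` have total order at most `-g a ≤ 1`.
  have hX' : ∀ Y : Finset ℂ, (∀ z ∈ Y, z ∈ A ∧ z ∉ X ∧ z ≠ a) → ∑ z ∈ Y, g z + g a ≤ 0 := by
    intro Y hY
    have h1 := sum_le_finsum_mem hfin (X ∪ insert a Y) (by
      intro z hz
      simp only [Finset.mem_union, Finset.mem_insert] at hz
      rcases hz with h | rfl | h
      exacts [hX z h, haA, (hY z h).1]) (by
      intro z hz hzX
      simp only [Finset.mem_union, Finset.mem_insert, not_or] at hzX
      exact hnn z hz hzX.1 hzX.2.1)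
    rw [hsum, Finset.sum_union, Finset.sum_insert] at h1
    · linarith
    · exact fun h => (hY a h).2.2 rfl
    · rw [Finset.disjoint_left]
      intro z hz hz'
      rcases Finset.mem_insert.1 hz' with rfl | h
      exacts [haX hz, (hY z h).2.1 hz]
  by_cases hga : 0 ≤ g a
  · left
    intro z hz hzX
    by_cases hza : z = a
    · subst hza
      have := hX' ∅ (by simp)
      simp at this
      omega
    · have := hX' {z} (by simpa using ⟨hz, hzX, hza⟩)
      have h2 := hnn z hz hzX hza
      simp at this
      omega
  · right
    have hga' : g a = -1 := by omega
    refine ⟨hga', ?_⟩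
    obtain ⟨w, hw, hwX, hwa, hgw⟩ : ∃ w ∈ A, w ∉ X ∧ w ≠ a ∧ 0 < g w := by
      by_contra! hcon
      have hz : ∀ z ∈ A, z ∉ X → z ≠ a → g z = 0 := fun z h1 h2 h3 =>
        le_antisymm (hcon z h1 h2 h3) (hnn z h1 h2 h3)
      rw [finsum_mem_eq_sum_of_inter_support_eq (s := A) (t := insert a X)] at hsum
      · rw [Finset.sum_insert haX, hga'] at hsum
        omega
      · ext z
        simp only [Set.mem_inter_iff, Function.mem_support, Finset.coe_insert, Set.mem_insert_iff,
          Finset.mem_coe]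
        constructor
        · rintro ⟨h1, h2⟩
          refine ⟨?_, h2⟩
          by_contra! h3
          exact h2 (hz z h1 h3.2 h3.1)
        · rintro ⟨rfl | h1, h2⟩
          exacts [⟨haA, h2⟩, ⟨hX z h1, h2⟩]
    refine ⟨w, hw, hwX, hwa, ?_, ?_⟩
    · have := hX' {w} (by simpa using ⟨hw, hwX, hwa⟩)
      simp at this
      omega
    · intro z hz hzX hza hzw
      have := hX' {z, w} (by
        intro y hy
        rcases Finset.mem_insert.1 hy with rfl | hy
        · exact ⟨hz, hzX, hza⟩
        · rw [Finset.mem_singleton.1 hy]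
          exact ⟨hw, hwX, hwa⟩)
      rw [Finset.sum_pair hzw] at this
      have h2 := hnn z hz hzX hza
      omega

/-- Zeros of a real function on `γ₁` with at least as many zeros as the order of its pole. -/
theorem structure_lower (hω₁ : 0 < ω₁) (hτ : 0 < τ) (hf : IsEllipticPoly ω₁ τ a N f)
    (hne : ∀ z, meromorphicOrderAt f z ≠ ⊤) (hs : ConjSymm ω₁ τ a f) (ha : a ∈ horContour ω₁ τ)
    (X : Finset ℂ) (hX : ∀ z ∈ X, z ∈ horContour ω₁ 0 ∧ z ≠ 0 ∧ 1 ≤ ordZ f z) (hN : N ≤ X.card) :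
    X.card = N ∧ ordZ f 0 = -N ∧ (∀ z ∈ X, ordZ f z = 1) ∧
      (∀ z ∈ horContour ω₁ 0, z ≠ 0 → z ∉ X → ordZ f z = 0) ∧
      ((∀ z ∈ horContour ω₁ τ, ordZ f z = 0) ∨
        (ordZ f a = -1 ∧ ∃ w ∈ horContour ω₁ τ, w ≠ a ∧ ordZ f w = 1 ∧
          ∀ z ∈ horContour ω₁ τ, z ≠ a → z ≠ w → ordZ f z = 0)) ∧
      ∀ z ∈ fundRect ω₁ τ, z ∉ horContour ω₁ 0 ∪ horContour ω₁ τ → ordZ f z = 0 := by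
  classical
  have hm := hf.meromorphic
  have hΓ0 := horContour_zero_subset_fundRect (ω₁ := ω₁) hτ
  have hΓτ := horContour_subset_fundRect (ω₁ := ω₁) hτ
  have haΩ := hΓτ ha
  have ha0 : a ∉ horContour ω₁ 0 := fun h => hτ.ne (h.2.symm.trans ha.2)
  have h00 : (0 : ℂ) ∈ horContour ω₁ 0 := ⟨by simp [hω₁], rfl⟩
  have hz0τ : ∀ z ∈ horContour ω₁ τ, z ≠ 0 := by
    rintro z ⟨-, hz⟩ rfl
    exact hτ.ne hz
  have hsum := hf.sum_split hω₁ hτ hne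
  have hev0 := hf.isElliptic.even_finsum_horContour hω₁ hne
    (hs.isRealOnLine hω₁ hτ hf.isElliptic (Or.inl rfl))
  have hevτ := hf.isElliptic.even_finsum_horContour hω₁ hne
    (hs.isRealOnLine hω₁ hτ hf.isElliptic (Or.inr rfl))
  have hrest := hf.rest_nonneg hω₁ hτ hne (Or.inr ha)
  have hlow : ∀ Y : Finset ℂ, (∀ z ∈ Y, z ∈ horContour ω₁ 0 ∧ z ≠ 0) →
      ordZ f 0 + ∑ z ∈ Y, ordZ f z ≤ ∑ᶠ z ∈ horContour ω₁ 0, ordZ f z := by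
    intro Y hY
    have h := sum_le_finsum_mem (finite_support_ordZ hm hne hΓ0) (insert 0 Y) (by
      intro z hz
      rcases Finset.mem_insert.1 hz with rfl | hz
      exacts [h00, (hY z hz).1]) (by
      intro z hz hzY
      refine hf.ordZ_nonneg hω₁ hτ hne haΩ (hΓ0 hz) (fun h => hzY (by simp [h])) ?_
      rintro rfl
      exact ha0 hz)
    rwa [Finset.sum_insert fun h => (hY 0 h).2 rfl] at h
  have hup : ∀ Y : Finset ℂ, (∀ z ∈ Y, z ∈ horContour ω₁ τ) → a ∉ Y →
      ordZ f a + ∑ z ∈ Y, ordZ f z ≤ ∑ᶠ z ∈ horContour ω₁ τ, ordZ f z := by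
    intro Y hY haY
    have h := sum_le_finsum_mem (finite_support_ordZ hm hne hΓτ) (insert a Y) (by
      intro z hz
      rcases Finset.mem_insert.1 hz with rfl | hz
      exacts [ha, hY z hz]) (by
      intro z hz hzY
      exact hf.ordZ_nonneg hω₁ hτ hne haΩ (hΓτ hz) (hz0τ z hz) (fun h => hzY (by simp [h])))
    rwa [Finset.sum_insert haY] at h
  have hcard : (X.card : ℤ) ≤ ∑ z ∈ X, ordZ f z := by
    have := Finset.card_nsmul_le_sum X (ordZ f) 1 fun z hz => (hX z hz).2.2
    simpa using this
  have hXl := hlow X fun z hz => ⟨(hX z hz).1, (hX z hz).2.1⟩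
  have hN' : (N : ℤ) ≤ X.card := by exact_mod_cast hN
  have h0N := hf.ordZ_zero_ge hne
  have haN := hf.ordZ_anchor_ge hne
  have hup0 := hup ∅ (by simp) (by simp)
  have hrest0 := hrest ∅ (by simp)
  simp only [Finset.sum_empty] at hup0 hrest0
  -- The sum over `γ₂` is at least `-1` and even, hence nonnegative. The sum over `γ₁` is at least
  -- `-N + X.card ≥ 0`, and the rest is nonnegative. As the total is `0`, all three vanish.
  obtain ⟨k, hk⟩ := hevτ
  have e1 : ∑ᶠ z ∈ horContour ω₁ 0, ordZ f z = 0 := by omega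
  have e2 : ∑ᶠ z ∈ horContour ω₁ τ, ordZ f z = 0 := by omega
  have e3 : ∑ᶠ z ∈ fundRect ω₁ τ \ (horContour ω₁ 0 ∪ horContour ω₁ τ), ordZ f z = 0 := by omega
  refine ⟨by omega, by omega, fun z hz => ?_, fun z hz hz0 hzX => ?_, ?_, fun z hz hz' => ?_⟩
  · have h1 : ∑ z ∈ X, (ordZ f z - 1) = 0 := by
      rw [Finset.sum_sub_distrib]
      simp
      omega
    have := (Finset.sum_eq_zero_iff_of_nonneg fun z hz => by have := (hX z hz).2.2; omega).1 h1 z hz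
    omega
  · have h1 := hlow (insert z X) (by
      intro y hy
      rcases Finset.mem_insert.1 hy with rfl | hy
      exacts [⟨hz, hz0⟩, ⟨(hX y hy).1, (hX y hy).2.1⟩])
    rw [Finset.sum_insert hzX] at h1
    have h2 := hf.ordZ_nonneg hω₁ hτ hne haΩ (hΓ0 hz) hz0 (fun h => ha0 (h ▸ hz))
    omega
  · rcases line_alternative (finite_support_ordZ hm hne hΓτ) ∅ (by simp) ha (by simp) haN
      (fun z hz _ hza => hf.ordZ_nonneg hω₁ hτ hne haΩ (hΓτ hz) (hz0τ z hz) hza)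
      (by simpa using e2) with h | h
    · exact Or.inl fun z hz => h z hz (by simp)
    · refine Or.inr (by simpa using h)
  · have h1 := hrest {z} (by simpa using ⟨hz, not_or.1 hz'⟩)
    simp only [Finset.sum_singleton] at h1
    have h2 := hf.ordZ_nonneg hω₁ hτ hne haΩ hz (fun h => hz' (Or.inl (h ▸ h00)))
      (fun h => hz' (Or.inr (h ▸ ha)))
    omega

/-- Zeros of a real function on `γ₂` with sufficiently many zeros there. -/
theorem structure_upper (hω₁ : 0 < ω₁) (hτ : 0 < τ) (hf : IsEllipticPoly ω₁ τ a N f)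
    (hne : ∀ z, meromorphicOrderAt f z ≠ ⊤) (hs : ConjSymm ω₁ τ a f) (ha : a ∈ horContour ω₁ 0)
    (ha0 : a ≠ 0) (X : Finset ℂ) (hX : ∀ z ∈ X, z ∈ horContour ω₁ τ ∧ 1 ≤ ordZ f z)
    (M : ℕ) (hM : Even M) (hNM : N ≤ M) (hMX : M ≤ X.card) :
    X.card = M ∧ (∀ z ∈ X, ordZ f z = 1) ∧ (∀ z ∈ horContour ω₁ τ, z ∉ X → ordZ f z = 0) ∧
      (∀ z ∈ fundRect ω₁ τ, z ∉ horContour ω₁ 0 ∪ horContour ω₁ τ → ordZ f z = 0) ∧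
      ∑ᶠ z ∈ horContour ω₁ 0, ordZ f z = -M := by
  classical
  have hm := hf.meromorphic
  have hΓ0 := horContour_zero_subset_fundRect (ω₁ := ω₁) hτ
  have hΓτ := horContour_subset_fundRect (ω₁ := ω₁) hτ
  have haΩ := hΓ0 ha
  have haτ : a ∉ horContour ω₁ τ := fun h => hτ.ne (ha.2.symm.trans h.2)
  have h00 : (0 : ℂ) ∈ horContour ω₁ 0 := ⟨by simp [hω₁], rfl⟩
  have hz0τ : ∀ z ∈ horContour ω₁ τ, z ≠ 0 := by
    rintro z ⟨-, hz⟩ rfl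
    exact hτ.ne hz
  have hsum := hf.sum_split hω₁ hτ hne
  have hev0 := hf.isElliptic.even_finsum_horContour hω₁ hne
    (hs.isRealOnLine hω₁ hτ hf.isElliptic (Or.inl rfl))
  have hrest := hf.rest_nonneg hω₁ hτ hne (Or.inl ha)
  have hlow : ordZ f 0 + ordZ f a ≤ ∑ᶠ z ∈ horContour ω₁ 0, ordZ f z := by
    have h := sum_le_finsum_mem (finite_support_ordZ hm hne hΓ0) {0, a} (by
      intro z hz
      rcases Finset.mem_insert.1 hz with rfl | hz
      · exact h00
      · rw [Finset.mem_singleton.1 hz]; exact ha) (by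
      intro z hz hzY
      exact hf.ordZ_nonneg hω₁ hτ hne haΩ (hΓ0 hz) (fun h => hzY (by simp [h]))
        (fun h => hzY (by simp [h])))
    rwa [Finset.sum_pair ha0.symm] at h
  have hup : ∀ Y : Finset ℂ, (∀ z ∈ Y, z ∈ horContour ω₁ τ) →
      ∑ z ∈ Y, ordZ f z ≤ ∑ᶠ z ∈ horContour ω₁ τ, ordZ f z := by
    intro Y hY
    refine sum_le_finsum_mem (finite_support_ordZ hm hne hΓτ) Y hY fun z hz _ => ?_
    exact hf.ordZ_nonneg hω₁ hτ hne haΩ (hΓτ hz) (hz0τ z hz) (fun h => haτ (h ▸ hz))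
  have hcard : (X.card : ℤ) ≤ ∑ z ∈ X, ordZ f z := by
    have := Finset.card_nsmul_le_sum X (ordZ f) 1 fun z hz => (hX z hz).2
    simpa using this
  have hXl := hup X fun z hz => (hX z hz).1
  have h1 : (N : ℤ) ≤ M := by exact_mod_cast hNM
  have h2 : (M : ℤ) ≤ X.card := by exact_mod_cast hMX
  have h0N := hf.ordZ_zero_ge hne
  have haN := hf.ordZ_anchor_ge hne
  have hrest0 := hrest ∅ (by simp)
  simp only [Finset.sum_empty] at hrest0
  -- The sum over `γ₁` is at least `-N - 1 ≥ -M - 1`; it and `M` are even, so it is at least `-M`.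
  -- The sum over `γ₂` is at least `X.card ≥ M`, and the rest is nonnegative, so these bounds are
  -- equalities.
  obtain ⟨k, hk⟩ := hev0
  obtain ⟨j, hj⟩ := hM
  have e1 : ∑ᶠ z ∈ horContour ω₁ 0, ordZ f z = -M := by omega
  refine ⟨by omega, fun z hz => ?_, fun z hz hzX => ?_, fun z hz hz' => ?_, e1⟩
  · have h3 : ∑ z ∈ X, (ordZ f z - 1) = 0 := by
      rw [Finset.sum_sub_distrib]
      simp
      omega
    have := (Finset.sum_eq_zero_iff_of_nonneg fun z hz => by have := (hX z hz).2; omega).1 h3 z hz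
    omega
  · have h3 := hup (insert z X) (by
      intro y hy
      rcases Finset.mem_insert.1 hy with rfl | hy
      exacts [hz, (hX y hy).1])
    rw [Finset.sum_insert hzX] at h3
    have h4 := hf.ordZ_nonneg hω₁ hτ hne haΩ (hΓτ hz) (hz0τ z hz) (fun h => haτ (h ▸ hz))
    omega
  · have h3 := hrest {z} (by simpa using ⟨hz, not_or.1 hz'⟩)
    simp only [Finset.sum_singleton] at h3
    have h4 := hf.ordZ_nonneg hω₁ hτ hne haΩ hz (fun h => hz' (Or.inl (h ▸ h00)))
      (fun h => hz' (Or.inl (h ▸ ha)))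
    omega

end IsEllipticPoly

/-! ### Reflection and admissible contours. -/

/-- The reflection `z ↦ conj (f (conj z))` of a function in the real axis. -/
noncomputable def conjReflect (f : ℂ → ℂ) (z : ℂ) : ℂ := (starRingEnd ℂ) (f ((starRingEnd ℂ) z))

lemma tendsto_conj_nhdsNE (z : ℂ) :
    Tendsto (starRingEnd ℂ) (𝓝[≠] z) (𝓝[≠] ((starRingEnd ℂ) z)) :=
  tendsto_nhdsWithin_iff.2 ⟨(Complex.continuous_conj.tendsto z).mono_left nhdsWithin_le_nhds, by
    filter_upwards [self_mem_nhdsWithin] with w hw using fun h => hw ((starRingEnd ℂ).injective h)⟩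

lemma AnalyticAt.conjReflect {f : ℂ → ℂ} {z : ℂ} (hf : AnalyticAt ℂ f ((starRingEnd ℂ) z)) :
    AnalyticAt ℂ (conjReflect f) z := by
  rw [Complex.analyticAt_iff_eventually_differentiableAt] at hf ⊢
  filter_upwards [(Complex.continuous_conj.tendsto z).eventually hf] with w hw
  have := hw.conj_conj
  rw [Complex.conj_conj] at this
  exact this

lemma MeromorphicAt.conjReflect {f : ℂ → ℂ} {z : ℂ} (hf : MeromorphicAt f ((starRingEnd ℂ) z)) :
    MeromorphicAt (conjReflect f) z := by
  obtain ⟨n, hn⟩ := hf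
  refine ⟨n, ?_⟩
  have h1 : (fun w => (w - z) ^ n • _root_.conjReflect f w) =
      _root_.conjReflect (fun w => (w - (starRingEnd ℂ) z) ^ n • f w) := by
    funext w
    simp [_root_.conjReflect]
  rw [h1]
  exact hn.conjReflect

lemma order_conjReflect {f : ℂ → ℂ} {z : ℂ} (hf : MeromorphicAt f ((starRingEnd ℂ) z)) :
    meromorphicOrderAt (conjReflect f) z = meromorphicOrderAt f ((starRingEnd ℂ) z) := by
  cases ho : meromorphicOrderAt f ((starRingEnd ℂ) z) with
  | top =>
    rw [meromorphicOrderAt_eq_top_iff] at ho ⊢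
    filter_upwards [(tendsto_conj_nhdsNE z).eventually ho] with w hw
    simp [conjReflect, hw]
  | coe n =>
    obtain ⟨g, hg, hg0, hfg⟩ := (meromorphicOrderAt_eq_int_iff hf).1 ho
    refine (meromorphicOrderAt_eq_int_iff hf.conjReflect).2
      ⟨conjReflect g, hg.conjReflect, by simpa [conjReflect] using hg0, ?_⟩
    filter_upwards [(tendsto_conj_nhdsNE z).eventually hfg] with w hw
    simp [conjReflect, hw]

lemma IsEllipticPoly.conjReflect {ω₁ τ : ℝ} {a : ℂ} {n : ℕ} {f : ℂ → ℂ}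
    (hf : IsEllipticPoly ω₁ τ a n f) (ha : (starRingEnd ℂ) a - a ∈ rectLattice ω₁ τ) :
    IsEllipticPoly ω₁ τ a n (conjReflect f) where
  meromorphic z := (hf.meromorphic _).conjReflect
  periodic l hl z := by
    simp only [_root_.conjReflect, map_add]
    rw [hf.periodic _ (conj_mem_rectLattice.2 hl)]
  holomorphic z hz hza := by
    refine (hf.holomorphic _ (fun h => hz (conj_mem_rectLattice.1 h)) fun h => hza ?_).conjReflect
    have := add_mem (conj_mem_rectLattice.2 h) ha
    rwa [map_sub, Complex.conj_conj, sub_add_sub_cancel] at this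
  order_zero := by
    rw [order_conjReflect (hf.meromorphic _)]
    simpa using hf.order_zero
  order_anchor := by
    rw [order_conjReflect (hf.meromorphic _), hf.isElliptic.order_congr ha]
    exact hf.order_anchor

/-- The hypotheses on the contour at height `h` and the anchor `a` under which the pairing is a
real inner product: the contour is symmetric, and so is `a`, which does not lie on it. -/
structure IsAnchor (ω₁ τ h : ℝ) (a : ℂ) : Prop where
  pos₁ : 0 < ω₁
  pos₂ : 0 < τ
  notMem : a ∉ rectLattice ω₁ τ
  sub_notMem : ∀ t, horPoint h t - a ∉ rectLattice ω₁ τ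
  conj_sub_mem : (starRingEnd ℂ) a - a ∈ rectLattice ω₁ τ
  line : h = 0 ∨ h = τ

lemma IsAnchor.lower {ω₁ τ : ℝ} (hω₁ : 0 < ω₁) (hτ : 0 < τ) (s : ℝ) :
    IsAnchor ω₁ τ 0 (horPoint τ s) := by
  have key : ∀ z : ℂ, z.im = τ ∨ z.im = -τ → z ∉ rectLattice ω₁ τ := by
    intro z hz h
    obtain ⟨-, n, -, h2⟩ := mem_rectLattice_iff_re_im.1 h
    have h3 : (2 * n - 1 : ℤ) * τ = 0 ∨ (2 * n + 1 : ℤ) * τ = 0 := by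
      rcases hz with hz | hz
      · left; push_cast; linarith
      · right; push_cast; linarith
    rcases h3 with h3 | h3 <;> rcases mul_eq_zero.1 h3 with h3 | h3
    · have : (2 * n - 1 : ℤ) = 0 := by exact_mod_cast h3
      omega
    · exact hτ.ne' h3
    · have : (2 * n + 1 : ℤ) = 0 := by exact_mod_cast h3
      omega
    · exact hτ.ne' h3
  exact ⟨hω₁, hτ, key _ (.inl (horPoint_im _ _)), fun t => key _ (.inr (by simp [horPoint_im])),
    conj_horPoint_sub_mem (.inr rfl), .inl rfl⟩

lemma IsAnchor.upper {ω₁ τ : ℝ} (hω₁ : 0 < ω₁) (hτ : 0 < τ) {s : ℝ}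
    (hs : s ∈ Set.Ioo 0 (2 * ω₁)) : IsAnchor ω₁ τ τ (horPoint 0 s) := by
  refine ⟨hω₁, hτ, fun h => ?_, fun t h => ?_, conj_horPoint_sub_mem (.inl rfl), .inr rfl⟩
  · have h0 : horPoint 0 s ∈ fundRect ω₁ τ :=
      horContour_zero_subset_fundRect hτ ⟨by rw [horPoint_re]; exact ⟨hs.1.le, hs.2⟩, horPoint_im _ _⟩
    have := eq_of_sub_mem_rectLattice h0 (zero_mem_fundRect hω₁ hτ) (by simpa using h)
    have h1 := horPoint_re 0 s
    rw [this] at h1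
    exact hs.1.ne (by simpa using h1)
  · have := (IsAnchor.lower hω₁ hτ t).sub_notMem s
    exact this (by simpa using neg_mem h)

namespace IsAnchor

variable {ω₁ τ h : ℝ} {a : ℂ}

lemma horPoint_notMem (H : IsAnchor ω₁ τ h a) {t : ℝ} (ht : t ∈ Set.Ioo 0 (2 * ω₁)) :
    horPoint h t ∉ rectLattice ω₁ τ := by
  rcases H.line with rfl | rfl
  · exact (upper H.pos₁ H.pos₂ ht).notMem
  · exact (lower H.pos₁ H.pos₂ t).notMem

/-- It turns the pairing of `f` with its reflection into `∫ |f|² W`, so that a bilinear pairing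
serves as an inner product. -/
lemma conjReflect_horPoint (H : IsAnchor ω₁ τ h a) {n : ℕ} {f : ℂ → ℂ}
    (hf : IsEllipticPoly ω₁ τ a n f) (t : ℝ) :
    conjReflect f (horPoint h t) = (starRingEnd ℂ) (f (horPoint h t)) := by
  have := hf.periodic _ (conj_horPoint_sub_mem (ω₁ := ω₁) (t := t) H.line) (horPoint h t)
  rw [add_sub_cancel] at this
  rw [conjReflect, this]

end IsAnchor

/-! ### The pairing and its positivity. -/

lemma contourPairing_comm (ω₁ h : ℝ) (W : ℂ → ℝ) (P Q : ℂ → ℂ) :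
    contourPairing ω₁ h W P Q = contourPairing ω₁ h W Q P := by
  simp only [contourPairing, mul_comm (P _)]

lemma contourPairing_const_mul (ω₁ h : ℝ) (W : ℂ → ℝ) (P Q : ℂ → ℂ) (c : ℂ) :
    contourPairing ω₁ h W P (fun z => c * Q z) = c * contourPairing ω₁ h W P Q := by
  rw [contourPairing, contourPairing, ← intervalIntegral.integral_const_mul]
  congr 1
  funext t
  ring

lemma intervalIntegral_congr_Ioo {E : Type*} [NormedAddCommGroup E] [NormedSpace ℝ E]
    {f g : ℝ → E} {b c : ℝ} (hbc : b ≤ c) (hfg : ∀ t ∈ Set.Ioo b c, f t = g t) :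
    ∫ t in b..c, f t = ∫ t in b..c, g t := by
  rw [intervalIntegral.integral_of_le hbc, intervalIntegral.integral_of_le hbc,
    integral_Ioc_eq_integral_Ioo, integral_Ioc_eq_integral_Ioo]
  exact setIntegral_congr_fun measurableSet_Ioo hfg

section

variable {ω₁ τ h : ℝ} {a : ℂ} {W : ℂ → ℝ} {m n k : ℕ} {P Q R : ℂ → ℂ}

lemma IsAnchor.contourPairing_congr (H : IsAnchor ω₁ τ h a) {P' Q' : ℂ → ℂ}
    (hP : ∀ z, z ∉ rectLattice ω₁ τ → z - a ∉ rectLattice ω₁ τ → P z = P' z)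
    (hQ : ∀ z, z ∉ rectLattice ω₁ τ → z - a ∉ rectLattice ω₁ τ → Q z = Q' z) :
    contourPairing ω₁ h W P Q = contourPairing ω₁ h W P' Q' := by
  refine intervalIntegral_congr_Ioo (by linarith [H.pos₁]) fun t ht => ?_
  rw [hP _ (H.horPoint_notMem ht) (H.sub_notMem t), hQ _ (H.horPoint_notMem ht) (H.sub_notMem t)]

lemma IsPosWeight.intervalIntegrable (hW : IsPosWeight ω₁ τ h a W) (hP : IsEllipticPoly ω₁ τ a m P)
    (hQ : IsEllipticPoly ω₁ τ a n Q) : IntervalIntegrable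
      (fun t : ℝ => P (horPoint h t) * Q (horPoint h t) * (W (horPoint h t) : ℂ))
      volume 0 (2 * ω₁) :=
  hW.integrable (max m n) P Q (hP.mono (le_max_left _ _)) (hQ.mono (le_max_right _ _))

lemma IsPosWeight.contourPairing_add (hW : IsPosWeight ω₁ τ h a W) (hP : IsEllipticPoly ω₁ τ a m P)
    (hQ : IsEllipticPoly ω₁ τ a n Q) (hR : IsEllipticPoly ω₁ τ a k R) :
    contourPairing ω₁ h W P (fun z => Q z + R z) =
      contourPairing ω₁ h W P Q + contourPairing ω₁ h W P R := by
  rw [contourPairing, contourPairing, contourPairing, ← intervalIntegral.integral_add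
    (hW.intervalIntegrable hP hQ) (hW.intervalIntegrable hP hR)]
  congr 1
  funext t
  ring

lemma IsPosWeight.contourPairing_sub (hW : IsPosWeight ω₁ τ h a W) (hP : IsEllipticPoly ω₁ τ a m P)
    (hQ : IsEllipticPoly ω₁ τ a n Q) (hR : IsEllipticPoly ω₁ τ a k R) :
    contourPairing ω₁ h W P (fun z => Q z - R z) =
      contourPairing ω₁ h W P Q - contourPairing ω₁ h W P R := by
  rw [contourPairing, contourPairing, contourPairing, ← intervalIntegral.integral_sub
    (hW.intervalIntegrable hP hQ) (hW.intervalIntegrable hP hR)]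
  congr 1
  funext t
  ring

lemma IsPosWeight.contourPairing_sum (hW : IsPosWeight ω₁ τ h a W) (hP : IsEllipticPoly ω₁ τ a m P)
    {ι : Type*} (s : Finset ι) (c : ι → ℂ) (F : ι → ℂ → ℂ)
    (hF : ∀ i ∈ s, IsEllipticPoly ω₁ τ a n (F i)) :
    contourPairing ω₁ h W P (fun z => ∑ i ∈ s, c i * F i z) =
      ∑ i ∈ s, c i * contourPairing ω₁ h W P (F i) := by
  simp only [contourPairing, ← intervalIntegral.integral_const_mul]
  rw [← intervalIntegral.integral_finsetSum]
  · congr 1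
    funext t
    rw [Finset.mul_sum, Finset.sum_mul]
    exact Finset.sum_congr rfl fun i _ => by ring
  · exact fun i hi => (hW.intervalIntegrable hP (hF i hi)).const_mul _

lemma IsAnchor.contourPairing_conjReflect (H : IsAnchor ω₁ τ h a) (hP : IsEllipticPoly ω₁ τ a m P)
    (hQ : IsEllipticPoly ω₁ τ a n Q) :
    contourPairing ω₁ h W (conjReflect P) Q =
      (starRingEnd ℂ) (contourPairing ω₁ h W P (conjReflect Q)) := by
  have h2 : (0 : ℝ) ≤ 2 * ω₁ := by linarith [H.pos₁]
  rw [contourPairing, contourPairing, intervalIntegral.integral_of_le h2,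
    intervalIntegral.integral_of_le h2, ← integral_conj]
  congr 1
  funext t
  simp [H.conjReflect_horPoint hP, H.conjReflect_horPoint hQ]

lemma integral_pos_of_ae_pos {f : ℝ → ℝ} {b c : ℝ} (hbc : b < c)
    (hf : IntervalIntegrable f volume b c)
    (hpos : ∀ᵐ t ∂(volume.restrict (Set.Ioo b c)), 0 < f t) : 0 < ∫ t in b..c, f t := by
  rw [intervalIntegral.integral_of_le hbc.le, integral_Ioc_eq_integral_Ioo]
  have hi : IntegrableOn f (Set.Ioo b c) :=
    ((intervalIntegrable_iff_integrableOn_Ioc_of_le hbc.le).1 hf).mono_set Set.Ioo_subset_Ioc_self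
  refine lt_of_le_of_ne (integral_nonneg_of_ae (hpos.mono fun t ht => ht.le)) fun h0 => ?_
  have h1 := (integral_eq_zero_iff_of_nonneg_ae (hpos.mono fun t ht => ht.le) hi).1 h0.symm
  have h2 : ∀ᵐ t ∂(volume.restrict (Set.Ioo b c)), False := by
    filter_upwards [hpos, h1] with t h3 h4
    rw [h4] at h3
    exact lt_irrefl _ h3
  rw [eventually_false_iff_eq_bot, ae_eq_bot, Measure.restrict_eq_zero, Real.volume_Ioo,
    ENNReal.ofReal_eq_zero] at h2
  linarith

/-- The factor `ε` carries a sign that is constant but unknown, as happens for the product in the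
argument on sign changes. -/
lemma IsPosWeight.contourPairing_re_pos (_ : 0 < ω₁) (hW : IsPosWeight ω₁ τ h a W)
    (hP : IsEllipticPoly ω₁ τ a m P)
    (hQ : IsEllipticPoly ω₁ τ a n Q) (ε : ℝ) (hpos : ∀ᵐ t ∂(volume.restrict (Set.Ioo 0 (2 * ω₁))),
      0 < ε * (P (horPoint h t) * Q (horPoint h t)).re) :
    0 < ε * (contourPairing ω₁ h W P Q).re := by
  have hi := hW.intervalIntegrable hP hQ
  have h2 : (0 : ℝ) < 2 * ω₁ := by linarith
  have hre : (contourPairing ω₁ h W P Q).re = ∫ t in (0 : ℝ)..(2 * ω₁),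
      (P (horPoint h t) * Q (horPoint h t) * (W (horPoint h t) : ℂ)).re := by
    rw [contourPairing]
    exact (Complex.reCLM.intervalIntegral_comp_comm hi).symm
  rw [hre, ← intervalIntegral.integral_const_mul]
  refine integral_pos_of_ae_pos h2 (IntervalIntegrable.const_mul ?_ _) ?_
  · rw [intervalIntegrable_iff] at hi ⊢
    exact hi.re
  · filter_upwards [hpos, hW.pos] with t h3 h4
    rw [Complex.re_mul_ofReal]
    nlinarith [mul_pos h3 h4]

lemma ae_ne_zero_horPoint (ω₁ : ℝ) {f : ℂ → ℂ} (hf : ∀ z, MeromorphicAt f z)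
    (hne : ∀ z, meromorphicOrderAt f z ≠ ⊤) (h : ℝ) :
    ∀ᵐ t ∂(volume.restrict (Set.Ioo 0 (2 * ω₁))),
      AnalyticAt ℂ f (horPoint h t) ∧ f (horPoint h t) ≠ 0 := by
  have h1 := (finite_line_support hf hne (2 * ω₁) h).countable.ae_notMem volume
  filter_upwards [ae_restrict_of_ae h1, ae_restrict_mem measurableSet_Ioo] with t h2 h3
  by_contra h4
  exact h2 ⟨Set.Ioo_subset_Icc_self h3, h4⟩

lemma IsAnchor.contourPairing_self_conj (H : IsAnchor ω₁ τ h a) (hW : IsPosWeight ω₁ τ h a W)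
    (hP : IsEllipticPoly ω₁ τ a m P) (hne : meromorphicOrderAt P 0 ≠ ⊤) :
    0 < (contourPairing ω₁ h W P (conjReflect P)).re := by
  have := hW.contourPairing_re_pos H.pos₁ hP (hP.conjReflect H.conj_sub_mem) 1 (by
    filter_upwards [ae_ne_zero_horPoint ω₁ hP.meromorphic
      (order_ne_top_of_ne_top hP.meromorphic hne) h] with t ht
    rw [H.conjReflect_horPoint hP, Complex.mul_conj, one_mul, Complex.ofReal_re]
    exact Complex.normSq_pos.2 ht.2)
  simpa using this

lemma IsEllipticPoly.eq_zero_of_order_eq_top (hP : IsEllipticPoly ω₁ τ a m P)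
    (htop : meromorphicOrderAt P 0 = ⊤) (z : ℂ) (hz : z ∉ rectLattice ω₁ τ)
    (hza : z - a ∉ rectLattice ω₁ τ) : P z = 0 := by
  have h1 : meromorphicOrderAt P z = ⊤ := by
    by_contra h2
    exact order_ne_top_of_ne_top hP.meromorphic h2 0 htop
  have h2 := (hP.holomorphic z hz hza)
  have h3 := h2.continuousAt.tendsto.mono_left (nhdsWithin_le_nhds (s := {z}ᶜ))
  exact tendsto_nhds_unique h3
    (tendsto_const_nhds.congr' ((meromorphicOrderAt_eq_top_iff.1 h1).mono fun w hw => hw.symm))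

/-- The reflection of `P` lies in the same space and is an admissible test function. -/
lemma IsAnchor.eq_zero_of_orthogonal (H : IsAnchor ω₁ τ h a) (hW : IsPosWeight ω₁ τ h a W)
    (hP : IsEllipticPoly ω₁ τ a m P)
    (horth : ∀ Q, IsEllipticPoly ω₁ τ a m Q → contourPairing ω₁ h W P Q = 0)
    (z : ℂ) (hz : z ∉ rectLattice ω₁ τ) (hza : z - a ∉ rectLattice ω₁ τ) : P z = 0 := by
  refine hP.eq_zero_of_order_eq_top ?_ z hz hza
  by_contra hne
  have := H.contourPairing_self_conj hW hP hne
  rw [horth _ (hP.conjReflect H.conj_sub_mem)] at this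
  simp at this

end

/-! ### Orthogonal functions: uniqueness, reality and existence. -/

/-- `f` lies in `𝓛(n·0 + a)` and is orthogonal to all the spaces `𝓛(m·0 + a)` with `m < n`. -/
structure IsOrthogonalEOP (ω₁ τ h : ℝ) (W : ℂ → ℝ) (a : ℂ) (n : ℕ) (f : ℂ → ℂ) : Prop where
  mem : IsEllipticPoly ω₁ τ a n f
  orthogonal : ∀ m < n, ∀ Q : ℂ → ℂ, IsEllipticPoly ω₁ τ a m Q → contourPairing ω₁ h W f Q = 0

lemma IsOrthonormalEOP.isOrthogonalEOP {ω₁ τ h : ℝ} {W : ℂ → ℝ} {a : ℂ} {n : ℕ} {f : ℂ → ℂ}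
    (hf : IsOrthonormalEOP ω₁ τ h W a n f) : IsOrthogonalEOP ω₁ τ h W a n f :=
  ⟨hf.mem, hf.orthogonal⟩

section

variable {ω₁ τ h : ℝ} {a : ℂ} {W : ℂ → ℝ} {m n : ℕ} {f g : ℂ → ℂ}

lemma meromorphicOrderAt_pow_zero (n : ℕ) :
    meromorphicOrderAt (fun z : ℂ => z ^ n) 0 = (n : WithTop ℤ) := by
  simpa using fun_meromorphicOrderAt_pow_id_sub_const (𝕜 := ℂ) (x := 0) (n := n)

lemma order_pow_mul (hf : MeromorphicAt f 0) (n : ℕ) :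
    meromorphicOrderAt (fun z : ℂ => z ^ n * f z) 0 = n + meromorphicOrderAt f 0 := by
  have hp : MeromorphicAt (fun z : ℂ => z ^ n) 0 := by fun_prop
  have := meromorphicOrderAt_mul hp hf
  rw [meromorphicOrderAt_pow_zero] at this
  exact this

namespace IsEllipticPoly

/-- The leading coefficient exists. -/
lemma exists_leading (hf : IsEllipticPoly ω₁ τ a n f) :
    ∃ c, Tendsto (fun z : ℂ => z ^ n * f z) (𝓝[≠] 0) (𝓝 c) := by
  have hp : MeromorphicAt (fun z : ℂ => z ^ n) 0 := by fun_prop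
  refine tendsto_nhds_of_meromorphicOrderAt_nonneg (hp.mul (hf.meromorphic 0)) ?_
  have h1 := order_pow_mul (hf.meromorphic 0) n
  change meromorphicOrderAt (fun z : ℂ => z ^ n * f z) 0 ≥ 0
  rw [h1]
  calc (0 : WithTop ℤ) = n + ((-(n : ℤ) : ℤ) : WithTop ℤ) := by
        have : ((0 : ℤ) : WithTop ℤ) = (((n : ℤ) + -(n : ℤ) : ℤ) : WithTop ℤ) := by simp
        exact_mod_cast this
    _ ≤ _ := by gcongr; exact hf.order_zero

lemma order_zero_of_leading (hf : IsEllipticPoly ω₁ τ a n f) {c : ℂ} (hc : c ≠ 0)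
    (h : Tendsto (fun z : ℂ => z ^ n * f z) (𝓝[≠] 0) (𝓝 c)) :
    meromorphicOrderAt f 0 = ((-(n : ℤ) : ℤ) : WithTop ℤ) := by
  have hp : MeromorphicAt (fun z : ℂ => z ^ n) 0 := by fun_prop
  have h1 := (tendsto_ne_zero_iff_meromorphicOrderAt_eq_zero (hp.mul (hf.meromorphic 0))).1
    ⟨c, hc, h⟩
  have h2 := order_pow_mul (hf.meromorphic 0) n
  have h3 := h2.symm.trans h1
  cases ho : meromorphicOrderAt f 0 with
  | top => rw [ho] at h3; exact absurd h3 (by simp)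
  | coe k =>
    rw [ho] at h3
    have h4 : (n : ℤ) + k = 0 := by exact_mod_cast h3
    congr 1
    omega

end IsEllipticPoly

lemma tendsto_leading_conjReflect {c : ℂ}
    (h : Tendsto (fun z : ℂ => z ^ n * f z) (𝓝[≠] 0) (𝓝 c)) :
    Tendsto (fun z : ℂ => z ^ n * conjReflect f z) (𝓝[≠] 0) (𝓝 ((starRingEnd ℂ) c)) := by
  have h1 := tendsto_conj_nhdsNE 0
  rw [map_zero] at h1
  have h2 := (Complex.continuous_conj.tendsto c).comp (h.comp h1)
  refine h2.congr fun z => ?_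
  simp [conjReflect]

/-- An orthogonal function whose leading coefficient vanishes is zero. -/
lemma IsOrthogonalEOP.eq_zero (H : IsAnchor ω₁ τ h a) (hW : IsPosWeight ω₁ τ h a W)
    (hf : IsOrthogonalEOP ω₁ τ h W a n f)
    (h0 : Tendsto (fun z : ℂ => z ^ n * f z) (𝓝[≠] 0) (𝓝 0))
    (z : ℂ) (hz : z ∉ rectLattice ω₁ τ) (hza : z - a ∉ rectLattice ω₁ τ) : f z = 0 := by
  match n with
  | 0 =>
    -- For `n = 0` there is no smaller space to descend to; the function is constant and equals its
    -- leading coefficient.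
    obtain ⟨c, hc⟩ := hf.mem.exists_const_of_zero H.pos₁ H.pos₂
    have h1 : Tendsto (fun z : ℂ => z ^ 0 * f z) (𝓝[≠] 0) (𝓝 c) := by
      refine tendsto_const_nhds.congr' ?_
      filter_upwards [eventually_notMem_polar H.pos₁ H.pos₂ a 0] with w hw
      rw [hc w hw.1 hw.2, pow_zero, one_mul]
    rw [hc z hz hza, tendsto_nhds_unique h1 h0]
  | n + 1 =>
    exact H.eq_zero_of_orthogonal hW (hf.mem.pred_of_tendsto_zero h0)
      (hf.orthogonal n (Nat.lt_succ_self n)) z hz hza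

namespace IsOrthogonalEOP

lemma sub_const_mul (hW : IsPosWeight ω₁ τ h a W) (hf : IsOrthogonalEOP ω₁ τ h W a n f)
    (hg : IsOrthogonalEOP ω₁ τ h W a n g) (c : ℂ) :
    IsOrthogonalEOP ω₁ τ h W a n (fun z => f z - c * g z) := by
  refine ⟨hf.mem.sub (hg.mem.const_mul c), fun m hm Q hQ => ?_⟩
  rw [contourPairing_comm, hW.contourPairing_sub hQ hf.mem (hg.mem.const_mul c),
    contourPairing_const_mul, contourPairing_comm, hf.orthogonal m hm Q hQ, contourPairing_comm,
    hg.orthogonal m hm Q hQ]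
  simp

lemma const_mul (hf : IsOrthogonalEOP ω₁ τ h W a n f) (c : ℂ) :
    IsOrthogonalEOP ω₁ τ h W a n (fun z => c * f z) := by
  refine ⟨hf.mem.const_mul c, fun m hm Q hQ => ?_⟩
  rw [contourPairing_comm, contourPairing_const_mul, contourPairing_comm, hf.orthogonal m hm Q hQ,
    mul_zero]

/-- Orthogonal functions are unique up to a constant factor. -/
lemma eq_const_mul (H : IsAnchor ω₁ τ h a) (hW : IsPosWeight ω₁ τ h a W)
    (hf : IsOrthogonalEOP ω₁ τ h W a n f) (hg : IsOrthogonalEOP ω₁ τ h W a n g) {c d : ℂ}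
    (hd : d ≠ 0)
    (hfc : Tendsto (fun z : ℂ => z ^ n * f z) (𝓝[≠] 0) (𝓝 c))
    (hgd : Tendsto (fun z : ℂ => z ^ n * g z) (𝓝[≠] 0) (𝓝 d))
    (z : ℂ) (hz : z ∉ rectLattice ω₁ τ) (hza : z - a ∉ rectLattice ω₁ τ) : f z = c / d * g z := by
  refine sub_eq_zero.1 ((hf.sub_const_mul hW hg (c / d)).eq_zero H hW ?_ z hz hza)
  have := hfc.sub (hgd.const_mul (c / d))
  rw [div_mul_cancel₀ _ hd, sub_self] at this
  exact this.congr fun z => by ring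

/-- The reflection is orthogonal to the same spaces and has the same leading coefficient, because
that coefficient is real. Uniqueness identifies the two. -/
lemma conjSymm (H : IsAnchor ω₁ τ h a) (hW : IsPosWeight ω₁ τ h a W)
    (hf : IsOrthogonalEOP ω₁ τ h W a n f) {c : ℝ}
    (hfc : Tendsto (fun z : ℂ => z ^ n * f z) (𝓝[≠] 0) (𝓝 (c : ℂ))) : ConjSymm ω₁ τ a f := by
  have hr : IsOrthogonalEOP ω₁ τ h W a n (conjReflect f) := by
    refine ⟨hf.mem.conjReflect H.conj_sub_mem, fun m hm Q hQ => ?_⟩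
    rw [H.contourPairing_conjReflect hf.mem hQ,
      hf.orthogonal m hm _ (hQ.conjReflect H.conj_sub_mem), map_zero]
  have h1 := tendsto_leading_conjReflect hfc
  rw [Complex.conj_ofReal] at h1
  intro z hz hza
  have h2 := (hf.sub_const_mul hW hr 1).eq_zero H hW (by
    have := hfc.sub (h1.const_mul 1)
    rw [one_mul, sub_self] at this
    exact this.congr fun z => by ring) z hz hza
  rw [one_mul, sub_eq_zero] at h2
  rw [h2, conjReflect, Complex.conj_conj]

end IsOrthogonalEOP

/-- The Gram matrix of the basis of `𝓛(n·0 + a)`. -/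
noncomputable def gramMatrix (L : PeriodPair) (ω₁ h : ℝ) (W : ℂ → ℝ) (a : ℂ) (n : ℕ) :
    Matrix (Fin (n + 1)) (Fin (n + 1)) ℂ :=
  Matrix.of fun j k => contourPairing ω₁ h W (ellBasis L a j) (ellBasis L a k)

/-- The orthogonal function obtained from the Gram matrix by Cramer's rule. -/
noncomputable def gramEOP (L : PeriodPair) (ω₁ h : ℝ) (W : ℂ → ℝ) (a : ℂ) (n : ℕ) : ℂ → ℂ :=
  ellSum L a n ((gramMatrix L ω₁ h W a n).cramer (Pi.single (Fin.last n) 1))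

lemma IsAnchor.pairing_basis_sum (H : IsAnchor ω₁ τ h a) (hW : IsPosWeight ω₁ τ h a W)
    (c : Fin (n + 1) → ℂ) (j : Fin (n + 1)) :
    contourPairing ω₁ h W (ellBasis (rectPeriodPair H.pos₁ H.pos₂) a j)
      (ellSum (rectPeriodPair H.pos₁ H.pos₂) a n c) =
    (gramMatrix (rectPeriodPair H.pos₁ H.pos₂) ω₁ h W a n).mulVec c j := by
  have := hW.contourPairing_sum (ellBasis_mem H.pos₁ H.pos₂ H.notMem j) Finset.univ c
    (fun k : Fin (n + 1) => ellBasis (rectPeriodPair H.pos₁ H.pos₂) a k)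
    (fun k _ => (ellBasis_mem H.pos₁ H.pos₂ H.notMem k).mono (Fin.is_le k))
  refine Eq.trans this ?_
  rw [Matrix.mulVec, dotProduct]
  exact Finset.sum_congr rfl fun k _ => mul_comm _ _

lemma IsAnchor.pairing_eq_sum (H : IsAnchor ω₁ τ h a) (hW : IsPosWeight ω₁ τ h a W) {Q : ℂ → ℂ}
    (hQ : IsEllipticPoly ω₁ τ a m Q) : ∃ d : Fin (m + 1) → ℂ, ∀ {k : ℕ} {P : ℂ → ℂ},
      IsEllipticPoly ω₁ τ a k P → contourPairing ω₁ h W P Q = ∑ j, d j *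
        contourPairing ω₁ h W (ellBasis (rectPeriodPair H.pos₁ H.pos₂) a j) P := by
  obtain ⟨d, hd⟩ := hQ.exists_eq_ellSum H.pos₁ H.pos₂ H.notMem
  refine ⟨d, fun hP => ?_⟩
  rw [H.contourPairing_congr (fun _ _ _ => rfl) hd]
  refine (hW.contourPairing_sum hP Finset.univ d
    (fun k : Fin (m + 1) => ellBasis (rectPeriodPair H.pos₁ H.pos₂) a k)
    (fun k _ => (ellBasis_mem H.pos₁ H.pos₂ H.notMem k).mono (Fin.is_le k))).trans ?_
  exact Finset.sum_congr rfl fun j _ => by rw [contourPairing_comm]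

/-- The matrix belongs to a bilinear form and not to a Hermitian one. A kernel vector yields a
function orthogonal to the whole space, in particular to its own reflection. -/
lemma IsAnchor.det_gramMatrix_ne_zero (H : IsAnchor ω₁ τ h a) (hW : IsPosWeight ω₁ τ h a W) :
    (gramMatrix (rectPeriodPair H.pos₁ H.pos₂) ω₁ h W a n).det ≠ 0 := by
  intro hdet
  obtain ⟨v, hv, hGv⟩ := Matrix.exists_mulVec_eq_zero_iff.2 hdet
  have hp := ellSum_mem H.pos₁ H.pos₂ H.notMem n v
  have h1 := H.contourPairing_self_conj hW hp (order_ellSum_ne_top H.pos₁ H.pos₂ H.notMem hv)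
  obtain ⟨d, hd⟩ := H.pairing_eq_sum hW (hp.conjReflect H.conj_sub_mem)
  rw [hd hp] at h1
  simp [H.pairing_basis_sum hW, hGv] at h1

/-- Cramer's vector `c` satisfies `G c = det G • e_last`, which encodes orthogonality to all earlier
basis functions. Without division by the determinant, `c` is polynomial in the Gram entries. -/
lemma IsAnchor.pairing_basis_gramEOP (H : IsAnchor ω₁ τ h a) (hW : IsPosWeight ω₁ τ h a W)
    (j : Fin (n + 1)) :
    contourPairing ω₁ h W (ellBasis (rectPeriodPair H.pos₁ H.pos₂) a j)
      (gramEOP (rectPeriodPair H.pos₁ H.pos₂) ω₁ h W a n) =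
    (gramMatrix (rectPeriodPair H.pos₁ H.pos₂) ω₁ h W a n).det *
      (Pi.single (Fin.last n) 1 : Fin (n + 1) → ℂ) j := by
  rw [gramEOP, H.pairing_basis_sum hW, Matrix.mulVec_cramer, Pi.smul_apply, smul_eq_mul]

lemma IsAnchor.isOrthogonalEOP_gramEOP (H : IsAnchor ω₁ τ h a) (hW : IsPosWeight ω₁ τ h a W) :
    IsOrthogonalEOP ω₁ τ h W a n (gramEOP (rectPeriodPair H.pos₁ H.pos₂) ω₁ h W a n) := by
  have hmem : IsEllipticPoly ω₁ τ a n (gramEOP (rectPeriodPair H.pos₁ H.pos₂) ω₁ h W a n) :=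
    ellSum_mem H.pos₁ H.pos₂ H.notMem n _
  refine ⟨hmem, fun m hm Q hQ => ?_⟩
  obtain ⟨d, hd⟩ := H.pairing_eq_sum hW hQ
  rw [hd hmem]
  refine Finset.sum_eq_zero fun j _ => ?_
  have := H.pairing_basis_gramEOP hW (n := n) ⟨j, by omega⟩
  rw [this, Pi.single_eq_of_ne (fun h => by
    have := congrArg Fin.val h
    simp only [Fin.val_last] at this
    omega)]
  simp

/-- With zero leading coefficient the function would vanish, whereas its pairing with the last basis
function is the nonzero determinant. -/
lemma IsAnchor.exists_leading_gramEOP (H : IsAnchor ω₁ τ h a) (hW : IsPosWeight ω₁ τ h a W) :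
    ∃ d : ℂ, d ≠ 0 ∧ Tendsto
      (fun z : ℂ => z ^ n * gramEOP (rectPeriodPair H.pos₁ H.pos₂) ω₁ h W a n z) (𝓝[≠] 0) (𝓝 d) := by
  have ho := H.isOrthogonalEOP_gramEOP hW (n := n)
  obtain ⟨d, hd⟩ := ho.mem.exists_leading
  refine ⟨d, ?_, hd⟩
  rintro rfl
  have h1 := H.pairing_basis_gramEOP hW (Fin.last n)
  rw [H.contourPairing_congr (fun _ _ _ => rfl) (ho.eq_zero H hW hd), Pi.single_eq_same, mul_one]
    at h1
  refine H.det_gramMatrix_ne_zero hW (h1.symm.trans ?_)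
  simp [contourPairing]

/-- Dividing by the leading coefficient makes it `1`, hence real, so the function equals its
reflection off the poles. Its pairing with itself is then positive, and a positive factor normalizes
it. -/
theorem IsAnchor.exists_isOrthonormalEOP (H : IsAnchor ω₁ τ h a) (hW : IsPosWeight ω₁ τ h a W)
    (n : ℕ) : ∃ g, IsOrthonormalEOP ω₁ τ h W a n g := by
  obtain ⟨d, hd0, hd⟩ := H.exists_leading_gramEOP hW (n := n)
  have ho := (H.isOrthogonalEOP_gramEOP hW (n := n)).const_mul d⁻¹
  set g := fun z => d⁻¹ * gramEOP (rectPeriodPair H.pos₁ H.pos₂) ω₁ h W a n z with hg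
  have h1 : Tendsto (fun z : ℂ => z ^ n * g z) (𝓝[≠] 0) (𝓝 ((1 : ℝ) : ℂ)) := by
    have := hd.const_mul d⁻¹
    rw [inv_mul_cancel₀ hd0] at this
    rw [Complex.ofReal_one]
    exact this.congr fun z => by rw [hg]; ring
  have hs := ho.conjSymm H hW h1
  have hne : meromorphicOrderAt g 0 ≠ ⊤ := by
    rw [ho.mem.order_zero_of_leading (by simp) h1]
    exact WithTop.coe_ne_top
  have hpos := H.contourPairing_self_conj hW ho.mem hne
  have hrefl : ∀ z, z ∉ rectLattice ω₁ τ → z - a ∉ rectLattice ω₁ τ → conjReflect g z = g z := by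
    intro z hz hza
    rw [conjReflect, hs z hz hza, Complex.conj_conj]
  have heq := H.contourPairing_congr (W := W) (P := g) (fun _ _ _ => rfl) hrefl
  have hreal : (contourPairing ω₁ h W g g).im = 0 := by
    rw [← Complex.conj_eq_iff_im]
    have h2 := H.contourPairing_conjReflect (W := W) ho.mem ho.mem
    rw [heq, H.contourPairing_congr hrefl (fun _ _ _ => rfl)] at h2
    exact h2.symm
  rw [heq] at hpos
  set N := (contourPairing ω₁ h W g g).re with hN
  have hNN : contourPairing ω₁ h W g g = (N : ℂ) := Complex.ext rfl (by simpa using hreal)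
  have hsq := Real.sqrt_pos.2 hpos
  have hm := ho.const_mul ((Real.sqrt N)⁻¹ : ℝ)
  refine ⟨_, hm.mem, hm.orthogonal, ?_, (Real.sqrt N)⁻¹, inv_pos.2 hsq, ?_⟩
  · rw [contourPairing_const_mul, contourPairing_comm, contourPairing_const_mul, hNN]
    norm_cast
    have := Real.mul_self_sqrt hpos.le
    field_simp
    rw [sq, this]
  · have := h1.const_mul (((Real.sqrt N)⁻¹ : ℝ) : ℂ)
    rw [Complex.ofReal_one, mul_one] at this
    exact this.congr fun z => by ring

end

/-! ### Sign changes of orthogonal functions. -/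

/-- The two admissible configurations of contour and anchor: one of them on the real axis, the other
one at height `τ`. -/
def OppositeAnchor (ω₁ τ h : ℝ) (a : ℂ) : Prop :=
  (h = 0 ∧ a ∈ horContour ω₁ τ) ∨ (h = τ ∧ a ∈ horContour ω₁ 0 ∧ a ≠ 0)

section

variable {ω₁ τ h : ℝ} {a : ℂ} {W : ℂ → ℝ} {m n : ℕ} {f g : ℂ → ℂ}

lemma eq_horPoint_of_mem {z : ℂ} (hz : z ∈ horContour ω₁ h) : horPoint h z.re = z := by
  rw [← hz.2, horPoint_re_im]

lemma OppositeAnchor.isAnchor (hω₁ : 0 < ω₁) (hτ : 0 < τ) (hO : OppositeAnchor ω₁ τ h a) :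
    IsAnchor ω₁ τ h a := by
  rcases hO with ⟨rfl, ha⟩ | ⟨rfl, ha, ha0⟩
  · rw [← eq_horPoint_of_mem ha]
    exact IsAnchor.lower hω₁ hτ _
  · rw [← eq_horPoint_of_mem ha]
    refine IsAnchor.upper hω₁ hτ ⟨lt_of_le_of_ne ha.1.1 fun h => ha0 ?_, ha.1.2⟩
    exact Complex.ext h.symm ha.2

lemma ConjSymm.add (hf : ConjSymm ω₁ τ a f) (hg : ConjSymm ω₁ τ a g) :
    ConjSymm ω₁ τ a (fun z => f z + g z) := fun z hz hza => by
  beta_reduce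
  rw [hf z hz hza, hg z hz hza, map_add]

lemma ConjSymm.mul (hf : ConjSymm ω₁ τ a f) (hg : ConjSymm ω₁ τ a g) :
    ConjSymm ω₁ τ a (fun z => f z * g z) := fun z hz hza => by
  beta_reduce
  rw [hf z hz hza, hg z hz hza, map_mul]

lemma ConjSymm.const_mul (hf : ConjSymm ω₁ τ a f) (c : ℝ) :
    ConjSymm ω₁ τ a (fun z => c * f z) := fun z hz hza => by
  beta_reduce
  rw [hf z hz hza, map_mul, Complex.conj_ofReal]

lemma IsElliptic.mul (hf : IsElliptic ω₁ τ f) (hg : IsElliptic ω₁ τ g) :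
    IsElliptic ω₁ τ (fun z => f z * g z) :=
  ⟨fun z => (hf.meromorphic z).mul (hg.meromorphic z),
    fun l hl z => by rw [hf.periodic l hl, hg.periodic l hl]⟩

lemma order_mul_ne_top (hf : ∀ z, MeromorphicAt f z) (hg : ∀ z, MeromorphicAt g z)
    (hfn : ∀ z, meromorphicOrderAt f z ≠ ⊤) (hgn : ∀ z, meromorphicOrderAt g z ≠ ⊤) (z : ℂ) :
    meromorphicOrderAt (fun z => f z * g z) z ≠ ⊤ := by
  have := meromorphicOrderAt_mul (hf z) (hg z)
  change meromorphicOrderAt (f * g) z ≠ ⊤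
  rw [this]
  exact WithTop.add_ne_top.2 ⟨hfn z, hgn z⟩

lemma ordZ_mul (hf : ∀ z, MeromorphicAt f z) (hg : ∀ z, MeromorphicAt g z)
    (hfn : ∀ z, meromorphicOrderAt f z ≠ ⊤) (hgn : ∀ z, meromorphicOrderAt g z ≠ ⊤) (z : ℂ) :
    ordZ (fun z => f z * g z) z = ordZ f z + ordZ g z := by
  rw [← WithTop.coe_inj, coe_ordZ (order_mul_ne_top hf hg hfn hgn z), WithTop.coe_add,
    coe_ordZ (hfn z), coe_ordZ (hgn z)]
  exact meromorphicOrderAt_mul (hf z) (hg z)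

lemma order_add_eq_top {z : ℂ} (hf : meromorphicOrderAt f z = ⊤) (hg : meromorphicOrderAt g z = ⊤)
    (c d : ℂ) : meromorphicOrderAt (fun z => c * f z + d * g z) z = ⊤ := by
  rw [meromorphicOrderAt_eq_top_iff] at *
  filter_upwards [hf, hg] with w h1 h2
  rw [h1, h2]
  simp

lemma mem_horContour_notMem_polar (H : IsAnchor ω₁ τ h a) {x : ℂ} (hx : x ∈ horContour ω₁ h)
    (hx0 : x ≠ 0) : x ∉ rectLattice ω₁ τ ∧ x - a ∉ rectLattice ω₁ τ := by
  constructor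
  · intro hl
    have hxf : x ∈ fundRect ω₁ τ := by
      rcases H.line with rfl | rfl
      · exact horContour_zero_subset_fundRect H.pos₂ hx
      · exact horContour_subset_fundRect H.pos₂ hx
    exact hx0 (eq_of_sub_mem_rectLattice hxf (zero_mem_fundRect H.pos₁ H.pos₂) (by simpa using hl))
  · rw [← eq_horPoint_of_mem hx]
    exact H.sub_notMem _

/-- With `Q*` the reflection of `Q`, both `Q + Q*` and `i (Q - Q*)` are symmetric and keep the zeros
on the contour. They do not both vanish identically. -/
lemma IsAnchor.exists_conjSymm_vanishing (H : IsAnchor ω₁ τ h a) (X : Finset ℂ)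
    (hX : ∀ x ∈ X, x ∈ horContour ω₁ h) :
    ∃ Q, IsEllipticPoly ω₁ τ a X.card Q ∧ (∀ z, meromorphicOrderAt Q z ≠ ⊤) ∧
      ConjSymm ω₁ τ a Q ∧ ∀ x ∈ X, Q x = 0 := by
  obtain ⟨Q, hQ, hne, hQX⟩ := exists_isEllipticPoly_vanishing H.pos₁ H.pos₂ H.notMem X
  have hR := hQ.conjReflect H.conj_sub_mem
  have hRX : ∀ x ∈ X, conjReflect Q x = 0 := by
    intro x hx
    have := H.conjReflect_horPoint hQ x.re
    rwa [eq_horPoint_of_mem (hX x hx), hQX x hx, map_zero] at this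
  have hss : ∀ z, conjReflect Q ((starRingEnd ℂ) z) = (starRingEnd ℂ) (Q z) := fun z => by
    simp [conjReflect]
  have hss' : ∀ z, Q ((starRingEnd ℂ) z) = (starRingEnd ℂ) (conjReflect Q z) := fun z => by
    simp [conjReflect]
  by_cases h1 : meromorphicOrderAt (fun z => Q z + conjReflect Q z) 0 = ⊤
  · refine ⟨fun z => Complex.I * (Q z - conjReflect Q z), (hQ.sub hR).const_mul _,
      order_ne_top_of_ne_top ((hQ.sub hR).const_mul _).meromorphic (z := 0) fun h2 => hne ?_,
      fun z _ _ => ?_, fun x hx => ?_⟩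
    -- The coefficients come from `Q = (Q + Q*) / 2 - (i / 2) · i (Q - Q*)`.
    · rw [← order_add_eq_top h1 h2 (1 / 2) (-Complex.I / 2)]
      congr 1
      funext z
      linear_combination (1 / 2 * (Q z - conjReflect Q z)) * Complex.I_sq
    · beta_reduce
      rw [hss, hss']
      simp only [map_mul, map_sub, Complex.conj_I]
      ring
    · beta_reduce
      rw [hQX x hx, hRX x hx]
      simp
  · refine ⟨_, hQ.add hR, order_ne_top_of_ne_top (hQ.add hR).meromorphic h1, fun z _ _ => ?_,
      fun x hx => ?_⟩
    · beta_reduce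
      rw [hss, hss', map_add, add_comm]
    · simp [hQX x hx, hRX x hx]

lemma IsEllipticPoly.one_le_ordZ (hf : IsEllipticPoly ω₁ τ a n f)
    (hne : ∀ z, meromorphicOrderAt f z ≠ ⊤) {x : ℂ} (hx : x ∉ rectLattice ω₁ τ)
    (hxa : x - a ∉ rectLattice ω₁ τ) (h0 : f x = 0) : 1 ≤ ordZ f x := by
  have han := hf.holomorphic x hx hxa
  have h1 : 0 < meromorphicOrderAt f x := by
    rw [← tendsto_zero_iff_meromorphicOrderAt_pos (hf.meromorphic x), ← h0]
    exact han.continuousAt.tendsto.mono_left nhdsWithin_le_nhds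
  rw [← coe_ordZ (hne x)] at h1
  have : (0 : ℤ) < ordZ f x := by exact_mod_cast h1
  omega

/-- A function orthogonal to the spaces `𝓛(m·0 + a)` with `m < n` changes sign at least `n` times
on the contour. -/
theorem OppositeAnchor.le_card_odd (hω₁ : 0 < ω₁) (hτ : 0 < τ) (hO : OppositeAnchor ω₁ τ h a)
    (hW : IsPosWeight ω₁ τ h a W) {N : ℕ} (hf : IsEllipticPoly ω₁ τ a N f)
    (hne : ∀ z, meromorphicOrderAt f z ≠ ⊤) (hs : ConjSymm ω₁ τ a f)
    (horth : ∀ m < n, ∀ Q, IsEllipticPoly ω₁ τ a m Q → contourPairing ω₁ h W f Q = 0)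
    (X : Finset ℂ) (hX : ∀ z, z ∈ X ↔ z ∈ horContour ω₁ h ∧ z ≠ 0 ∧ Odd (ordZ f z)) :
    n ≤ X.card := by
  by_contra hlt
  rw [not_le] at hlt
  have H := hO.isAnchor hω₁ hτ
  obtain ⟨Q, hQ, hQne, hQs, hQX⟩ := H.exists_conjSymm_vanishing X fun x hx => ((hX x).1 hx).1
  have hQ1 : ∀ x ∈ X, 1 ≤ ordZ Q x := fun x hx => by
    have h1 := mem_horContour_notMem_polar H ((hX x).1 hx).1 ((hX x).1 hx).2.1
    exact hQ.one_le_ordZ hQne h1.1 h1.2 (hQX x hx)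
  have hmul := hf.isElliptic.mul hQ.isElliptic
  have hmne := order_mul_ne_top hf.meromorphic hQ.meromorphic hne hQne
  have hmo := ordZ_mul hf.meromorphic hQ.meromorphic hne hQne
  have hreal := (hs.mul hQs).isRealOnLine hω₁ hτ hmul H.line
  -- `Q` has pole order at most `X.card` at `0` and vanishes on `X`, so the count leaves it only
  -- simple zeros at `X` and no others on the contour away from `0`.
  have hQord : ∀ z ∈ horContour ω₁ h, z ≠ 0 → (z ∈ X → ordZ Q z = 1) ∧
      (z ∉ X → ordZ Q z = 0) := by
    rcases hO with ⟨rfl, ha⟩ | ⟨rfl, ha, ha0⟩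
    · obtain ⟨-, -, h1, h2, -⟩ := hQ.structure_lower hω₁ hτ hQne hQs ha X
        (fun z hz => ⟨((hX z).1 hz).1, ((hX z).1 hz).2.1, hQ1 z hz⟩) le_rfl
      exact fun z hz hz0 => ⟨fun h => h1 z h, fun h => h2 z hz hz0 h⟩
    -- The count on `γ₂` needs an even number of zeros. As `0 ∉ γ₂`, the set `X` consists of all
    -- points of odd order of `f` there, and parity applies.
    · have hev : Even X.card := by
        obtain ⟨Y, hY, hYe⟩ := exists_finset_odd (finite_support_ordZ hf.meromorphic hne
          (horContour_subset_fundRect (ω₁ := ω₁) hτ))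
        have hYX : Y = X := by
          ext z
          rw [hY, hX]
          refine ⟨fun h1 => ⟨h1.1, ?_, h1.2⟩, fun h1 => ⟨h1.1, h1.2.2⟩⟩
          rintro rfl
          have := h1.1.2
          simp only [Complex.zero_im] at this
          exact hτ.ne this
        rw [hYX] at hYe
        exact_mod_cast hYe.1 (hf.isElliptic.even_finsum_horContour hω₁ hne
          (hs.isRealOnLine hω₁ hτ hf.isElliptic H.line))
      obtain ⟨-, h1, h2, -⟩ := hQ.structure_upper hω₁ hτ hQne hQs ha ha0 X
        (fun z hz => ⟨((hX z).1 hz).1, hQ1 z hz⟩) X.card hev le_rfl le_rfl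
      exact fun z hz _ => ⟨fun h => h1 z h, fun h => h2 z hz h⟩
  have heven0 : ∀ z ∈ horContour ω₁ h, z ≠ 0 → Even (ordZ (fun z => f z * Q z) z) := by
    intro z hz hz0
    rw [hmo]
    by_cases hzX : z ∈ X
    · rw [(hQord z hz hz0).1 hzX]
      exact ((hX z).1 hzX).2.2.add_odd odd_one
    · rw [(hQord z hz hz0).2 hzX, add_zero, ← Int.not_odd_iff_even]
      exact fun h => hzX ((hX z).2 ⟨hz, hz0, h⟩)
  have heven : ∀ z ∈ horContour ω₁ h, Even (ordZ (fun z => f z * Q z) z) := by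
    intro z hz
    by_contra hodd
    rw [Int.not_even_iff_odd] at hodd
    -- The only candidate for odd order is `0`, but the number of points of odd order is even, so it
    -- cannot be the sole one.
    have hz0 : z = 0 := by
      by_contra hz0
      exact Int.not_even_iff_odd.2 hodd (heven0 z hz hz0)
    have hsub : horContour ω₁ h ⊆ fundRect ω₁ τ := by
      rcases H.line with rfl | rfl
      · exact horContour_zero_subset_fundRect hτ
      · exact horContour_subset_fundRect hτ
    obtain ⟨Y, hY, hYe⟩ := exists_finset_odd (finite_support_ordZ hmul.meromorphic hmne hsub)
    have hYz : Y = {z} := by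
      ext y
      rw [hY, Finset.mem_singleton]
      constructor
      · rintro ⟨h1, h2⟩
        by_contra hyz
        exact Int.not_even_iff_odd.2 h2 (heven0 y h1 fun h => hyz (h.trans hz0.symm))
      · rintro rfl
        exact ⟨hz, hodd⟩
    have := hYe.1 (hmul.even_finsum_horContour hω₁ hmne hreal)
    rw [hYz] at this
    simp at this
  obtain ⟨ε, hε⟩ := hmul.exists_sign hω₁ hmne hreal heven
  have hpos := hW.contourPairing_re_pos hω₁ hf hQ ε (by
    filter_upwards [ae_ne_zero_horPoint ω₁ hmul.meromorphic hmne h] with t ht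
    exact hε t ht.1 ht.2)
  rw [horth _ hlt Q hQ] at hpos
  simp at hpos

end

/-! ### Locating the zeros from orthogonality. -/

section

variable {ω₁ τ h : ℝ} {a : ℂ} {W : ℂ → ℝ} {m n N : ℕ} {f g : ℂ → ℂ}

lemma ordZ_eq_of_order {z : ℂ} {k : ℤ} (h : meromorphicOrderAt f z = (k : WithTop ℤ)) :
    ordZ f z = k := by
  rw [ordZ, h]
  rfl

lemma zero_mem_horContour (hω₁ : 0 < ω₁) : (0 : ℂ) ∈ horContour ω₁ 0 := ⟨by simp [hω₁], rfl⟩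

lemma ne_zero_of_mem_horContour (hτ : 0 < τ) {z : ℂ} (hz : z ∈ horContour ω₁ τ) : z ≠ 0 := by
  rintro rfl
  exact hτ.ne hz.2

/-- Zeros of a function orthogonal to the spaces `𝓛(m·0 + a)`, `m < n`, on the real contour. -/
theorem exists_zeros_lower (hω₁ : 0 < ω₁) (hτ : 0 < τ) (ha : a ∈ horContour ω₁ τ)
    (hW : IsPosWeight ω₁ τ 0 a W) (hf : IsEllipticPoly ω₁ τ a N f)
    (h0 : meromorphicOrderAt f 0 = ((-(N : ℤ) : ℤ) : WithTop ℤ)) (hs : ConjSymm ω₁ τ a f)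
    (horth : ∀ m < n, ∀ Q, IsEllipticPoly ω₁ τ a m Q → contourPairing ω₁ 0 W f Q = 0)
    (hNn : N ≤ n + 1) :
    ∃ X : Finset ℂ, X.card = N ∧
      (∀ z ∈ X, z ∈ horContour ω₁ 0 ∧ z ≠ 0 ∧ ordZ f z = 1) ∧
      (∀ z ∈ horContour ω₁ 0, z ≠ 0 → z ∉ X → ordZ f z = 0) ∧
      ((∀ z ∈ horContour ω₁ τ, ordZ f z = 0) ∨
        (ordZ f a = -1 ∧ ∃ w ∈ horContour ω₁ τ, w ≠ a ∧ ordZ f w = 1 ∧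
          ∀ z ∈ horContour ω₁ τ, z ≠ a → z ≠ w → ordZ f z = 0)) ∧
      ∀ z ∈ fundRect ω₁ τ, z ∉ horContour ω₁ 0 ∪ horContour ω₁ τ → ordZ f z = 0 := by
  have hne : ∀ z, meromorphicOrderAt f z ≠ ⊤ :=
    order_ne_top_of_ne_top hf.meromorphic (z := 0) (by rw [h0]; exact WithTop.coe_ne_top)
  obtain ⟨Y, hY, hYe⟩ := exists_finset_odd (finite_support_ordZ hf.meromorphic hne
    (horContour_zero_subset_fundRect (ω₁ := ω₁) hτ))
  have hYev := hYe.1 (hf.isElliptic.even_finsum_horContour hω₁ hne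
    (hs.isRealOnLine hω₁ hτ hf.isElliptic (.inl rfl)))
  have hX : ∀ z, z ∈ Y.erase 0 ↔ z ∈ horContour ω₁ 0 ∧ z ≠ 0 ∧ Odd (ordZ f z) := fun z => by
    rw [Finset.mem_erase, hY]
    tauto
  have hcard := OppositeAnchor.le_card_odd hω₁ hτ (.inl ⟨rfl, ha⟩) hW hf hne hs horth _ hX
  -- The points of odd order on the line are even in number, and `0` is one of them exactly when `N`
  -- is odd. So the number away from `0` has the parity of `N`; being at least `n ≥ N - 1`, it is at
  -- least `N`.
  have hN : N ≤ (Y.erase 0).card := by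
    by_cases hodd : Odd N
    · have hmem : (0 : ℂ) ∈ Y := by
        rw [hY, ordZ_eq_of_order h0, odd_neg, Int.odd_coe_nat]
        exact ⟨zero_mem_horContour hω₁, hodd⟩
      have h1 := Finset.card_erase_add_one hmem
      obtain ⟨k, hk⟩ := hodd
      obtain ⟨j, hj⟩ := hYev
      omega
    · have hmem : (0 : ℂ) ∉ Y := by
        rw [hY, ordZ_eq_of_order h0, odd_neg, Int.odd_coe_nat]
        exact fun h => hodd h.2
      rw [Finset.erase_eq_of_notMem hmem] at hcard ⊢
      obtain ⟨k, hk⟩ := Nat.not_odd_iff_even.1 hodd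
      obtain ⟨j, hj⟩ := hYev
      omega
  obtain ⟨h1, -, h2, h3, h4, h5⟩ := hf.structure_lower hω₁ hτ hne hs ha (Y.erase 0) (fun z hz => by
    have hz' := (hX z).1 hz
    refine ⟨hz'.1, hz'.2.1, ?_⟩
    have h2 := hf.ordZ_nonneg hω₁ hτ hne (horContour_subset_fundRect hτ ha)
      (horContour_zero_subset_fundRect hτ hz'.1) hz'.2.1
      (by rintro rfl; exact hτ.ne (hz'.1.2.symm.trans ha.2))
    obtain ⟨k, hk⟩ := hz'.2.2
    omega) hN
  exact ⟨_, h1, fun z hz => ⟨((hX z).1 hz).1, ((hX z).1 hz).2.1, h2 z hz⟩, h3, h4, h5⟩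

/-- Zeros of a function orthogonal to the spaces `𝓛(m·0 + a)`, `m < n`, on the upper contour. -/
theorem exists_zeros_upper (hω₁ : 0 < ω₁) (hτ : 0 < τ) (ha : a ∈ horContour ω₁ 0) (ha0 : a ≠ 0)
    (hW : IsPosWeight ω₁ τ τ a W) (hf : IsEllipticPoly ω₁ τ a N f)
    (hne : ∀ z, meromorphicOrderAt f z ≠ ⊤) (hs : ConjSymm ω₁ τ a f)
    (horth : ∀ m < n, ∀ Q, IsEllipticPoly ω₁ τ a m Q → contourPairing ω₁ τ W f Q = 0)
    (M : ℕ) (hM : Even M) (hNM : N ≤ M) (hMn : M ≤ n + 1) :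
    ∃ X : Finset ℂ, X.card = M ∧
      (∀ z ∈ X, z ∈ horContour ω₁ τ ∧ ordZ f z = 1) ∧
      (∀ z ∈ horContour ω₁ τ, z ∉ X → ordZ f z = 0) ∧
      (∀ z ∈ fundRect ω₁ τ, z ∉ horContour ω₁ 0 ∪ horContour ω₁ τ → ordZ f z = 0) ∧
      ∑ᶠ z ∈ horContour ω₁ 0, ordZ f z = -M := by
  obtain ⟨X, hX, hXe⟩ := exists_finset_odd (finite_support_ordZ hf.meromorphic hne
    (horContour_subset_fundRect (ω₁ := ω₁) hτ))
  have hXev := hXe.1 (hf.isElliptic.even_finsum_horContour hω₁ hne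
    (hs.isRealOnLine hω₁ hτ hf.isElliptic (.inr rfl)))
  have hcard := OppositeAnchor.le_card_odd hω₁ hτ (.inr ⟨rfl, ha, ha0⟩) hW hf hne hs horth X
    fun z => by
      rw [hX]
      exact ⟨fun hz => ⟨hz.1, ne_zero_of_mem_horContour hτ hz.1, hz.2⟩, fun hz => ⟨hz.1, hz.2.2⟩⟩
  obtain ⟨h1, h2, h3, h4, h5⟩ := hf.structure_upper hω₁ hτ hne hs ha ha0 X (fun z hz => by
    have hz' := (hX z).1 hz
    refine ⟨hz'.1, ?_⟩
    have h2 := hf.ordZ_nonneg hω₁ hτ hne (horContour_zero_subset_fundRect hτ ha)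
      (horContour_subset_fundRect hτ hz'.1) (ne_zero_of_mem_horContour hτ hz'.1)
      (by rintro rfl; exact hτ.ne (ha.2.symm.trans hz'.1.2))
    obtain ⟨k, hk⟩ := hz'.2
    omega) M hM hNM (by
    -- Both `X.card` and `M` are even and `X.card ≥ n ≥ M - 1`, so `X.card ≥ M`.
    obtain ⟨k, hk⟩ := hM
    obtain ⟨j, hj⟩ := hXev
    omega)
  exact ⟨X, h1, fun z hz => ⟨((hX z).1 hz).1, h2 z hz⟩, h3, h4, h5⟩

/-! ### Interlacing -/

/-- Induction along the lists: an entry of one list between neighbours of the other cannot have a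
smaller index than the one already placed, nor can two entries share a gap. Only the comparison of
the first entries has to be assumed. -/
lemma interlace_of_card_eq {N : ℕ} {z w : Fin N → ℝ} (hz : StrictMono z) (hw : StrictMono w)
    (hzw : ∀ i j, z i < z j → ∃ k, z i < w k ∧ w k < z j)
    (hwz : ∀ i j, w i < w j → ∃ k, w i < z k ∧ z k < w j)
    (h0 : ∀ i : Fin N, (i : ℕ) = 0 → z i < w i) :
    (∀ i, z i < w i) ∧ ∀ i j : Fin N, (j : ℕ) = i + 1 → w i < z j := by
  have key1 : ∀ (k : ℕ) (hk : k < N), z ⟨k, hk⟩ < w ⟨k, hk⟩ := by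
    intro k
    induction k with
    | zero => exact fun hk => h0 _ rfl
    | succ k ih =>
      intro hk
      have h1 := ih (by omega)
      obtain ⟨j, hj1, hj2⟩ := hwz ⟨k, by omega⟩ ⟨k + 1, hk⟩ (hw (by simp))
      have h2 := hz.lt_iff_lt.1 (h1.trans hj1)
      have h3 : (⟨k + 1, hk⟩ : Fin N) ≤ j := by
        rw [Fin.lt_def] at h2
        rw [Fin.le_def]
        exact h2
      exact (hz.monotone h3).trans_lt hj2
  have key2 : ∀ (k : ℕ) (hk : k + 1 < N), w ⟨k, by omega⟩ < z ⟨k + 1, hk⟩ := by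
    intro k
    induction k with
    | zero =>
      intro hk
      by_contra hcon
      obtain ⟨j, hj1, hj2⟩ := hzw ⟨0, by omega⟩ ⟨1, hk⟩ (hz (by simp))
      have h2 := hw.lt_iff_lt.1 (hj2.trans_le (not_lt.1 hcon))
      rw [Fin.lt_def] at h2
      simp at h2
    | succ k ih =>
      intro hk
      by_contra hcon
      have h1 := ih (by omega)
      obtain ⟨j, hj1, hj2⟩ := hzw ⟨k + 1, by omega⟩ ⟨k + 2, hk⟩ (hz (by simp))
      have h2 := hw.lt_iff_lt.1 (hj2.trans_le (not_lt.1 hcon))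
      have h3 := hw.lt_iff_lt.1 (h1.trans hj1)
      rw [Fin.lt_def] at h2 h3
      simp only at h2 h3
      omega
  refine ⟨fun i => key1 i i.2, fun i j hij => ?_⟩
  have hj : j = ⟨i + 1, hij ▸ j.2⟩ := Fin.ext hij
  rw [hj]
  exact key2 i _

lemma hasDerivAt_re_horPoint {t : ℝ} (hf : AnalyticAt ℂ f (horPoint h t)) :
    HasDerivAt (fun s => (f (horPoint h s)).re) (deriv f (horPoint h t)).re t ∧
    HasDerivAt (fun s => (f (horPoint h s)).im) (deriv f (horPoint h t)).im t := by
  have h1 : HasDerivAt (fun s : ℝ => horPoint h s) 1 t := by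
    simpa [horPoint] using (Complex.ofRealCLM.hasDerivAt (x := t)).add_const ((h : ℂ) * Complex.I)
  have h2 : HasDerivAt (fun s : ℝ => f (horPoint h s)) (deriv f (horPoint h t)) t := by
    have := hf.differentiableAt.hasDerivAt.comp t h1
    rwa [mul_one] at this
  exact ⟨Complex.reCLM.hasFDerivAt.comp_hasDerivAt t h2,
    Complex.imCLM.hasFDerivAt.comp_hasDerivAt t h2⟩

lemma IsRealOnLine.deriv_im {t : ℝ} (hr : IsRealOnLine f h) (hf : AnalyticAt ℂ f (horPoint h t)) :
    (deriv f (horPoint h t)).im = 0 := by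
  refine (hasDerivAt_re_horPoint hf).2.unique ((hasDerivAt_const t (0 : ℝ)).congr_of_eventuallyEq ?_)
  filter_upwards [(continuous_horPoint h).continuousAt.tendsto.eventually hf.eventually_analyticAt]
    with s hs using hr s hs

/-- If `v` had no zero inside, it would have none at the ends either, where `u` vanishes and the
Wronskian does not. Rolle's theorem for `u / v` would then produce a zero of the Wronskian. -/
lemma exists_zero_between {u v u' v' : ℝ → ℝ} {p q : ℝ} (hpq : p < q)
    (hu : ∀ t ∈ Set.Icc p q, HasDerivAt u (u' t) t) (hv : ∀ t ∈ Set.Icc p q, HasDerivAt v (v' t) t)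
    (hW : ∀ t ∈ Set.Icc p q, u' t * v t - u t * v' t ≠ 0) (hp : u p = 0) (hq : u q = 0) :
    ∃ t, p < t ∧ t < q ∧ v t = 0 := by
  by_contra! hcon
  have hv0 : ∀ t ∈ Set.Icc p q, v t ≠ 0 := by
    intro t ht h0
    rcases eq_or_lt_of_le ht.1 with rfl | h1
    · exact hW p ht (by rw [hp, h0]; ring)
    · rcases eq_or_lt_of_le ht.2 with rfl | h2
      · exact hW t ht (by rw [hq, h0]; ring)
      · exact hcon t h1 h2 h0
  have hd : ∀ t ∈ Set.Icc p q, HasDerivAt (fun s => u s / v s)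
      ((u' t * v t - u t * v' t) / v t ^ 2) t := fun t ht => (hu t ht).div (hv t ht) (hv0 t ht)
  obtain ⟨c, hc, hc0⟩ := exists_hasDerivAt_eq_zero hpq
    (fun t ht => (hd t ht).continuousAt.continuousWithinAt) (by simp [hp, hq])
    (fun t ht => hd t (Set.Ioo_subset_Icc_self ht))
  have hcI := Set.Ioo_subset_Icc_self hc
  exact div_ne_zero (hW c hcI) (pow_ne_zero 2 (hv0 c hcI)) hc0

/-- If no nontrivial real combination of `f` and `g` has a multiple zero on the contour then the
Wronskian of `f` and `g` does not vanish there. -/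
lemma wronskian_ne_zero {t : ℝ} (hf : AnalyticAt ℂ f (horPoint h t))
    (hg : AnalyticAt ℂ g (horPoint h t)) (hfr : IsRealOnLine f h) (hgr : IsRealOnLine g h)
    (hsimple : ∀ α β : ℝ, (α ≠ 0 ∨ β ≠ 0) →
      meromorphicOrderAt (fun z => α * f z + β * g z) (horPoint h t) ≤ ((1 : ℤ) : WithTop ℤ)) :
    (deriv f (horPoint h t)).re * (g (horPoint h t)).re -
      (f (horPoint h t)).re * (deriv g (horPoint h t)).re ≠ 0 := by
  intro hW
  set z := horPoint h t with hz
  -- A combination that vanishes together with its derivative has a zero of order at least two,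
  -- against the assumption.
  have key : ∀ α β : ℝ, (α ≠ 0 ∨ β ≠ 0) → α * (f z).re + β * (g z).re = 0 →
      α * (deriv f z).re + β * (deriv g z).re = 0 → False := by
    intro α β hαβ h1 h2
    have hfa := hfr t hf
    have hga := hgr t hg
    have hfd := hfr.deriv_im hf
    have hgd := hgr.deriv_im hg
    rw [← hz] at hfa hga hfd hgd
    have han : AnalyticAt ℂ (fun z => (α : ℂ) * f z + β * g z) z :=
      (analyticAt_const.mul hf).add (analyticAt_const.mul hg)
    have h0 : (fun z => (α : ℂ) * f z + β * g z) z = 0 := by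
      apply Complex.ext
      · simpa using h1
      · simp [hfa, hga]
    have hd : deriv (fun z => (α : ℂ) * f z + β * g z) z = α * deriv f z + β * deriv g z := by
      have := ((hf.differentiableAt.hasDerivAt.const_mul (α : ℂ)).add
        (hg.differentiableAt.hasDerivAt.const_mul (β : ℂ))).deriv
      exact this
    have hd0 : deriv (fun z => (α : ℂ) * f z + β * g z) z = 0 := by
      rw [hd]
      apply Complex.ext
      · simpa using h2
      · simp [hfd, hgd]
    have hpos : 0 < meromorphicOrderAt (fun z => (α : ℂ) * f z + β * g z) z := by
      rw [← tendsto_zero_iff_meromorphicOrderAt_pos han.meromorphicAt, ← h0]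
      exact han.continuousAt.tendsto.mono_left nhdsWithin_le_nhds
    have h1' := hsimple α β hαβ
    refine (AnalyticAt.order_eq_one_iff han h0).1 (le_antisymm h1' ?_) hd0
    cases ho : meromorphicOrderAt (fun z => (α : ℂ) * f z + β * g z) z with
    | top => exact le_top
    | coe k =>
      rw [ho] at hpos
      have : (0 : ℤ) < k := by exact_mod_cast hpos
      exact_mod_cast (by omega : (1 : ℤ) ≤ k)
  -- A vanishing Wronskian makes the two equations for `(α, β)` dependent. A nonzero solution is
  -- `(g, -f)` if the values do not both vanish, otherwise `(g', -f')`, and anything if the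
  -- derivatives vanish as well.
  by_cases hfg : (f z).re = 0 ∧ (g z).re = 0
  · by_cases hd : (deriv f z).re = 0 ∧ (deriv g z).re = 0
    · exact key 1 0 (by simp) (by simp [hfg.1]) (by simp [hd.1])
    · refine key (deriv g z).re (-(deriv f z).re) ?_ (by simp [hfg.1, hfg.2]) (by ring)
      rw [neg_ne_zero]
      tauto
  · refine key (g z).re (-(f z).re) ?_ (by ring) (by linarith)
    rw [neg_ne_zero]
    tauto

/-- `A` is the set of abscissae of the zeros of `f` on the contour, all of which are simple. -/
structure IsSimpleZeroSet (ω₁ h : ℝ) (f : ℂ → ℂ) (A : Finset ℝ) : Prop where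
  mem_Ico : ∀ t ∈ A, t ∈ Set.Ico 0 (2 * ω₁)
  analyticAt : ∀ t ∈ Set.Ico 0 (2 * ω₁), horPoint h t ≠ 0 → AnalyticAt ℂ f (horPoint h t)
  order_of_mem : ∀ t ∈ A, horPoint h t ≠ 0 ∧
    meromorphicOrderAt f (horPoint h t) = ((1 : ℤ) : WithTop ℤ)
  order_of_notMem : ∀ t ∈ Set.Ico 0 (2 * ω₁), t ∉ A →
    meromorphicOrderAt f (horPoint h t) ≤ ((0 : ℤ) : WithTop ℤ)

namespace IsSimpleZeroSet

variable {A B : Finset ℝ}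

lemma eq_zero (hA : IsSimpleZeroSet ω₁ h f A) {t : ℝ} (ht : t ∈ A) : f (horPoint h t) = 0 := by
  have h1 := hA.order_of_mem t ht
  have h2 := hA.analyticAt t (hA.mem_Ico t ht) h1.1
  have h3 : 0 < meromorphicOrderAt f (horPoint h t) := by
    rw [h1.2]
    exact_mod_cast (by norm_num : (0 : ℤ) < 1)
  exact tendsto_nhds_unique (h2.continuousAt.tendsto.mono_left nhdsWithin_le_nhds)
    ((tendsto_zero_iff_meromorphicOrderAt_pos h2.meromorphicAt).2 h3)

lemma mem_of_eq_zero (hA : IsSimpleZeroSet ω₁ h f A) {t : ℝ} (ht : t ∈ Set.Ico 0 (2 * ω₁))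
    (h0 : horPoint h t ≠ 0) (hft : f (horPoint h t) = 0) : t ∈ A := by
  by_contra htA
  have h1 := hA.order_of_notMem t ht htA
  have h2 := hA.analyticAt t ht h0
  refine not_lt.2 h1 ?_
  change 0 < _
  rw [← tendsto_zero_iff_meromorphicOrderAt_pos h2.meromorphicAt, ← hft]
  exact h2.continuousAt.tendsto.mono_left nhdsWithin_le_nhds

lemma isZeroList (hA : IsSimpleZeroSet ω₁ h f A) {N : ℕ} {z : Fin N → ℝ}
    (hz : Function.Injective z) (hzA : ∀ t, t ∈ A ↔ ∃ i, z i = t) :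
    IsZeroList f (horContour ω₁ h) fun i => horPoint h (z i) := by
  refine ⟨fun i => ⟨?_, horPoint_im _ _⟩, fun w hw => ?_⟩
  · rw [horPoint_re]
    exact hA.mem_Ico _ ((hzA _).2 ⟨i, rfl⟩)
  · have hiff : ∀ i, horPoint h (z i) = w ↔ z i = w.re := by
      intro i
      rw [← eq_horPoint_of_mem hw]
      refine ⟨fun h1 => ?_, fun h1 => by rw [h1, horPoint_re]⟩
      have := congrArg Complex.re h1
      rwa [horPoint_re] at this
    simp only [hiff]
    rw [← eq_horPoint_of_mem hw, horPoint_re]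
    by_cases hwA : w.re ∈ A
    · obtain ⟨i, hi⟩ := (hzA _).1 hwA
      have : {j | z j = w.re} = {i} := by
        ext j
        simp only [Set.mem_ofPred_eq, Set.mem_singleton_iff]
        rw [← hi]
        exact hz.eq_iff
      rw [this, Set.ncard_singleton, (hA.order_of_mem _ hwA).2]
      rfl
    · have : {j | z j = w.re} = ∅ := by
        ext j
        simp only [Set.mem_ofPred_eq, Set.mem_empty_iff_false, iff_false]
        exact fun h1 => hwA ((hzA _).2 ⟨j, h1⟩)
      rw [this, Set.ncard_empty]
      exact (max_eq_right (hA.order_of_notMem _ hw.1 hwA)).symm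

/-- Between two zeros of `f` there is a zero of `g`. -/
lemma exists_between (hA : IsSimpleZeroSet ω₁ h f A) (hB : IsSimpleZeroSet ω₁ h g B)
    (hW : ∀ t ∈ Set.Ico 0 (2 * ω₁), horPoint h t ≠ 0 →
      (deriv f (horPoint h t)).re * (g (horPoint h t)).re -
        (f (horPoint h t)).re * (deriv g (horPoint h t)).re ≠ 0)
    (hgr : IsRealOnLine g h) {p q : ℝ} (hp : p ∈ A) (hq : q ∈ A) (hpq : p < q) :
    ∃ t ∈ B, p < t ∧ t < q := by
  have hp' := hA.mem_Ico p hp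
  have hq' := hA.mem_Ico q hq
  -- The possible pole at the origin is avoided: it has abscissa `0`, the left end of the contour,
  -- and `p` is a zero elsewhere.
  have hI : ∀ t ∈ Set.Icc p q, t ∈ Set.Ico 0 (2 * ω₁) ∧ horPoint h t ≠ 0 := by
    intro t ht
    refine ⟨⟨hp'.1.trans ht.1, ht.2.trans_lt hq'.2⟩, fun h0 => ?_⟩
    have ht0 : t = 0 := by simpa [horPoint_re] using congrArg Complex.re h0
    have hpt : p = t := le_antisymm ht.1 (by rw [ht0]; exact hp'.1)
    exact (hA.order_of_mem p hp).1 (hpt ▸ h0)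
  obtain ⟨t, h1, h2, h3⟩ := exists_zero_between (u := fun t => (f (horPoint h t)).re)
    (v := fun t => (g (horPoint h t)).re) hpq
    (fun t ht => (hasDerivAt_re_horPoint (hA.analyticAt t (hI t ht).1 (hI t ht).2)).1)
    (fun t ht => (hasDerivAt_re_horPoint (hB.analyticAt t (hI t ht).1 (hI t ht).2)).1)
    (fun t ht => hW t (hI t ht).1 (hI t ht).2) (by simp [hA.eq_zero hp]) (by simp [hA.eq_zero hq])
  have ht := hI t ⟨h1.le, h2.le⟩
  exact ⟨t, hB.mem_of_eq_zero ht.1 ht.2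
    (Complex.ext h3 (hgr t (hB.analyticAt t ht.1 ht.2))), h1, h2⟩

lemma notMem_of_mem (hA : IsSimpleZeroSet ω₁ h f A) (hB : IsSimpleZeroSet ω₁ h g B)
    (hW : ∀ t ∈ Set.Ico 0 (2 * ω₁), horPoint h t ≠ 0 →
      (deriv f (horPoint h t)).re * (g (horPoint h t)).re -
        (f (horPoint h t)).re * (deriv g (horPoint h t)).re ≠ 0) {t : ℝ} (ht : t ∈ A) :
    t ∉ B := fun htB => hW t (hA.mem_Ico t ht) (hA.order_of_mem t ht).1 (by
  rw [hA.eq_zero ht, hB.eq_zero htB]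
  simp)

/-- The gaps between consecutive zeros of `f` yield `B.card` distinct zeros of `g`, which are
therefore all of them. -/
theorem strictlyInterlaces_succ (hA : IsSimpleZeroSet ω₁ h f A) (hB : IsSimpleZeroSet ω₁ h g B)
    (hW : ∀ t ∈ Set.Ico 0 (2 * ω₁), horPoint h t ≠ 0 →
      (deriv f (horPoint h t)).re * (g (horPoint h t)).re -
        (f (horPoint h t)).re * (deriv g (horPoint h t)).re ≠ 0)
    (hgr : IsRealOnLine g h) (hcard : A.card = B.card + 1) :
    StrictlyInterlaces (horContour ω₁ h) f g := by
  set z := A.orderEmbOfFin hcard with hz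
  have hzA : ∀ i, z i ∈ A := fun i => A.orderEmbOfFin_mem hcard i
  have hbt : ∀ i : Fin B.card, ∃ t ∈ B, z i.castSucc < t ∧ t < z i.succ := fun i =>
    hA.exists_between hB hW hgr (hzA _) (hzA _) (z.strictMono i.castSucc_lt_succ)
  choose w hwB hw1 hw2 using hbt
  have hwm : StrictMono w := by
    intro i j hij
    refine (hw2 i).trans_le (le_trans (z.monotone ?_) (hw1 j).le)
    rw [Fin.le_def]
    simpa using hij
  refine Or.inr ⟨B.card, fun i => horPoint h (z i), fun i => horPoint h (w i),
    hA.isZeroList z.injective fun t => ?_, hB.isZeroList hwm.injective fun t => ?_, fun i => ?_⟩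
  · have := A.range_orderEmbOfFin hcard
    rw [← Finset.mem_coe, ← this]
    rfl
  · have himg : Finset.univ.image w = B :=
      Finset.eq_of_subset_of_card_le (Finset.image_subset_iff.2 fun i _ => hwB i) (by
        rw [Finset.card_image_of_injective _ hwm.injective]
        simp)
    have := Finset.ext_iff.1 himg t
    rw [← this]
    simp
  · simp only [horPoint_re]
    exact ⟨hw1 i, hw2 i⟩

/-- With equally many zeros, separation works in both directions, and the smaller of the two first
zeros decides the order. -/
theorem strictlyInterlaces_or (hA : IsSimpleZeroSet ω₁ h f A) (hB : IsSimpleZeroSet ω₁ h g B)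
    (hW : ∀ t ∈ Set.Ico 0 (2 * ω₁), horPoint h t ≠ 0 →
      (deriv f (horPoint h t)).re * (g (horPoint h t)).re -
        (f (horPoint h t)).re * (deriv g (horPoint h t)).re ≠ 0)
    (hfr : IsRealOnLine f h) (hgr : IsRealOnLine g h) (hcard : A.card = B.card) :
    StrictlyInterlaces (horContour ω₁ h) f g ∨ StrictlyInterlaces (horContour ω₁ h) g f := by
  have hW' : ∀ t ∈ Set.Ico 0 (2 * ω₁), horPoint h t ≠ 0 →
      (deriv g (horPoint h t)).re * (f (horPoint h t)).re -
        (g (horPoint h t)).re * (deriv f (horPoint h t)).re ≠ 0 := fun t ht ht0 hcon =>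
    hW t ht ht0 (by linarith)
  set z := A.orderEmbOfFin hcard with hz
  set w := B.orderEmbOfFin rfl with hw
  have hzA : ∀ t, t ∈ A ↔ ∃ i, z i = t := fun t => by
    rw [← Finset.mem_coe, ← A.range_orderEmbOfFin hcard]
    rfl
  have hwB : ∀ t, t ∈ B ↔ ∃ i, w i = t := fun t => by
    rw [← Finset.mem_coe, ← B.range_orderEmbOfFin rfl]
    rfl
  have hne : ∀ i j, z i ≠ w j := fun i j hij =>
    hA.notMem_of_mem hB hW ((hzA _).2 ⟨i, rfl⟩) ((hwB _).2 ⟨j, hij.symm⟩)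
  have hzw : ∀ i j, z i < z j → ∃ k, z i < w k ∧ w k < z j := fun i j hij => by
    obtain ⟨t, ht, h1, h2⟩ :=
      hA.exists_between hB hW hgr ((hzA _).2 ⟨i, rfl⟩) ((hzA _).2 ⟨j, rfl⟩) hij
    obtain ⟨k, rfl⟩ := (hwB t).1 ht
    exact ⟨k, h1, h2⟩
  have hwz : ∀ i j, w i < w j → ∃ k, w i < z k ∧ z k < w j := fun i j hij => by
    obtain ⟨t, ht, h1, h2⟩ :=
      hB.exists_between hA hW' hfr ((hwB _).2 ⟨i, rfl⟩) ((hwB _).2 ⟨j, rfl⟩) hij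
    obtain ⟨k, rfl⟩ := (hzA t).1 ht
    exact ⟨k, h1, h2⟩
  have hzl := hA.isZeroList z.injective hzA
  have hwl := hB.isZeroList w.injective hwB
  by_cases h0 : ∀ i : Fin B.card, (i : ℕ) = 0 → z i < w i
  · obtain ⟨h1, h2⟩ := interlace_of_card_eq z.strictMono w.strictMono hzw hwz h0
    exact Or.inl (Or.inl ⟨_, _, _, hzl, hwl, fun i => by simpa only [horPoint_re] using h1 i,
      fun i j hij => by simpa only [horPoint_re] using h2 i j hij⟩)
  · push Not at h0
    obtain ⟨i, hi, hle⟩ := h0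
    obtain ⟨h1, h2⟩ := interlace_of_card_eq w.strictMono z.strictMono hwz hzw (fun j hj => by
        have : j = i := Fin.ext (hj.trans hi.symm)
        rw [this]
        exact lt_of_le_of_ne hle (hne i i).symm)
    exact Or.inr (Or.inl ⟨_, _, _, hwl, hzl, fun i => by simpa only [horPoint_re] using h1 i,
      fun i j hij => by simpa only [horPoint_re] using h2 i j hij⟩)

end IsSimpleZeroSet

end

/-! ### Zeros of the orthonormal functions and their interlacing. -/

section

variable {ω₁ τ h : ℝ} {a : ℂ} {W : ℂ → ℝ} {m n N : ℕ} {f g : ℂ → ℂ}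

lemma isMeroZero_iff {z : ℂ} (h : meromorphicOrderAt f z ≠ ⊤) : IsMeroZero f z ↔ 0 < ordZ f z := by
  rw [IsMeroZero, ← coe_ordZ h]
  exact_mod_cast Iff.rfl

lemma isSimpleMeroZero_iff {z : ℂ} (h : meromorphicOrderAt f z ≠ ⊤) :
    IsSimpleMeroZero f z ↔ ordZ f z = 1 := by
  rw [IsSimpleMeroZero, ← coe_ordZ h]
  exact_mod_cast Iff.rfl

lemma hasPoleAt_iff {z : ℂ} (h : meromorphicOrderAt f z ≠ ⊤) : HasPoleAt f z ↔ ordZ f z < 0 := by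
  rw [HasPoleAt, ← coe_ordZ h]
  exact_mod_cast Iff.rfl

namespace IsOrthonormalEOP

lemma order_zero (hf : IsOrthonormalEOP ω₁ τ h W a n f) :
    meromorphicOrderAt f 0 = ((-(n : ℤ) : ℤ) : WithTop ℤ) := by
  obtain ⟨c, hc, hlim⟩ := hf.leading_pos
  exact hf.mem.order_zero_of_leading (by exact_mod_cast hc.ne') hlim

lemma order_ne_top (hf : IsOrthonormalEOP ω₁ τ h W a n f) (z : ℂ) : meromorphicOrderAt f z ≠ ⊤ :=
  order_ne_top_of_ne_top hf.mem.meromorphic (z := 0)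
    (by rw [hf.order_zero]; exact WithTop.coe_ne_top) z

lemma conjSymm (H : IsAnchor ω₁ τ h a) (hW : IsPosWeight ω₁ τ h a W)
    (hf : IsOrthonormalEOP ω₁ τ h W a n f) : ConjSymm ω₁ τ a f := by
  obtain ⟨c, -, hlim⟩ := hf.leading_pos
  exact hf.isOrthogonalEOP.conjSymm H hW hlim

lemma isSimpleMeroZero (hω₁ : 0 < ω₁) (hτ : 0 < τ) (hf : IsOrthonormalEOP ω₁ τ h W a n f)
    (hs : ∀ z ∈ fundRect ω₁ τ, 0 < ordZ f z → ordZ f z = 1) {z : ℂ} (hz : IsMeroZero f z) :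
    IsSimpleMeroZero f z := by
  obtain ⟨l, hl, hzl⟩ := exists_add_mem_fundRect hω₁ hτ z
  have h1 := hf.mem.isElliptic.order_add hl z
  rw [IsMeroZero, ← h1] at hz
  rw [IsSimpleMeroZero, ← h1]
  exact (isSimpleMeroZero_iff (hf.order_ne_top _)).2
    (hs _ hzl ((isMeroZero_iff (hf.order_ne_top _)).1 hz))

/-- Nontrivial real combinations of two consecutive functions. -/
lemma combination (H : IsAnchor ω₁ τ h a) (hW : IsPosWeight ω₁ τ h a W)
    (hf : IsOrthonormalEOP ω₁ τ h W a (n + 1) f) (hg : IsOrthonormalEOP ω₁ τ h W a n g) (α β : ℝ)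
    (hαβ : α ≠ 0 ∨ β ≠ 0) :
    ∃ N, N ≤ n + 1 ∧ IsEllipticPoly ω₁ τ a N (fun z => α * f z + β * g z) ∧
      meromorphicOrderAt (fun z => α * f z + β * g z) 0 = ((-(N : ℤ) : ℤ) : WithTop ℤ) ∧
      ConjSymm ω₁ τ a (fun z => α * f z + β * g z) ∧
      ∀ m < n, ∀ Q, IsEllipticPoly ω₁ τ a m Q →
        contourPairing ω₁ h W (fun z => α * f z + β * g z) Q = 0 := by
  have hs : ConjSymm ω₁ τ a (fun z => α * f z + β * g z) :=
    ((hf.conjSymm H hW).const_mul α).add ((hg.conjSymm H hW).const_mul β)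
  have horth : ∀ m < n, ∀ Q, IsEllipticPoly ω₁ τ a m Q →
      contourPairing ω₁ h W (fun z => α * f z + β * g z) Q = 0 := by
    intro m hm Q hQ
    rw [contourPairing_comm, hW.contourPairing_add hQ (hf.mem.const_mul α) (hg.mem.const_mul β),
      contourPairing_const_mul, contourPairing_const_mul, contourPairing_comm,
      hf.orthogonal m (by omega) Q hQ, contourPairing_comm, hg.orthogonal m hm Q hQ]
    simp
  have hc : ∀ {F : ℂ → ℂ} {γ : ℝ}, MeromorphicAt F 0 → γ ≠ 0 →
      meromorphicOrderAt (fun z => (γ : ℂ) * F z) 0 = meromorphicOrderAt F 0 := by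
    intro F γ hF hγ
    have h1 := meromorphicOrderAt_mul (MeromorphicAt.const (γ : ℂ) 0) hF
    have h2 : meromorphicOrderAt (fun _ : ℂ => (γ : ℂ)) 0 = 0 := by
      rw [meromorphicOrderAt_const, if_neg (by exact_mod_cast hγ)]
    rw [h2, zero_add] at h1
    exact h1
  -- The term `β g` cannot cancel the pole of `α f` of order `n + 1`. So the exact order of the pole
  -- is `n + 1` or `n`.
  by_cases hα : α = 0
  · have hβ : β ≠ 0 := by tauto
    have heq : (fun z => (α : ℂ) * f z + β * g z) = fun z => (β : ℂ) * g z := by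
      funext z
      simp [hα]
    refine ⟨n, by omega, ?_, ?_, hs, horth⟩
    · rw [heq]
      exact hg.mem.const_mul _
    · rw [heq, hc (hg.mem.meromorphic 0) hβ, hg.order_zero]
  · refine ⟨n + 1, le_rfl, (hf.mem.const_mul _).add ((hg.mem.const_mul _).mono (by omega)), ?_, hs,
      horth⟩
    have h1 : meromorphicOrderAt (fun z => (α : ℂ) * f z) 0 <
        meromorphicOrderAt (fun z => (β : ℂ) * g z) 0 := by
      rw [hc (hf.mem.meromorphic 0) hα, hf.order_zero]
      exact lt_of_lt_of_le (by exact_mod_cast (by omega : -((n + 1 : ℕ) : ℤ) < -n))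
        (hg.mem.const_mul (β : ℂ)).order_zero
    have h2 := meromorphicOrderAt_add_eq_left_of_lt
      ((hg.mem.const_mul (β : ℂ)).meromorphic 0) h1
    rw [hc (hf.mem.meromorphic 0) hα, hf.order_zero] at h2
    exact h2

end IsOrthonormalEOP

lemma exists_isSimpleZeroSet (H : IsAnchor ω₁ τ h a) (hf : IsEllipticPoly ω₁ τ a N f)
    (hne : ∀ z, meromorphicOrderAt f z ≠ ⊤) (X : Finset ℂ)
    (hX : ∀ z ∈ X, z ∈ horContour ω₁ h ∧ z ≠ 0 ∧ ordZ f z = 1)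
    (hX' : ∀ z ∈ horContour ω₁ h, z ∉ X → ordZ f z ≤ 0) :
    ∃ A : Finset ℝ, A.card = X.card ∧ IsSimpleZeroSet ω₁ h f A := by
  have hcont : ∀ t ∈ Set.Ico 0 (2 * ω₁), horPoint h t ∈ horContour ω₁ h := fun t ht =>
    ⟨by rwa [horPoint_re], horPoint_im _ _⟩
  have hmem : ∀ t, t ∈ X.image Complex.re ↔ horPoint h t ∈ X := by
    intro t
    rw [Finset.mem_image]
    constructor
    · rintro ⟨z, hz, rfl⟩
      rwa [eq_horPoint_of_mem (hX z hz).1]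
    · exact fun ht => ⟨_, ht, horPoint_re _ _⟩
  refine ⟨X.image Complex.re, Finset.card_image_of_injOn fun z hz w hw hzw => ?_, ?_, ?_, ?_, ?_⟩
  · exact Complex.ext hzw ((hX z hz).1.2.trans (hX w hw).1.2.symm)
  · intro t ht
    have := (hX _ ((hmem t).1 ht)).1.1
    rwa [horPoint_re] at this
  · intro t ht ht0
    have := mem_horContour_notMem_polar H (hcont t ht) ht0
    exact hf.holomorphic _ this.1 this.2
  · intro t ht
    have := hX _ ((hmem t).1 ht)
    exact ⟨this.2.1, by rw [← coe_ordZ (hne _), this.2.2]⟩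
  · intro t ht htA
    rw [← coe_ordZ (hne _)]
    exact_mod_cast hX' _ (hcont t ht) fun h1 => htA ((hmem t).2 h1)

lemma meroZeros_eq (hne : ∀ z, meromorphicOrderAt f z ≠ ⊤) {S : Set ℂ} (X : Finset ℂ)
    (hX : ∀ z ∈ X, z ∈ S ∧ ordZ f z = 1) (hX' : ∀ z ∈ S, z ∉ X → ordZ f z ≤ 0) :
    meroZeros f S = X := by
  ext z
  rw [meroZeros, Set.mem_ofPred_eq, isMeroZero_iff (hne z), Finset.mem_coe]
  constructor
  · rintro ⟨h1, h2⟩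
    by_contra h3
    exact absurd (hX' z h1 h3) (not_le.2 h2)
  · intro hz
    refine ⟨(hX z hz).1, ?_⟩
    rw [(hX z hz).2]
    norm_num

/-- The consequences of the alternative for the orders on the contour that contains the anchor. -/
lemma zeros_of_alternative (hne : ∀ z, meromorphicOrderAt f z ≠ ⊤) {S : Set ℂ} (ha : a ∈ S)
    (h0 : ∀ z ∈ S, z = 0 → ordZ f z ≤ 0) (ha0 : a ≠ 0)
    (halt : (∀ z ∈ S, z ≠ 0 → ordZ f z = 0) ∨ (ordZ f a = -1 ∧ ∃ w ∈ S, w ≠ 0 ∧ w ≠ a ∧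
      ordZ f w = 1 ∧ ∀ z ∈ S, z ≠ 0 → z ≠ a → z ≠ w → ordZ f z = 0)) :
    ((∃ z ∈ S, IsSimpleMeroZero f z) ↔ HasPoleAt f a) ∧ (meroZeros f S).encard ≤ 1 ∧
      ∀ z ∈ S, 0 < ordZ f z → ordZ f z = 1 := by
  rw [hasPoleAt_iff (hne a)]
  simp only [isSimpleMeroZero_iff (hne _)]
  rcases halt with halt | ⟨h1, w, hwS, hw0, hwa, hw1, hw⟩
  · have hle : ∀ z ∈ S, ordZ f z ≤ 0 := fun z hz => by
      by_cases hz0 : z = 0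
      exacts [h0 z hz hz0, (halt z hz hz0).le]
    refine ⟨⟨fun ⟨z, hz, hz1⟩ => ?_, fun h => ?_⟩, ?_, fun z hz hz1 => ?_⟩
    · have := hle z hz
      omega
    · rw [halt a ha ha0] at h
      exact absurd h (lt_irrefl _)
    · rw [meroZeros_eq hne ∅ (by simp) (fun z hz _ => hle z hz)]
      simp
    · exact absurd (hle z hz) (not_le.2 hz1)
  · have hle : ∀ z ∈ S, z ≠ w → ordZ f z ≤ 0 := fun z hz hzw => by
      by_cases hz0 : z = 0
      · exact h0 z hz hz0
      by_cases hza : z = a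
      · rw [hza, h1]
        norm_num
      · exact (hw z hz hz0 hza hzw).le
    refine ⟨⟨fun _ => by rw [h1]; norm_num, fun _ => ⟨w, hwS, hw1⟩⟩, ?_, fun z hz hz1 => ?_⟩
    · rw [meroZeros_eq hne {w} (by simpa using ⟨hwS, hw1⟩)
        (fun z hz hzw => hle z hz (by simpa using hzw))]
      simp
    · by_cases hzw : z = w
      · rw [hzw, hw1]
      · exact absurd (hle z hz hzw) (not_le.2 hz1)

theorem zeros_lower (hω₁ : 0 < ω₁) (hτ : 0 < τ) (ha : a ∈ horContour ω₁ τ)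
    (hW : IsPosWeight ω₁ τ 0 a W) (hg : IsOrthonormalEOP ω₁ τ 0 W a n g) :
    (∀ z, IsMeroZero g z → IsSimpleMeroZero g z) ∧
    (meroZeros g (horContour ω₁ 0)).encard = n ∧
    ((∃ z ∈ horContour ω₁ τ, IsSimpleMeroZero g z) ↔ HasPoleAt g a) ∧
    (meroZeros g (horContour ω₁ τ)).encard ≤ 1 ∧
    meroZeros g (fundRect ω₁ τ) ⊆ horContour ω₁ 0 ∪ horContour ω₁ τ ∧
    ∃ A : Finset ℝ, A.card = n ∧ IsSimpleZeroSet ω₁ 0 g A := by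
  have H := OppositeAnchor.isAnchor hω₁ hτ (.inl ⟨rfl, ha⟩)
  have hne := hg.order_ne_top
  obtain ⟨X, h1, h2, h3, h4, h5⟩ := exists_zeros_lower hω₁ hτ ha hW hg.mem hg.order_zero
    (hg.conjSymm H hW) hg.orthogonal (by omega)
  have hX' : ∀ z ∈ horContour ω₁ 0, z ∉ X → ordZ g z ≤ 0 := fun z hz hzX => by
    by_cases hz0 : z = 0
    · rw [hz0, ordZ_eq_of_order hg.order_zero]
      omega
    · exact (h3 z hz hz0 hzX).le
  have hnz : ∀ z ∈ horContour ω₁ τ, z ≠ 0 := fun z hz => ne_zero_of_mem_horContour hτ hz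
  obtain ⟨e1, e2, e3⟩ := zeros_of_alternative hne ha (fun z hz h0 => absurd h0 (hnz z hz))
    (hnz a ha) (by
      rcases h4 with h4 | ⟨h6, w, h7, h8, h9, h10⟩
      · exact Or.inl fun z hz _ => h4 z hz
      · exact Or.inr ⟨h6, w, h7, hnz w h7, h8, h9, fun z hz _ => h10 z hz⟩)
  refine ⟨fun z hz => hg.isSimpleMeroZero hω₁ hτ (fun z hz hpos => ?_) hz, ?_, e1, e2, ?_, ?_⟩
  · by_cases hz0 : z ∈ horContour ω₁ 0
    · by_cases hzX : z ∈ X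
      · exact (h2 z hzX).2.2
      · exact absurd (hX' z hz0 hzX) (not_le.2 hpos)
    by_cases hzτ : z ∈ horContour ω₁ τ
    · exact e3 z hzτ hpos
    · rw [h5 z hz (not_or.2 ⟨hz0, hzτ⟩)] at hpos
      exact absurd hpos (lt_irrefl _)
  · rw [meroZeros_eq hne X (fun z hz => ⟨(h2 z hz).1, (h2 z hz).2.2⟩) hX', Set.encard_coe_eq_coe_finsetCard,
      h1]
  · rintro z ⟨hz, hz0⟩
    by_contra hcon
    rw [isMeroZero_iff (hne z), h5 z hz hcon] at hz0
    exact lt_irrefl _ hz0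
  · rw [← h1]
    exact exists_isSimpleZeroSet H hg.mem hne X h2 hX'

/-- Combinations may have pole order `n + 1` while being orthogonal only for `m < n`. The bound `N ≤
n + 1` in `exists_zeros_lower` allows precisely this loss, so their zeros on the contour stay
simple. -/
theorem strictlyInterlaces_lower (hω₁ : 0 < ω₁) (hτ : 0 < τ) (ha : a ∈ horContour ω₁ τ)
    (hW : IsPosWeight ω₁ τ 0 a W) (hf : IsOrthonormalEOP ω₁ τ 0 W a (n + 1) f)
    (hg : IsOrthonormalEOP ω₁ τ 0 W a n g) : StrictlyInterlaces (horContour ω₁ 0) f g := by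
  have H := OppositeAnchor.isAnchor hω₁ hτ (.inl ⟨rfl, ha⟩)
  obtain ⟨A, hAc, hA⟩ := (zeros_lower hω₁ hτ ha hW hf).2.2.2.2.2
  obtain ⟨B, hBc, hB⟩ := (zeros_lower hω₁ hτ ha hW hg).2.2.2.2.2
  have hfr := (hf.conjSymm H hW).isRealOnLine hω₁ hτ hf.mem.isElliptic (.inl rfl)
  have hgr := (hg.conjSymm H hW).isRealOnLine hω₁ hτ hg.mem.isElliptic (.inl rfl)
  refine hA.strictlyInterlaces_succ hB (fun t ht ht0 => ?_) hgr (by rw [hAc, hBc])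
  refine wronskian_ne_zero (hA.analyticAt t ht ht0) (hB.analyticAt t ht ht0) hfr hgr
    fun α β hαβ => ?_
  obtain ⟨N, hN, h1, h2, h3, h4⟩ := hf.combination H hW hg α β hαβ
  obtain ⟨X, -, h5, h6, -⟩ := exists_zeros_lower hω₁ hτ ha hW h1 h2 h3 h4 hN
  have hne := order_ne_top_of_ne_top h1.meromorphic (z := 0) (by rw [h2]; exact WithTop.coe_ne_top)
  rw [← coe_ordZ (hne _), WithTop.coe_le_coe]
  by_cases hX : horPoint 0 t ∈ X
  · exact (h5 _ hX).2.2.le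
  · rw [h6 _ ⟨by rwa [horPoint_re], horPoint_im _ _⟩ ht0 hX]
    norm_num

/-- `M` is the even one among `n` and `n + 1`; the number of zeros on `γ₂` must be even. -/
theorem zeros_upper (hω₁ : 0 < ω₁) (hτ : 0 < τ) (ha : a ∈ horContour ω₁ 0) (ha0 : a ≠ 0)
    (hW : IsPosWeight ω₁ τ τ a W) (hg : IsOrthonormalEOP ω₁ τ τ W a n g) (M : ℕ)
    (hM : Even M) (hnM : n ≤ M) (hMn : M ≤ n + 1) :
    (∀ z ∈ fundRect ω₁ τ, z ∉ horContour ω₁ 0 → 0 < ordZ g z → ordZ g z = 1) ∧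
    (meroZeros g (horContour ω₁ τ)).encard = M ∧
    meroZeros g (fundRect ω₁ τ) ⊆ horContour ω₁ 0 ∪ horContour ω₁ τ ∧
    (∃ A : Finset ℝ, A.card = M ∧ IsSimpleZeroSet ω₁ τ g A) ∧
    ∑ᶠ z ∈ horContour ω₁ 0, ordZ g z = -M := by
  have H := OppositeAnchor.isAnchor hω₁ hτ (.inr ⟨rfl, ha, ha0⟩)
  have hne := hg.order_ne_top
  obtain ⟨X, h1, h2, h3, h4, h5⟩ := exists_zeros_upper hω₁ hτ ha ha0 hW hg.mem hne
    (hg.conjSymm H hW) hg.orthogonal M hM hnM hMn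
  have hX' : ∀ z ∈ horContour ω₁ τ, z ∉ X → ordZ g z ≤ 0 := fun z hz hzX => (h3 z hz hzX).le
  refine ⟨fun z hz hz0 hpos => ?_, ?_, ?_, ?_, h5⟩
  · by_cases hzX : z ∈ X
    · exact (h2 z hzX).2
    by_cases hzτ : z ∈ horContour ω₁ τ
    · exact absurd (hX' z hzτ hzX) (not_le.2 hpos)
    · rw [h4 z hz (not_or.2 ⟨hz0, hzτ⟩)] at hpos
      exact absurd hpos (lt_irrefl _)
  · rw [meroZeros_eq hne X h2 hX', Set.encard_coe_eq_coe_finsetCard, h1]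
  · rintro z ⟨hz, hz0⟩
    by_contra hcon
    rw [isMeroZero_iff (hne z), h4 z hz hcon] at hz0
    exact lt_irrefl _ hz0
  · rw [← h1]
    exact exists_isSimpleZeroSet H hg.mem hne X
      (fun z hz => ⟨(h2 z hz).1, ne_zero_of_mem_horContour hτ (h2 z hz).1, (h2 z hz).2⟩) hX'

/-- The total order `-n` on `γ₁` is already accounted for by the pole at `0`. What remains adds up
to zero, which leaves at most a pole at `a` paired with a simple zero. -/
theorem zeros_upper_even (hω₁ : 0 < ω₁) (hτ : 0 < τ) (ha : a ∈ horContour ω₁ 0) (ha0 : a ≠ 0)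
    (hW : IsPosWeight ω₁ τ τ a W) (hg : IsOrthonormalEOP ω₁ τ τ W a n g) (hn : Even n) :
    (∀ z, IsMeroZero g z → IsSimpleMeroZero g z) ∧
    (meroZeros g (horContour ω₁ τ)).encard = n ∧
    ((∃ z ∈ horContour ω₁ 0, IsSimpleMeroZero g z) ↔ HasPoleAt g a) ∧
    (meroZeros g (horContour ω₁ 0)).encard ≤ 1 ∧
    meroZeros g (fundRect ω₁ τ) ⊆ horContour ω₁ 0 ∪ horContour ω₁ τ ∧
    ∃ A : Finset ℝ, A.card = n ∧ IsSimpleZeroSet ω₁ τ g A := by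
  have hne := hg.order_ne_top
  obtain ⟨h1, h2, h3, h4, h5⟩ := zeros_upper hω₁ hτ ha ha0 hW hg n hn le_rfl (by omega)
  have hΓ0 := horContour_zero_subset_fundRect (ω₁ := ω₁) hτ
  have hord0 := ordZ_eq_of_order hg.order_zero
  have halt := IsEllipticPoly.line_alternative
    (finite_support_ordZ hg.mem.meromorphic hne hΓ0) {0}
    (by simpa using zero_mem_horContour hω₁) ha (by simpa using ha0) (hg.mem.ordZ_anchor_ge hne)
    (fun z hz hz0 hza => hg.mem.ordZ_nonneg hω₁ hτ hne (hΓ0 ha) (hΓ0 hz) (by simpa using hz0) hza)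
    (by rw [h5, Finset.sum_singleton, hord0])
  simp only [Finset.mem_singleton] at halt
  obtain ⟨e1, e2, e3⟩ := zeros_of_alternative hne ha (fun z _ hz0 => by rw [hz0, hord0]; omega) ha0
    halt
  refine ⟨fun z hz => hg.isSimpleMeroZero hω₁ hτ (fun z hz hpos => ?_) hz, h2, e1, e2, h3, h4⟩
  by_cases hz0 : z ∈ horContour ω₁ 0
  · exact e3 z hz0 hpos
  · exact h1 z hz hz0 hpos

/-- The total order on `γ₁` is `-(n + 1)`, while `0` contributes `-n` and `a` at least `-1`. Hence
there is a pole at `a`, and no zero is left on `γ₁`. -/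
theorem zeros_upper_odd (hω₁ : 0 < ω₁) (hτ : 0 < τ) (ha : a ∈ horContour ω₁ 0) (ha0 : a ≠ 0)
    (hW : IsPosWeight ω₁ τ τ a W) (hg : IsOrthonormalEOP ω₁ τ τ W a n g) (hn : Odd n) :
    (∀ z, IsMeroZero g z → IsSimpleMeroZero g z) ∧
    (meroZeros g (horContour ω₁ τ)).encard = n + 1 ∧
    meroZeros g (fundRect ω₁ τ) ⊆ horContour ω₁ τ ∧
    HasPoleAt g a ∧
    ∃ A : Finset ℝ, A.card = n + 1 ∧ IsSimpleZeroSet ω₁ τ g A := by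
  have hne := hg.order_ne_top
  obtain ⟨h1, h2, h3, h4, h5⟩ := zeros_upper hω₁ hτ ha ha0 hW hg (n + 1) hn.add_one (by omega) le_rfl
  have hΓ0 := horContour_zero_subset_fundRect (ω₁ := ω₁) hτ
  have hord0 := ordZ_eq_of_order hg.order_zero
  have hanch := hg.mem.ordZ_anchor_ge hne
  have hnn : ∀ z ∈ horContour ω₁ 0, z ≠ 0 → z ≠ a → 0 ≤ ordZ g z := fun z hz hz0 hza =>
    hg.mem.ordZ_nonneg hω₁ hτ hne (hΓ0 ha) (hΓ0 hz) hz0 hza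
  have hsum : ∀ Y : Finset ℂ, (∀ z ∈ Y, z ∈ horContour ω₁ 0 ∧ z ≠ 0 ∧ z ≠ a) →
      -(n : ℤ) + (ordZ g a + ∑ z ∈ Y, ordZ g z) ≤ -((n + 1 : ℕ) : ℤ) := by
    intro Y hY
    have h6 := sum_le_finsum_mem (finite_support_ordZ hg.mem.meromorphic hne hΓ0)
      (insert 0 (insert a Y)) (by
        intro z hz
        rcases Finset.mem_insert.1 hz with rfl | hz
        · exact zero_mem_horContour hω₁
        rcases Finset.mem_insert.1 hz with rfl | hz
        exacts [ha, (hY z hz).1]) (by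
        intro z hz hzY
        exact hnn z hz (fun h => hzY (by simp [h])) (fun h => hzY (by simp [h])))
    rw [Finset.sum_insert, Finset.sum_insert (fun h => (hY a h).2.2 rfl), hord0, h5] at h6
    · exact h6
    · rw [Finset.mem_insert]
      rintro (h | h)
      exacts [ha0 h.symm, (hY 0 h).2.1 rfl]
  have ha1 := hsum ∅ (by simp)
  have hzero : ∀ z ∈ horContour ω₁ 0, ordZ g z ≤ 0 := by
    intro z hz
    by_cases hz0 : z = 0
    · rw [hz0, hord0]
      omega
    by_cases hza : z = a
    · rw [hza]
      simp at ha1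
      omega
    · have := hsum {z} (by simpa using ⟨hz, hz0, hza⟩)
      simp at this
      omega
  refine ⟨fun z hz => hg.isSimpleMeroZero hω₁ hτ (fun z hz hpos => ?_) hz, by simpa using h2, ?_, ?_,
    h4⟩
  · by_cases hz0 : z ∈ horContour ω₁ 0
    · exact absurd (hzero z hz0) (not_le.2 hpos)
    · exact h1 z hz hz0 hpos
  · intro z hz
    refine (h3 hz).resolve_left fun hz0 => ?_
    exact absurd (hzero z hz0) (not_le.2 ((isMeroZero_iff (hne z)).1 hz.2))
  · rw [hasPoleAt_iff (hne a)]
    simp at ha1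
    omega

/-- For `n` odd, `n + 1` is even and every nontrivial combination has exactly `n + 1` zeros on `γ₂`,
all simple. For `n` even, the required even bound `n + 2` would exceed what the orthogonality
supplies. -/
theorem strictlyInterlaces_upper (hω₁ : 0 < ω₁) (hτ : 0 < τ) (ha : a ∈ horContour ω₁ 0)
    (ha0 : a ≠ 0) (hW : IsPosWeight ω₁ τ τ a W) (hf : IsOrthonormalEOP ω₁ τ τ W a (n + 1) f)
    (hg : IsOrthonormalEOP ω₁ τ τ W a n g) (hn : Odd n) :
    StrictlyInterlaces (horContour ω₁ τ) f g ∨ StrictlyInterlaces (horContour ω₁ τ) g f := by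
  have H := OppositeAnchor.isAnchor hω₁ hτ (.inr ⟨rfl, ha, ha0⟩)
  obtain ⟨A, hAc, hA⟩ := (zeros_upper_even hω₁ hτ ha ha0 hW hf hn.add_one).2.2.2.2.2
  obtain ⟨B, hBc, hB⟩ := (zeros_upper_odd hω₁ hτ ha ha0 hW hg hn).2.2.2.2
  have hfr := (hf.conjSymm H hW).isRealOnLine hω₁ hτ hf.mem.isElliptic (.inr rfl)
  have hgr := (hg.conjSymm H hW).isRealOnLine hω₁ hτ hg.mem.isElliptic (.inr rfl)
  refine hA.strictlyInterlaces_or hB (fun t ht ht0 => ?_) hfr hgr (by rw [hAc, hBc])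
  refine wronskian_ne_zero (hA.analyticAt t ht ht0) (hB.analyticAt t ht ht0) hfr hgr
    fun α β hαβ => ?_
  obtain ⟨N, hN, h1, h2, h3, h4⟩ := hf.combination H hW hg α β hαβ
  have hne := order_ne_top_of_ne_top h1.meromorphic (z := 0) (by rw [h2]; exact WithTop.coe_ne_top)
  obtain ⟨X, -, h5, h6, -⟩ := exists_zeros_upper hω₁ hτ ha ha0 hW h1 hne h3 h4 (n + 1) hn.add_one hN
    le_rfl
  rw [← coe_ordZ (hne _), WithTop.coe_le_coe]
  by_cases hX : horPoint τ t ∈ X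
  · exact (h5 _ hX).2.le
  · rw [h6 _ ⟨by rwa [horPoint_re], horPoint_im _ _⟩ hX]
    norm_num

end

/-! ### Analytic dependence of the Gram matrix and the zeros on the anchor. -/

/-- Everything singular is kept in the fixed integrable factor `φ`. Differentiation under the
integral gives complex differentiability near `a`, hence analyticity. -/
lemma analyticAt_integral_mul {c : ℝ} (hc : 0 ≤ c) {φ : ℝ → ℂ}
    (hφ : IntervalIntegrable φ volume 0 c) {D D' : ℂ → ℝ → ℂ} {a : ℂ} {r : ℝ} (hr : 0 < r)
    (hD : ∀ b ∈ Metric.closedBall a r, ∀ t ∈ Set.Icc 0 c, HasDerivAt (D · t) (D' b t) b)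
    (hDc : ∀ b ∈ Metric.closedBall a r, ContinuousOn (D b) (Set.Icc 0 c))
    (hDc' : ContinuousOn (fun p : ℂ × ℝ => D' p.1 p.2) (Metric.closedBall a r ×ˢ Set.Icc 0 c)) :
    (∀ b ∈ Metric.closedBall a r, IntervalIntegrable (fun t => φ t * D b t) volume 0 c) ∧
      AnalyticAt ℂ (fun b => ∫ t in (0 : ℝ)..c, φ t * D b t) a := by
  have hint : ∀ {ψ : ℝ → ℂ}, ContinuousOn ψ (Set.Icc 0 c) →
      IntervalIntegrable (fun t => φ t * ψ t) volume 0 c := fun hψ =>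
    hφ.mul_continuousOn (by rwa [Set.uIcc_of_le hc])
  have h1 : ∀ b ∈ Metric.closedBall a r, IntervalIntegrable (fun t => φ t * D b t) volume 0 c :=
    fun b hb => hint (hDc b hb)
  refine ⟨h1, ?_⟩
  obtain ⟨C, hC⟩ := ((isCompact_closedBall a r).prod isCompact_Icc).exists_bound_of_continuousOn hDc'
  have hsub : Set.uIoc 0 c ⊆ Set.Icc 0 c := by
    rw [Set.uIoc_of_le hc]
    exact Set.Ioc_subset_Icc_self
  rw [Complex.analyticAt_iff_eventually_differentiableAt]
  filter_upwards [Metric.ball_mem_nhds a hr] with b hb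
  have hball : Metric.ball a r ∈ 𝓝 b := Metric.isOpen_ball.mem_nhds hb
  refine (intervalIntegral.hasDerivAt_integral_of_dominated_loc_of_deriv_le
    (F := fun b t => φ t * D b t) (F' := fun b t => φ t * D' b t) (bound := fun t => ‖φ t‖ * C)
    hball ?_ (h1 b (Metric.ball_subset_closedBall hb)) ?_ ?_ ?_ ?_).2.differentiableAt
  · filter_upwards [hball] with b' hb'
    exact (intervalIntegrable_iff.1 (h1 b' (Metric.ball_subset_closedBall hb'))).aestronglyMeasurable
  · exact (intervalIntegrable_iff.1 (hint (hDc'.comp (f := fun t => (b, t)) (by fun_prop)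
      fun t ht => ⟨Metric.ball_subset_closedBall hb, ht⟩))).aestronglyMeasurable
  · refine ae_of_all _ fun t ht b' hb' => ?_
    rw [norm_mul]
    exact mul_le_mul_of_nonneg_left (hC (b', t) ⟨Metric.ball_subset_closedBall hb', hsub ht⟩)
      (norm_nonneg _)
  · exact hφ.norm.mul_const C
  · exact ae_of_all _ fun t ht b' hb' =>
      (hD b' (Metric.ball_subset_closedBall hb') t (hsub ht)).const_mul _

section

variable {ω₁ τ h : ℝ} {a : ℂ} {W : ℂ → ℝ} {n : ℕ}

lemma IsAnchor.exists_closedBall (H : IsAnchor ω₁ τ h a) : ∃ r > 0, ∀ b ∈ Metric.closedBall a r,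
    ∀ t ∈ Set.Icc 0 (2 * ω₁), horPoint h t - b ∉ rectLattice ω₁ τ := by
  have hK : IsCompact ((fun t => horPoint h t - a) '' Set.Icc 0 (2 * ω₁)) :=
    isCompact_Icc.image ((continuous_horPoint h).sub continuous_const)
  obtain ⟨r, hr, hsub⟩ := hK.exists_cthickening_subset_open
    (isClosed_rectLattice H.pos₁ H.pos₂).isOpen_compl (by
      rintro _ ⟨t, -, rfl⟩
      exact H.sub_notMem t)
  refine ⟨r, hr, fun b hb t ht => hsub (Metric.mem_cthickening_of_dist_le _ (horPoint h t - a) _ _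
    ⟨t, ht, rfl⟩ ?_)⟩
  rwa [dist_sub_left, ← Metric.mem_closedBall]

/-- Changing the anchor from `a` to `b` alters only the basis function of index `1`, by `D = ζ(z -
a) - ζ(z - b)`, which is regular on the contour. The pairing is thus a polynomial in `D` under the
integral, with coefficients integrable by the hypothesis at `a` alone. -/
lemma IsAnchor.analyticAt_contourPairing_ellBasis (H : IsAnchor ω₁ τ h a)
    (hW : IsPosWeight ω₁ τ h a W) (j k : ℕ) :
    AnalyticAt ℂ (fun b => contourPairing ω₁ h W (ellBasis (rectPeriodPair H.pos₁ H.pos₂) b j)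
      (ellBasis (rectPeriodPair H.pos₁ H.pos₂) b k)) a := by
  set L := rectPeriodPair H.pos₁ H.pos₂ with hL
  obtain ⟨r, hr, hrΛ⟩ := H.exists_closedBall
  have h2 : (0 : ℝ) ≤ 2 * ω₁ := by linarith [H.pos₁]
  set D : ℂ → ℝ → ℂ := fun b t => L.zeta (horPoint h t - a) - L.zeta (horPoint h t - b) with hD
  set D' : ℂ → ℝ → ℂ := fun b t => -L.weierstrassP (horPoint h t - b) with hD'
  set κ : ℕ → ℂ := fun j => if j = 1 then 1 else 0 with hκ
  have hbasis : ∀ b ∈ Metric.closedBall a r, ∀ t ∈ Set.Ioo 0 (2 * ω₁), ∀ j,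
      ellBasis L b j (horPoint h t) = ellBasis L a j (horPoint h t) + κ j * D b t := by
    intro b hb t ht j
    match j with
    | 0 => simp [ellBasis, hκ]
    | 1 =>
      rw [ellBasis_one_of_notMem L b (H.horPoint_notMem ht) (hrΛ b hb t (Set.Ioo_subset_Icc_self ht)),
        ellBasis_one_of_notMem L a (H.horPoint_notMem ht) (H.sub_notMem t)]
      simp [hκ, hD]
    | j + 2 => simp [ellBasis, hκ]
  have hder : ∀ b ∈ Metric.closedBall a r, ∀ t ∈ Set.Icc 0 (2 * ω₁),
      HasDerivAt (D · t) (D' b t) b := by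
    intro b hb t ht
    have h3 := (L.hasDerivAt_zeta (hrΛ b hb t ht)).comp b ((hasDerivAt_id b).const_sub (horPoint h t))
    have h4 := h3.const_sub (L.zeta (horPoint h t - a))
    simp only [mul_neg, mul_one, neg_neg] at h4
    exact h4
  have hzc : ∀ b ∈ Metric.closedBall a r, ContinuousOn (fun t => L.zeta (horPoint h t - b))
      (Set.Icc 0 (2 * ω₁)) := fun b hb t ht =>
    (ContinuousAt.comp (f := fun t => horPoint h t - b) (L.analyticAt_zeta (hrΛ b hb t ht)).continuousAt
      ((continuous_horPoint h).sub continuous_const).continuousAt).continuousWithinAt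
  have hDc : ∀ b ∈ Metric.closedBall a r, ContinuousOn (D b) (Set.Icc 0 (2 * ω₁)) := fun b hb =>
    (hzc a (Metric.mem_closedBall_self hr.le)).sub (hzc b hb)
  have hcont2 : ∀ {ψ : ℂ → ℂ}, (∀ u, u ∉ L.lattice → AnalyticAt ℂ ψ u) →
      ContinuousOn (fun p : ℂ × ℝ => ψ (horPoint h p.2 - p.1))
        (Metric.closedBall a r ×ˢ Set.Icc 0 (2 * ω₁)) := fun hψ p hp =>
    (ContinuousAt.comp (f := fun p : ℂ × ℝ => horPoint h p.2 - p.1)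
      (hψ _ (hrΛ p.1 hp.1 p.2 hp.2)).continuousAt
      (((continuous_horPoint h).comp continuous_snd).sub continuous_fst).continuousAt).continuousWithinAt
  have hDc' : ContinuousOn (fun p : ℂ × ℝ => D' p.1 p.2)
      (Metric.closedBall a r ×ˢ Set.Icc 0 (2 * ω₁)) :=
    (hcont2 fun u hu => analyticAt_iterate_deriv_weierstrassP L 0 hu).neg
  have hDc2 : ContinuousOn (fun p : ℂ × ℝ => D p.1 p.2)
      (Metric.closedBall a r ×ˢ Set.Icc 0 (2 * ω₁)) :=
    ((hzc a (Metric.mem_closedBall_self hr.le)).comp continuousOn_snd fun p hp => hp.2).sub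
      (hcont2 fun u hu => L.analyticAt_zeta hu)
  set φ : ℕ → ℕ → ℝ → ℂ := fun j k t => ellBasis L a j (horPoint h t) *
    ellBasis L a k (horPoint h t) * (W (horPoint h t) : ℂ) with hφ
  have hφi : ∀ j k, IntervalIntegrable (φ j k) volume 0 (2 * ω₁) := fun j k =>
    hW.intervalIntegrable (ellBasis_mem H.pos₁ H.pos₂ H.notMem j)
      (ellBasis_mem H.pos₁ H.pos₂ H.notMem k)
  have hI1 := fun j k => analyticAt_integral_mul h2 (hφi j k) hr hder hDc hDc'
  have hI2 := analyticAt_integral_mul h2 (hφi 0 0) hr (D := fun b t => D b t * D b t)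
    (D' := fun b t => D' b t * D b t + D b t * D' b t)
    (fun b hb t ht => (hder b hb t ht).mul (hder b hb t ht))
    (fun b hb => (hDc b hb).mul (hDc b hb)) ((hDc'.mul hDc2).add (hDc2.mul hDc'))
  -- Expansion of `(e_j + κ_j D)(e_k + κ_k D) W`. Since `e_0 = 1`, the functions `φ j 0` and `φ 0 0`
  -- are `e_j W` and `W`.
  have heq : (fun b => (∫ t in (0 : ℝ)..(2 * ω₁), φ j k t) +
      κ k * (∫ t in (0 : ℝ)..(2 * ω₁), φ j 0 t * D b t) +
      κ j * (∫ t in (0 : ℝ)..(2 * ω₁), φ k 0 t * D b t) +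
      κ j * κ k * (∫ t in (0 : ℝ)..(2 * ω₁), φ 0 0 t * (D b t * D b t))) =ᶠ[𝓝 a]
      fun b => contourPairing ω₁ h W (ellBasis L b j) (ellBasis L b k) := by
    filter_upwards [Metric.closedBall_mem_nhds a hr] with b hb
    have i1 := ((hI1 j 0).1 b hb).const_mul (κ k)
    have i2 := ((hI1 k 0).1 b hb).const_mul (κ j)
    have i3 := (hI2.1 b hb).const_mul (κ j * κ k)
    rw [← intervalIntegral.integral_const_mul, ← intervalIntegral.integral_const_mul,
      ← intervalIntegral.integral_const_mul, ← intervalIntegral.integral_add (hφi j k) i1,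
      ← intervalIntegral.integral_add ((hφi j k).add i1) i2,
      ← intervalIntegral.integral_add (((hφi j k).add i1).add i2) i3, contourPairing]
    refine intervalIntegral_congr_Ioo h2 fun t ht => ?_
    rw [hbasis b hb t ht j, hbasis b hb t ht k]
    simp only [hφ, ellBasis]
    ring
  exact (((analyticAt_const.add (analyticAt_const.mul (hI1 j 0).2)).add
    (analyticAt_const.mul (hI1 k 0).2)).add (analyticAt_const.mul hI2.2)).congr heq

lemma IsAnchor.analyticAt_cramer_gramMatrix (H : IsAnchor ω₁ τ h a)
    (hW : IsPosWeight ω₁ τ h a W) (v : Fin (n + 1) → ℂ) (j : Fin (n + 1)) :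
    AnalyticAt ℂ (fun b => (gramMatrix (rectPeriodPair H.pos₁ H.pos₂) ω₁ h W b n).cramer v j) a := by
  simp only [Matrix.cramer_apply, Matrix.det_apply']
  refine Finset.analyticAt_fun_sum _ fun σ _ => analyticAt_const.mul
    (Finset.analyticAt_fun_prod _ fun i _ => ?_)
  by_cases hij : i = j
  · subst hij
    simp only [Matrix.updateCol_self]
    exact analyticAt_const
  · simp only [Matrix.updateCol_ne hij]
    exact H.analyticAt_contourPairing_ellBasis hW _ _

lemma analyticAt_ellBasis_prod (L : PeriodPair) {z : ℂ} (hz : z ∉ L.lattice)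
    (hza : z - a ∉ L.lattice) (j : ℕ) :
    AnalyticAt ℂ (fun p : ℂ × ℂ => ellBasis L p.1 j p.2) (a, z) := by
  match j with
  | 0 => exact analyticAt_const
  | 1 =>
    have h1 : AnalyticAt ℂ (fun p : ℂ × ℂ => L.zeta p.2 - L.zeta (p.2 - p.1)) (a, z) := by
      refine AnalyticAt.sub ?_ ?_
      · exact AnalyticAt.comp (f := fun p : ℂ × ℂ => p.2) (L.analyticAt_zeta hz) analyticAt_snd
      · exact AnalyticAt.comp (f := fun p : ℂ × ℂ => p.2 - p.1) (L.analyticAt_zeta hza)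
          (analyticAt_snd.sub analyticAt_fst)
    have hopen : IsOpen {w : ℂ | w ∉ L.lattice} := L.isClosed_lattice.isOpen_compl
    refine h1.congr ?_
    have h2 : ContinuousAt (fun p : ℂ × ℂ => p.2 - p.1) (a, z) :=
      (continuous_snd.sub continuous_fst).continuousAt
    filter_upwards [(continuousAt_snd (p := (a, z))).eventually (hopen.mem_nhds hz),
      h2.eventually (hopen.mem_nhds hza)] with p h3 h4
    exact (ellBasis_one_of_notMem L p.1 h3 h4).symm
  | j + 2 =>
    exact AnalyticAt.comp (f := fun p : ℂ × ℂ => p.2)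
      (analyticAt_iterate_deriv_weierstrassP L j hz) analyticAt_snd

lemma IsAnchor.analyticAt_gramEOP_prod (H : IsAnchor ω₁ τ h a) (hW : IsPosWeight ω₁ τ h a W)
    {z : ℂ} (hz : z ∉ rectLattice ω₁ τ) (hza : z - a ∉ rectLattice ω₁ τ) :
    AnalyticAt ℂ (fun p : ℂ × ℂ => gramEOP (rectPeriodPair H.pos₁ H.pos₂) ω₁ h W p.1 n p.2)
      (a, z) := by
  simp only [gramEOP, ellSum]
  have h1 : ∀ j, AnalyticAt ℂ (fun p : ℂ × ℂ =>
      (gramMatrix (rectPeriodPair H.pos₁ H.pos₂) ω₁ h W p.1 n).cramer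
        (Pi.single (Fin.last n) 1) j) (a, z) := fun j =>
    AnalyticAt.comp (f := fun p : ℂ × ℂ => p.1)
      (g := fun b => (gramMatrix (rectPeriodPair H.pos₁ H.pos₂) ω₁ h W b n).cramer
        (Pi.single (Fin.last n) 1) j) (H.analyticAt_cramer_gramMatrix hW _ j) analyticAt_fst
  have h2 : ∀ j : ℕ, AnalyticAt ℂ (fun p : ℂ × ℂ =>
      ellBasis (rectPeriodPair H.pos₁ H.pos₂) p.1 j p.2) (a, z) := fun j =>
    analyticAt_ellBasis_prod (rectPeriodPair H.pos₁ H.pos₂) hz hza j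
  exact Finset.analyticAt_fun_sum _ fun j _ => (h1 j).fun_mul (h2 j)

/-- The analytic implicit function theorem for a simple zero. -/
lemma exists_analyticAt_zero {Φ : ℂ × ℂ → ℂ} {a z : ℂ} (hΦ : AnalyticAt ℂ Φ (a, z))
    (h0 : Φ (a, z) = 0) (hd : deriv (fun w => Φ (a, w)) z ≠ 0) :
    ∃ ψ : ℂ → ℂ, AnalyticAt ℂ ψ a ∧ ψ a = z ∧ ∀ᶠ p in 𝓝 (a, z), Φ p = 0 ↔ ψ p.1 = p.2 := by
  have hc : ContDiffAt ℂ ⊤ Φ (a, z) := hΦ.contDiffAt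
  have hinv : (fderiv ℂ Φ (a, z) ∘L .inr ℂ ℂ ℂ).IsInvertible := by
    have h1 : HasFDerivAt (fun w => Φ (a, w)) (fderiv ℂ Φ (a, z) ∘L .inr ℂ ℂ ℂ) z :=
      HasFDerivAt.comp z (hΦ.differentiableAt.hasFDerivAt) (hasFDerivAt_prodMk_right a z)
    have h2 := h1.hasDerivAt.deriv
    rw [h2] at hd
    refine ⟨ContinuousLinearEquiv.unitsEquivAut ℂ (Units.mk0 _ hd), ?_⟩
    ext
    simp
  have htop : (⊤ : WithTop ℕ∞) ≠ 0 := by simp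
  refine ⟨hc.implicitFunction htop hinv, ?_, hc.implicitFunction_apply_self htop hinv, ?_⟩
  · exact (hc.contDiffAt_implicitFunction htop hinv).analyticAt
  · have := hc.eventually_apply_eq_iff_implicitFunction htop hinv
    rwa [h0] at this

lemma IsEllipticPoly.isMeroZero_iff_eq_zero {f : ℂ → ℂ} (hf : IsEllipticPoly ω₁ τ a n f) {z : ℂ}
    (hz : z ∉ rectLattice ω₁ τ) (hza : z - a ∉ rectLattice ω₁ τ) : IsMeroZero f z ↔ f z = 0 := by
  have h1 := hf.holomorphic z hz hza
  have h2 := h1.continuousAt.tendsto.mono_left (nhdsWithin_le_nhds (s := {z}ᶜ))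
  rw [IsMeroZero, ← tendsto_zero_iff_meromorphicOrderAt_pos h1.meromorphicAt]
  refine ⟨fun h => tendsto_nhds_unique h2 h, fun h => ?_⟩
  rwa [h] at h2

lemma IsOrthonormalEOP.exists_eq_gramEOP {f : ℂ → ℂ} (H : IsAnchor ω₁ τ h a)
    (hW : IsPosWeight ω₁ τ h a W) (hf : IsOrthonormalEOP ω₁ τ h W a n f) :
    ∃ c : ℂ, c ≠ 0 ∧ ∀ z, z ∉ rectLattice ω₁ τ → z - a ∉ rectLattice ω₁ τ →
      f z = c * gramEOP (rectPeriodPair H.pos₁ H.pos₂) ω₁ h W a n z := by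
  obtain ⟨c, hc, hlim⟩ := hf.leading_pos
  obtain ⟨d, hd, hdlim⟩ := H.exists_leading_gramEOP hW (n := n)
  exact ⟨c / d, div_ne_zero (by exact_mod_cast hc.ne') hd,
    hf.isOrthogonalEOP.eq_const_mul H hW (H.isOrthogonalEOP_gramEOP hW) hd hlim hdlim⟩

/-- Off the poles, `F s` is a nonzero multiple of the Gram function with anchor `α s`, so both have
the same zeros there. No regularity of `s ↦ F s` is needed: the implicit function theorem is applied
to the Gram function, jointly analytic in the anchor and the variable. -/
theorem zerosAnalyticAt_of_eventually {α : ℝ → ℂ} {s₀ : ℝ} (hα : AnalyticAt ℝ α s₀)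
    (F : ℝ → ℂ → ℂ) (hF : ∀ᶠ s in 𝓝 s₀, IsAnchor ω₁ τ h (α s) ∧ IsPosWeight ω₁ τ h (α s) W ∧
      IsOrthonormalEOP ω₁ τ h W (α s) n (F s))
    (hz : ∀ z, IsMeroZero (F s₀) z → IsSimpleMeroZero (F s₀) z ∧ z ∉ rectLattice ω₁ τ ∧
      z - α s₀ ∉ rectLattice ω₁ τ) : ZerosAnalyticAt F s₀ := by
  obtain ⟨H, hW, hF₀⟩ := hF.self_of_nhds
  intro z₀ hz₀
  obtain ⟨hsimple, hzΛ, hzaΛ⟩ := hz z₀ hz₀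
  set L := rectPeriodPair H.pos₁ H.pos₂ with hL
  set Φ : ℂ × ℂ → ℂ := fun p => gramEOP L ω₁ h W p.1 n p.2 with hΦ
  have hopen : IsOpen {w : ℂ | w ∉ rectLattice ω₁ τ} :=
    (isClosed_rectLattice H.pos₁ H.pos₂).isOpen_compl
  have hΦa : AnalyticAt ℂ Φ (α s₀, z₀) := H.analyticAt_gramEOP_prod hW hzΛ hzaΛ
  obtain ⟨c, hc, hcF⟩ := hF₀.exists_eq_gramEOP H hW
  have hev0 : F s₀ =ᶠ[𝓝 z₀] fun w => c * Φ (α s₀, w) := by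
    filter_upwards [hopen.mem_nhds hzΛ,
      (continuous_id.sub continuous_const).continuousAt.eventually (hopen.mem_nhds hzaΛ)] with w h1 h2
    exact hcF w h1 h2
  have hF0z := (hF₀.mem.isMeroZero_iff_eq_zero hzΛ hzaΛ).1 hz₀
  have hΦ0 : Φ (α s₀, z₀) = 0 := by
    have := hev0.eq_of_nhds
    rw [hF0z] at this
    exact (mul_eq_zero.1 this.symm).resolve_left hc
  have hd : deriv (fun w => Φ (α s₀, w)) z₀ ≠ 0 := by
    have h1 := (AnalyticAt.order_eq_one_iff (hF₀.mem.holomorphic z₀ hzΛ hzaΛ) hF0z).1 hsimple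
    rw [hev0.deriv_eq, deriv_const_mul_field] at h1
    exact right_ne_zero_of_mul h1
  obtain ⟨ψ, hψ, hψ0, hψiff⟩ := exists_analyticAt_zero hΦa hΦ0 hd
  have hαc : ContinuousAt (fun p : ℝ × ℂ => (α p.1, p.2)) (s₀, z₀) :=
    (ContinuousAt.comp (f := fun p : ℝ × ℂ => p.1) hα.continuousAt continuousAt_fst).prodMk
      continuousAt_snd
  -- Near `(s₀, z₀)` the variable also avoids the moving poles `α s + Λ`, so zeros are read off from
  -- values.
  have hkey : ∀ᶠ p : ℝ × ℂ in 𝓝 (s₀, z₀), IsMeroZero (F p.1) p.2 ↔ ψ (α p.1) = p.2 := by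
    have hF' : ∀ᶠ p : ℝ × ℂ in 𝓝 (s₀, z₀), IsAnchor ω₁ τ h (α p.1) ∧
        IsPosWeight ω₁ τ h (α p.1) W ∧ IsOrthonormalEOP ω₁ τ h W (α p.1) n (F p.1) :=
      (continuousAt_fst (p := (s₀, z₀))).eventually hF
    have h3 : ContinuousAt (fun p : ℝ × ℂ => p.2 - α p.1) (s₀, z₀) :=
      continuousAt_snd.sub
        (ContinuousAt.comp (f := fun p : ℝ × ℂ => p.1) hα.continuousAt continuousAt_fst)
    filter_upwards [hF', hαc.eventually hψiff,
      (continuousAt_snd (p := (s₀, z₀))).eventually (hopen.mem_nhds hzΛ),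
      h3.eventually (hopen.mem_nhds hzaΛ)] with p hp h4 h5 h6
    obtain ⟨H', hW', hFp⟩ := hp
    obtain ⟨c', hc', hcF'⟩ := hFp.exists_eq_gramEOP H' hW'
    rw [hFp.mem.isMeroZero_iff_eq_zero h5 h6, hcF' _ h5 h6, mul_eq_zero, or_iff_right hc']
    exact h4
  have hZ : AnalyticAt ℝ (fun s => ψ (α s)) s₀ := (hψ.restrictScalars (𝕜 := ℝ)).comp hα
  refine ⟨fun s => ψ (α s), hZ, hψ0, ?_, ?_⟩
  · have h7 : ContinuousAt (fun s => (s, ψ (α s))) s₀ := continuousAt_id.prodMk hZ.continuousAt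
    have h8 : ∀ᶠ p : ℝ × ℂ in 𝓝 (s₀, ψ (α s₀)), IsMeroZero (F p.1) p.2 ↔ ψ (α p.1) = p.2 := by
      rwa [hψ0]
    filter_upwards [h7.eventually h8] with s hs using hs.2 rfl
  · rw [nhds_prod_eq, eventually_prod_iff] at hkey
    obtain ⟨p, hp, q, hq, hpq⟩ := hkey
    exact ⟨{z | q z}, hq, hp.mono fun s hs z hz hzero => ((hpq hs hz).1 hzero).symm⟩

end

/-! ### Change of anchor modulo the lattice. -/

section

variable {ω₁ τ h : ℝ} {a b : ℂ} {W : ℂ → ℝ} {n : ℕ} {f : ℂ → ℂ}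

lemma IsPosWeight.congr_anchor (hba : b - a ∈ rectLattice ω₁ τ) (hW : IsPosWeight ω₁ τ h a W) :
    IsPosWeight ω₁ τ h b W :=
  have hab : a - b ∈ rectLattice ω₁ τ := by simpa using neg_mem hba
  ⟨hW.pos, fun m P Q hP hQ => hW.integrable m P Q (hP.congr_anchor hab) (hQ.congr_anchor hab)⟩

lemma IsOrthonormalEOP.congr_anchor (hba : b - a ∈ rectLattice ω₁ τ)
    (hf : IsOrthonormalEOP ω₁ τ h W a n f) : IsOrthonormalEOP ω₁ τ h W b n f :=
  have hab : a - b ∈ rectLattice ω₁ τ := by simpa using neg_mem hba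
  ⟨hf.mem.congr_anchor hba, fun m hm Q hQ => hf.orthogonal m hm Q (hQ.congr_anchor hab),
    hf.normalized, hf.leading_pos⟩

lemma exists_mem_horContour (hω₁ : 0 < ω₁) (h s : ℝ) :
    ∃ b ∈ horContour ω₁ h, b - horPoint h s ∈ rectLattice ω₁ τ := by
  have h2 : 0 < 2 * ω₁ := by linarith
  obtain ⟨k, hk, -⟩ := existsUnique_add_zsmul_mem_Ico h2 s 0
  refine ⟨horPoint h (s + k • (2 * ω₁)), ⟨by simpa [horPoint_re] using hk, horPoint_im _ _⟩, ?_⟩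
  rw [horPoint_add, add_sub_cancel_left, zsmul_eq_mul]
  exact horPoint_add_mem k

/-- The zeros avoid the poles of the whole family. -/
lemma IsOrthonormalEOP.notMem_of_isMeroZero (hf : IsOrthonormalEOP ω₁ τ h W a n f)
    (hsimple : ∀ z, IsMeroZero f z → IsSimpleMeroZero f z)
    (ha : IsSimpleMeroZero f a → HasPoleAt f a) {z : ℂ} (hz : IsMeroZero f z) :
    IsSimpleMeroZero f z ∧ z ∉ rectLattice ω₁ τ ∧ z - a ∉ rectLattice ω₁ τ := by
  refine ⟨hsimple z hz, fun hl => ?_, fun hl => ?_⟩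
  · rw [IsMeroZero, hf.mem.isElliptic.order_congr (w := 0) (by simpa using hl), hf.order_zero] at hz
    have : (0 : ℤ) < -(n : ℤ) := by exact_mod_cast hz
    omega
  · have hza : IsMeroZero f a := by
      rw [IsMeroZero, ← hf.mem.isElliptic.order_congr hl]
      exact hz
    exact lt_asymm hza (ha (hsimple a hza))

lemma analyticAt_horPoint (h s : ℝ) : AnalyticAt ℝ (horPoint h) s :=
  (Complex.ofRealCLM.analyticAt s).add analyticAt_const

theorem zerosAnalyticAt_lower (hω₁ : 0 < ω₁) (hτ : 0 < τ)
    (hW : ∀ s : ℝ, IsPosWeight ω₁ τ 0 (horPoint τ s) W) (F : ℝ → ℂ → ℂ)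
    (hF : ∀ s : ℝ, IsOrthonormalEOP ω₁ τ 0 W (horPoint τ s) n (F s)) (s₀ : ℝ) :
    ZerosAnalyticAt F s₀ := by
  refine zerosAnalyticAt_of_eventually (analyticAt_horPoint τ s₀) F
    (Eventually.of_forall fun s => ⟨IsAnchor.lower hω₁ hτ s, hW s, hF s⟩) fun z hz => ?_
  -- The count of zeros is available for anchors in one period of the line; spaces and orthogonality
  -- depend on the anchor only modulo `Λ`, so `s₀` is reduced modulo `2ω₁`.
  obtain ⟨b, hb, hbs⟩ := exists_mem_horContour (τ := τ) hω₁ τ s₀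
  have hFb := (hF s₀).congr_anchor hbs
  obtain ⟨h1, -, h2, -⟩ := zeros_lower hω₁ hτ hb ((hW s₀).congr_anchor hbs) hFb
  -- A zero at the anchor would be a simple zero on its line and hence force a pole there, which is
  -- absurd.
  obtain ⟨h3, h4, h5⟩ := hFb.notMem_of_isMeroZero h1 (fun h => h2.1 ⟨b, hb, h⟩) hz
  refine ⟨h3, h4, fun h => h5 ?_⟩
  simpa using sub_mem h hbs

theorem zerosAnalyticAt_upper (hω₁ : 0 < ω₁) (hτ : 0 < τ)
    (hW : ∀ s ∈ Set.Ioo 0 (2 * ω₁), IsPosWeight ω₁ τ τ (horPoint 0 s) W) (F : ℝ → ℂ → ℂ)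
    (hF : ∀ s ∈ Set.Ioo 0 (2 * ω₁), IsOrthonormalEOP ω₁ τ τ W (horPoint 0 s) n (F s)) {s₀ : ℝ}
    (hs₀ : s₀ ∈ Set.Ioo 0 (2 * ω₁)) : ZerosAnalyticAt F s₀ := by
  refine zerosAnalyticAt_of_eventually (ω₁ := ω₁) (τ := τ) (h := τ) (W := W) (n := n) (analyticAt_horPoint 0 s₀)
    F ?_ fun z hz => ?_
  · filter_upwards [isOpen_Ioo.mem_nhds hs₀] with s hs
    exact ⟨IsAnchor.upper hω₁ hτ hs, hW s hs, hF s hs⟩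
  · have ha : horPoint 0 s₀ ∈ horContour ω₁ 0 :=
      ⟨by rw [horPoint_re]; exact Set.Ioo_subset_Ico_self hs₀, horPoint_im _ _⟩
    have ha0 : horPoint 0 s₀ ≠ 0 := fun h =>
      hs₀.1.ne' (by simpa [horPoint_re] using congrArg Complex.re h)
    rcases Nat.even_or_odd n with hn | hn
    · obtain ⟨h1, -, h2, -⟩ := zeros_upper_even hω₁ hτ ha ha0 (hW s₀ hs₀) (hF s₀ hs₀) hn
      exact (hF s₀ hs₀).notMem_of_isMeroZero h1 (fun h => h2.1 ⟨_, ha, h⟩) hz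
    · obtain ⟨h1, -, -, h2, -⟩ := zeros_upper_odd hω₁ hτ ha ha0 (hW s₀ hs₀) (hF s₀ hs₀) hn
      exact (hF s₀ hs₀).notMem_of_isMeroZero h1 (fun _ => h2) hz

end

/-! ### The main theorem. -/

theorem mainTheorem1 (ω₁ τ : ℝ) (hω₁ : 0 < ω₁) (hτ : 0 < τ) (W : ℂ → ℝ) :
    -- the case `Γ = γ₁`, `a ∈ γ₂`
    (∀ a ∈ horContour ω₁ τ, IsPosWeight ω₁ τ 0 a W →
      (∀ n, ∃ g, IsOrthonormalEOP ω₁ τ 0 W a n g) ∧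
      ∀ f : ℕ → ℂ → ℂ, (∀ n, IsOrthonormalEOP ω₁ τ 0 W a n (f n)) → ∀ n,
        (∀ z, IsMeroZero (f n) z → IsSimpleMeroZero (f n) z) ∧
        (meroZeros (f n) (horContour ω₁ 0)).encard = n ∧
        ((∃ z ∈ horContour ω₁ τ, IsSimpleMeroZero (f n) z) ↔ HasPoleAt (f n) a) ∧
        (meroZeros (f n) (horContour ω₁ τ)).encard ≤ 1 ∧
        meroZeros (f n) (fundRect ω₁ τ) ⊆ horContour ω₁ 0 ∪ horContour ω₁ τ ∧
        StrictlyInterlaces (horContour ω₁ 0) (f (n + 1)) (f n)) ∧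
    -- the case `Γ = γ₂`, `a ∈ γ₁ \ {0}`
    (∀ a ∈ horContour ω₁ 0, a ≠ 0 → IsPosWeight ω₁ τ τ a W →
      (∀ n, ∃ g, IsOrthonormalEOP ω₁ τ τ W a n g) ∧
      ∀ f : ℕ → ℂ → ℂ, (∀ n, IsOrthonormalEOP ω₁ τ τ W a n (f n)) → ∀ n,
        (∀ z, IsMeroZero (f n) z → IsSimpleMeroZero (f n) z) ∧
        (Even n →
          (meroZeros (f n) (horContour ω₁ τ)).encard = n ∧
          ((∃ z ∈ horContour ω₁ 0, IsSimpleMeroZero (f n) z) ↔ HasPoleAt (f n) a) ∧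
          (meroZeros (f n) (horContour ω₁ 0)).encard ≤ 1 ∧
          meroZeros (f n) (fundRect ω₁ τ) ⊆ horContour ω₁ 0 ∪ horContour ω₁ τ) ∧
        (Odd n →
          (meroZeros (f n) (horContour ω₁ τ)).encard = n + 1 ∧
          meroZeros (f n) (fundRect ω₁ τ) ⊆ horContour ω₁ τ ∧
          HasPoleAt (f n) a ∧
          (StrictlyInterlaces (horContour ω₁ τ) (f n) (f (n + 1)) ∨
            StrictlyInterlaces (horContour ω₁ τ) (f (n + 1)) (f n)))) ∧
    -- analytic dependence of the zeros on `a = s + iτ`, `s ∈ ℝ`, for `Γ = γ₁`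
    ((∀ s : ℝ, IsPosWeight ω₁ τ 0 (horPoint τ s) W) →
      ∀ (n : ℕ) (F : ℝ → ℂ → ℂ),
        (∀ s : ℝ, IsOrthonormalEOP ω₁ τ 0 W (horPoint τ s) n (F s)) →
        ∀ s₀ : ℝ, ZerosAnalyticAt F s₀) ∧
    -- analytic dependence of the zeros on `a = s`, `0 < s < 2ω₁`, for `Γ = γ₂`
    ((∀ s ∈ Set.Ioo 0 (2 * ω₁), IsPosWeight ω₁ τ τ (horPoint 0 s) W) →
      ∀ (n : ℕ) (F : ℝ → ℂ → ℂ),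
        (∀ s ∈ Set.Ioo 0 (2 * ω₁), IsOrthonormalEOP ω₁ τ τ W (horPoint 0 s) n (F s)) →
        ∀ s₀ ∈ Set.Ioo 0 (2 * ω₁), ZerosAnalyticAt F s₀) := by
  refine ⟨fun a ha hW => ⟨fun n => ?_, fun f hf n => ?_⟩, fun a ha ha0 hW =>
    ⟨fun n => ?_, fun f hf n => ?_⟩, fun hW n F hF s₀ => zerosAnalyticAt_lower hω₁ hτ hW F hF s₀,
    fun hW n F hF s₀ hs₀ => zerosAnalyticAt_upper hω₁ hτ hW F hF hs₀⟩
  · exact (OppositeAnchor.isAnchor hω₁ hτ (.inl ⟨rfl, ha⟩)).exists_isOrthonormalEOP hW n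
  · obtain ⟨h1, h2, h3, h4, h5, -⟩ := zeros_lower hω₁ hτ ha hW (hf n)
    exact ⟨h1, h2, h3, h4, h5, strictlyInterlaces_lower hω₁ hτ ha hW (hf (n + 1)) (hf n)⟩
  · exact (OppositeAnchor.isAnchor hω₁ hτ (.inr ⟨rfl, ha, ha0⟩)).exists_isOrthonormalEOP hW n
  · rcases Nat.even_or_odd n with hn | hn
    · obtain ⟨h1, h2, h3, h4, h5, -⟩ := zeros_upper_even hω₁ hτ ha ha0 hW (hf n) hn
      exact ⟨h1, fun _ => ⟨h2, h3, h4, h5⟩, fun hodd => absurd hn (Nat.not_even_iff_odd.2 hodd)⟩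
    · obtain ⟨h1, h2, h3, h4, -⟩ := zeros_upper_odd hω₁ hτ ha ha0 hW (hf n) hn
      exact ⟨h1, fun heven => absurd heven (Nat.not_even_iff_odd.2 hn), fun _ => ⟨h2, h3, h4,
        (strictlyInterlaces_upper hω₁ hτ ha ha0 hW (hf (n + 1)) (hf n) hn).symm⟩⟩
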